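/- By reals we mean elements of the Cantor space $2^\omega$, identified with subsets of $\omega$. Let $\mathsf{AC}_\omega(\mathbb R)$ be the axiom of countable choice for nonempty sets of reals. Blackwell determinacy. Let $\mathrm{Prob}(\omega)$ be the set of functions $p\colon\omega\to[0,1]$ with $\sum_{k}p(k)=1$. A mixed strategy $\sigma$ for player I (resp. $\tau$ for player II) assigns an element of $\mathrm{Prob}(\omega)$ to every finite sequence of natural numbers of even (resp. odd) length. Put $\nu(s)=\sigma(s)$ if $s$ has even length and $\nu(s)=\tau(s)$ otherwise, and let $\mu_{\sigma,\tau}$ be the unique Borel probability on $\omega^\omega$ with $\mu_{\sigma,\tau}(\{x : x\supseteq s\})=\prod_{i<\mathrm{lh}(s)}\nu(s{\restriction} i)(s(i))$ for every finite sequence $s$. A set $A\subseteq\omega^\omega$ is Blackwell-determined if either there is $\sigma$ such that for all $\tau$ the set $A$ is $\mu_{\sigma,\tau}$-measurable with $\mu_{\sigma,\tau}(A)=1$, or there is $\tau$ such that for all $\sigma$ the set $A$ is $\mu_{\sigma,\tau}$-measurable with $\mu_{\sigma,\tau}(A)=0$. The axiom $\mathsf{Bl\text{-}AD}$ states that every subset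 of $\omega^\omega$ is Blackwell-determined. Relative definability. For sets of reals $A,B$ and $n\ge 1$, $B$ is boldface $\Sigma^1_n$ in $A$ if for some $\Sigma^1_n$ formula $\varphi$ and some real $z$, $B$ is the set of reals $x$ such that $\varphi(x,z)$ holds in the second-order structure $(\omega,\wp(\omega),0,1,+,\times,\in,A)$, in which $A$ is a unary predicate on $\wp(\omega)$. Lemma (weak version of Wadge's Lemma). The theory $\mathsf{ZF}+\mathsf{AC}_\omega(\mathbb R)+\mathsf{Bl\text{-}AD}$ proves that for any two sets of reals $A$ and $B$, either $A$ is boldface $\Sigma^1_2$ in $B$ or $B$ is boldface $\Sigma^1_2$ in $A$. Equivalently: if $M$ is any model of $\mathsf{ZF}+\mathsf{AC}_\omega(\mathbb R)+\mathsf{Bl\text{-}AD}$, then for all $A,B\in M$ that are sets of reals in $M$, either $A$ is boldface $\Sigma^1_2$ in $B$ or $B$ is boldface $\Sigma^1_2$ in $A$, in the sense of $M$. -/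

import Mathlib

/-!
Bl-AD contradicts the full axiom of choice, so it is studied over the base theory
ZF + (countable choice for sets of reals). Accordingly the statement is about an arbitrary
model `M` of ZF: a type with a binary membership relation satisfying the axioms of ZF. All notions
(natural numbers, reals, sets of reals, mixed strategies, Borel probabilities, ...) are those of
`M`, i.e. every quantifier over them ranges only over objects which are represented by elements of
`M` (the `Internal` objects below).
-/

universe u v w

/-! ### Models of ZF -/

namespace SetModel

/-- The unique non-logical symbol of the language of set theory. -/
inductive MemSymbol : ℕ → Type
  | mem : MemSymbol 2

/-- The first-order language of set theory. -/
def language : FirstOrder.Language := ⟨fun _ => Empty, MemSymbol⟩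

/-- A type with a membership relation is a structure for the language of set theory. -/
instance structureOfMem (M : Type u) [Membership M M] : language.Structure M where
  funMap := fun f => Empty.elim f
  RelMap := fun {_} r => match r with
    | MemSymbol.mem => fun v => v 0 ∈ v 1

variable {M : Type u} [Membership M M]

/-- `p = {x, y}`. -/
def IsUPair (p x y : M) : Prop := ∀ z : M, z ∈ p ↔ z = x ∨ z = y

/-- `p = (x, y)`, the Kuratowski pair `{{x}, {x, y}}`. -/
def IsPair (p x y : M) : Prop := ∃ a b : M, IsUPair a x x ∧ IsUPair b x y ∧ IsUPair p a b

/-- `a = ∅`. -/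
def IsEmptySet (a : M) : Prop := ∀ z : M, z ∉ a

/-- `b = a ∪ {a}`. -/
def IsSucc (b a : M) : Prop := ∀ z : M, z ∈ b ↔ z ∈ a ∨ z = a

/-- `w` contains the empty set and is closed under successors. -/
def IsInductive (w : M) : Prop :=
  (∀ e : M, IsEmptySet e → e ∈ w) ∧ ∀ a : M, a ∈ w → ∀ b : M, IsSucc b a → b ∈ w

/-- `w = ω`, the least inductive set. -/
def IsOmega (w : M) : Prop :=
  IsInductive w ∧ ∀ v : M, IsInductive v → ∀ z : M, z ∈ w → z ∈ v

/-- `M` is a model of ZF. The schemas of separation and replacement are stated for the relations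
which are first-order definable over `M` with parameters from `M`. -/
structure IsZF (M : Type u) [Membership M M] : Prop where
  extensionality : ∀ a b : M, (∀ z : M, z ∈ a ↔ z ∈ b) → a = b
  foundation : ∀ a : M, (∃ x : M, x ∈ a) → ∃ x : M, x ∈ a ∧ ∀ y : M, y ∈ x → y ∉ a
  pairing : ∀ x y : M, ∃ p : M, IsUPair p x y
  union : ∀ a : M, ∃ b : M, ∀ z : M, z ∈ b ↔ ∃ c : M, c ∈ a ∧ z ∈ c
  powerset : ∀ a : M, ∃ b : M, ∀ c : M, c ∈ b ↔ ∀ z : M, z ∈ c → z ∈ a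
  infinity : ∃ w : M, (∃ e : M, IsEmptySet e ∧ e ∈ w) ∧
    ∀ a : M, a ∈ w → ∃ b : M, IsSucc b a ∧ b ∈ w
  separation : ∀ D : Set M, (Set.univ : Set M).Definable₁ language D →
    ∀ a : M, ∃ b : M, ∀ x : M, x ∈ b ↔ x ∈ a ∧ x ∈ D
  replacement : ∀ D : Set (M × M), (Set.univ : Set M).Definable₂ language D →
    ∀ a : M, (∀ x : M, x ∈ a → ∃! y : M, (x, y) ∈ D) →
      ∃ b : M, ∀ y : M, y ∈ b ↔ ∃ x : M, x ∈ a ∧ (x, y) ∈ D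

/-! ### Objects represented by elements of the model -/

/-- `IsCode t m` says that the element `m` of the model `M` represents the object `t`. -/
class Coded (M : Type u) (T : Type v) where
  IsCode : T → M → Prop

/-- `t` is an object of the model `M`: some element of `M` represents it. -/
def Internal (M : Type u) {T : Type v} [Coded M T] (t : T) : Prop := ∃ m : M, Coded.IsCode t m

/-- An element of `M` represents itself. -/
instance codedSelf : Coded M M := ⟨fun x m => x = m⟩

instance codedSubtype {T : Type v} [Coded M T] {p : T → Prop} : Coded M {x : T // p x} :=
  ⟨fun x m => Coded.IsCode x.1 m⟩

/-- A pair is represented by the ordered pair, in `M`, of its components. -/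
instance codedSigma {S : Type v} {T : S → Type w} [Coded M S] [∀ x, Coded M (T x)] :
    Coded M (Sigma T) :=
  ⟨fun x p => ∃ a b : M, Coded.IsCode x.1 a ∧ Coded.IsCode x.2 b ∧ IsPair p a b⟩

/-- A pair is represented by the ordered pair, in `M`, of its components. -/
instance codedProd {S : Type v} {T : Type w} [Coded M S] [Coded M T] : Coded M (S × T) :=
  ⟨fun x p => ∃ a b : M, Coded.IsCode x.1 a ∧ Coded.IsCode x.2 b ∧ IsPair p a b⟩

/-- A set of objects of `M` is represented by the element of `M` whose elements are the
representatives of its elements. -/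
instance codedSet {T : Type v} [Coded M T] : Coded M (Set T) :=
  ⟨fun X a => (∀ x ∈ X, Internal M x) ∧ ∀ m : M, m ∈ a ↔ ∃ x ∈ X, Coded.IsCode x m⟩

/-- A function between objects of `M` is represented by its graph in `M`. -/
instance codedFun {S : Type v} {T : Type w} [Coded M S] [Coded M T] : Coded M (S → T) :=
  ⟨fun F f => (∀ x, Internal M (x, F x)) ∧ ∀ p : M, p ∈ f ↔ ∃ x, Coded.IsCode (x, F x) p⟩

/-- The type of elements, in the sense of `M`, of `a`. -/
abbrev El (a : M) : Type u := {x : M // x ∈ a}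

/-! ### Natural numbers, real numbers and points of the Cantor and Baire spaces of the model -/

/-- The natural numbers `ω` of the model `M` with their arithmetic. All of these data exist and are
uniquely determined in every model of ZF. -/
structure Naturals (M : Type u) [Membership M M] where
  omega : M
  isOmega : IsOmega omega
  zero : El omega
  isEmptySet_zero : IsEmptySet zero.1
  succ : El omega → El omega
  isSucc_succ : ∀ n, IsSucc (succ n).1 n.1
  add : El omega × El omega → El omega
  internal_add : Internal M add
  add_zero : ∀ m, add (m, zero) = m
  add_succ : ∀ m n, add (m, succ n) = succ (add (m, n))
  mul : El omega × El omega → El omega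
  internal_mul : Internal M mul
  mul_zero : ∀ m, mul (m, zero) = zero
  mul_succ : ∀ m n, mul (m, succ n) = add (mul (m, n), m)

/-- The real line of the model `M`: an ordered field in `M` in which every nonempty set bounded above
has a least upper bound (all in the sense of `M`). It exists in every model of ZF and is unique
up to a unique isomorphism. -/
structure RealLine (M : Type u) [Membership M M] where
  carrier : M
  field : Field (El carrier)
  linearOrder : LinearOrder (El carrier)
  isStrictOrderedRing : IsStrictOrderedRing (El carrier)
  internal_add : Internal M (fun x : El carrier × El carrier => x.1 + x.2)
  internal_mul : Internal M (fun x : El carrier × El carrier => x.1 * x.2)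
  internal_le : Internal M {x : El carrier × El carrier | x.1 ≤ x.2}
  exists_isLUB : ∀ X : Set (El carrier), Internal M X → X.Nonempty → BddAbove X → ∃ r, IsLUB X r

/-- The numbers in a real line of `M`. -/
abbrev RealLine.Num (R : RealLine M) : Type u := El R.carrier

noncomputable instance (R : RealLine M) : Field R.Num := R.field

noncomputable instance (R : RealLine M) : LinearOrder R.Num := R.linearOrder

instance (R : RealLine M) : IsStrictOrderedRing R.Num := R.isStrictOrderedRing

namespace Naturals

variable (W : Naturals M)

/-- The natural numbers of the model. -/
abbrev Nat : Type u := El W.omega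

/-- The order of the natural numbers, which are von Neumann ordinals. -/
def Lt (m n : W.Nat) : Prop := m.1 ∈ n.1

def IsEven (n : W.Nat) : Prop := ∃ k : W.Nat, n = W.add (k, k)

/-- The reals of the model: elements of the Cantor space `2^ω`, identified with the subsets of
`ω`. -/
abbrev Real : Type u := {X : Set W.Nat // Internal M X}

/-- The Baire space `ω^ω` of the model. -/
abbrev Baire : Type u := {x : W.Nat → W.Nat // Internal M x}

/-- The finite sequences of natural numbers of the model: pairs of a length `n` and a function from
`{i | i < n}` to `ω`. -/
abbrev FinSeq : Type u := {s : Σ n : W.Nat, ({i : W.Nat // W.Lt i n} → W.Nat) // Internal M s}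

/-- The length of a finite sequence. -/
abbrev lh (s : W.FinSeq) : W.Nat := s.1.1

/-- The basic open set `[s]` of all `x ∈ ω^ω` extending `s`. -/
def cone (s : W.FinSeq) : Set W.Baire := {x | ∀ i, x.1 i.1 = s.1.2 i}

/-- Countable choice for sets of reals, in the model. -/
def CountableChoiceReals : Prop :=
  ∀ F : W.Nat → Set W.Real, Internal M F → (∀ n, (F n).Nonempty) →
    ∃ f : W.Nat → W.Real, Internal M f ∧ ∀ n, f n ∈ F n

/-! ### Borel probabilities on the Baire space of the model -/

/-- `U` is open in the product topology of `ω^ω`. -/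
def IsOpenSet (U : Set W.Baire) : Prop :=
  ∀ x ∈ U, ∃ s : W.FinSeq, x ∈ W.cone s ∧ W.cone s ⊆ U

/-- `K` is, in the model, a σ-algebra of subsets of `ω^ω`. -/
structure IsSigmaAlgebra (K : Set (Set W.Baire)) : Prop where
  internal : Internal M K
  empty_mem : ∅ ∈ K
  compl_mem : ∀ S ∈ K, Sᶜ ∈ K
  iUnion_mem : ∀ F : W.Nat → Set W.Baire, Internal M F → (∀ n, F n ∈ K) → (⋃ n, F n) ∈ K

/-- `S` is, in the model, a Borel subset of `ω^ω`: it lies in every σ-algebra containing the open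
sets. -/
def IsBorel (S : Set W.Baire) : Prop :=
  Internal M S ∧ ∀ K : Set (Set W.Baire), W.IsSigmaAlgebra K →
    (∀ U : Set W.Baire, Internal M U → W.IsOpenSet U → U ∈ K) → S ∈ K

variable (R : RealLine M)

/-- `l` is the sum of the series of nonnegative terms `f`, i.e. the supremum of its partial
sums. -/
def SumsTo (f : W.Nat → R.Num) (l : R.Num) : Prop :=
  ∃ S : W.Nat → R.Num, Internal M S ∧ S W.zero = 0 ∧ (∀ n, S (W.succ n) = S n + f n) ∧
    IsLUB (Set.range S) l

/-- `μ` is, in the model, a Borel probability on `ω^ω`; only the values of `μ` at Borel sets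
matter. -/
structure IsBorelProbability (μ : Set W.Baire → R.Num) : Prop where
  internal : Internal M (fun S : {S : Set W.Baire // W.IsBorel S} => μ S.1)
  nonneg : ∀ S, W.IsBorel S → 0 ≤ μ S
  univ : μ Set.univ = 1
  iUnion : ∀ F : W.Nat → Set W.Baire, Internal M F → (∀ n, W.IsBorel (F n)) →
    (∀ m n, m ≠ n → Disjoint (F m) (F n)) → W.SumsTo R (fun n => μ (F n)) (μ (⋃ n, F n))

/-- `A` is measurable with respect to the completion of the Borel probability `μ`, and has
measure `r`. -/
def HasMeasure (μ : Set W.Baire → R.Num) (A : Set W.Baire) (r : R.Num) : Prop :=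
  ∃ S T : Set W.Baire, W.IsBorel S ∧ W.IsBorel T ∧ S ⊆ A ∧ A ⊆ T ∧ μ (T \ S) = 0 ∧ μ S = r

/-! ### Blackwell games on the natural numbers of the model -/

/-- The functions from `ω` to `[0, 1]` of the model with sum `1`. -/
abbrev Prob : Type u :=
  {p : W.Nat → R.Num // Internal M p ∧ (∀ k, 0 ≤ p k ∧ p k ≤ 1) ∧ W.SumsTo R p 1}

/-- Mixed strategies for player I: functions on the positions of even length. -/
abbrev MixedI : Type u := {σ : {s : W.FinSeq // W.IsEven (W.lh s)} → W.Prob R // Internal M σ}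

/-- Mixed strategies for player II: functions on the positions of odd length. -/
abbrev MixedII : Type u := {τ : {s : W.FinSeq // ¬ W.IsEven (W.lh s)} → W.Prob R // Internal M τ}

variable {R}

open Classical in
/-- The distribution of the next move at a position, given mixed strategies of both players. -/
noncomputable def next (σ : W.MixedI R) (τ : W.MixedII R) (s : W.FinSeq) : W.Prob R :=
  if h : W.IsEven (W.lh s) then σ.1 ⟨s, h⟩ else τ.1 ⟨s, h⟩

/-- `μ = μ_{σ,τ}`, the unique Borel probability for which the measure of `[s]` is the product of
the probabilities of the moves `s(i)` at the positions `s ↾ i` for `i < lh(s)`. This product is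
written in its recursive form: for a finite sequence `s` and a number `k`, the measure of `[s⌢k]`
is that of `[s]` times the probability of the move `k` at `s` (for the empty sequence, `[s]` is
the whole space, of measure `1`). -/
structure IsOutcome (σ : W.MixedI R) (τ : W.MixedII R) (μ : Set W.Baire → R.Num) : Prop where
  isBorelProbability : W.IsBorelProbability R μ
  step : ∀ (s : W.FinSeq) (k : W.Nat),
    μ {x | x ∈ W.cone s ∧ x.1 (W.lh s) = k} = μ (W.cone s) * (W.next σ τ s).1 k

/-- `σ` is optimal in `A` for player I. -/
def OptimalI (A : Set W.Baire) (σ : W.MixedI R) : Prop :=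
  ∀ τ : W.MixedII R, ∃ μ, W.IsOutcome σ τ μ ∧ W.HasMeasure R μ A 1

/-- `τ` is optimal in `A` for player II. -/
def OptimalII (A : Set W.Baire) (τ : W.MixedII R) : Prop :=
  ∀ σ : W.MixedI R, ∃ μ, W.IsOutcome σ τ μ ∧ W.HasMeasure R μ A 0

variable (R) in
def BlackwellDetermined (A : Set W.Baire) : Prop :=
  (∃ σ : W.MixedI R, W.OptimalI A σ) ∨ ∃ τ : W.MixedII R, W.OptimalII A τ

/-- The axiom Bl-AD in the model: every subset of `ω^ω` is Blackwell-determined. -/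
def BlAD : Prop :=
  ∃ R : RealLine M, ∀ A : Set W.Baire, Internal M A → W.BlackwellDetermined R A

end Naturals

/-! ### Definability in second-order arithmetic with a predicate for a set of reals -/

/-- Terms for natural numbers. -/
inductive NumTerm : Type
  | var (i : ℕ)
  | zero
  | one
  | add (s t : NumTerm)
  | mul (s t : NumTerm)

/-- Formulas of second-order arithmetic with an additional unary predicate on sets of natural
numbers. There are number variables and set variables, both indexed by `ℕ`. -/
inductive SOFormula : Type
  | eq (s t : NumTerm)
  | mem (t : NumTerm) (j : ℕ)
  | pred (j : ℕ)
  | neg (φ : SOFormula)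
  | and (φ ψ : SOFormula)
  | allNum (i : ℕ) (φ : SOFormula)
  | allSet (j : ℕ) (φ : SOFormula)
  | exSet (j : ℕ) (φ : SOFormula)

namespace SOFormula

/-- The arithmetical formulas: those without quantifiers over sets. -/
def Arithmetical : SOFormula → Prop
  | eq _ _ => True
  | mem _ _ => True
  | pred _ => True
  | neg φ => φ.Arithmetical
  | and φ ψ => φ.Arithmetical ∧ ψ.Arithmetical
  | allNum _ φ => φ.Arithmetical
  | allSet _ _ => False
  | exSet _ _ => False

mutual

/-- `Σ¹ₙ` formulas: `n` alternating set quantifiers, the first one existential, followed by an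
arithmetical formula. -/
inductive IsSigma : ℕ → SOFormula → Prop
  | base {φ : SOFormula} : φ.Arithmetical → IsSigma 0 φ
  | ex {n : ℕ} {φ : SOFormula} (j : ℕ) : IsPi n φ → IsSigma (n + 1) (exSet j φ)

/-- `Π¹ₙ` formulas: `n` alternating set quantifiers, the first one universal, followed by an
arithmetical formula. -/
inductive IsPi : ℕ → SOFormula → Prop
  | base {φ : SOFormula} : φ.Arithmetical → IsPi 0 φ
  | all {n : ℕ} {φ : SOFormula} (j : ℕ) : IsSigma n φ → IsPi (n + 1) (allSet j φ)

end

end SOFormula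

namespace Naturals

variable (W : Naturals M)

/-- The value of a term under an assignment to the number variables. -/
def value (e : ℕ → W.Nat) : NumTerm → W.Nat
  | NumTerm.var i => e i
  | NumTerm.zero => W.zero
  | NumTerm.one => W.succ W.zero
  | NumTerm.add s t => W.add (value e s, value e t)
  | NumTerm.mul s t => W.mul (value e s, value e t)

/-- Satisfaction in the structure `(ω, ℘(ω), 0, 1, +, ×, ∈, A)` of the model, under assignments `e`
to the number variables and `E` to the set variables. -/
def Holds (A : Set W.Real) : (ℕ → W.Nat) → (ℕ → W.Real) → SOFormula → Prop
  | e, _, SOFormula.eq s t => W.value e s = W.value e t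
  | e, E, SOFormula.mem t j => W.value e t ∈ (E j).1
  | _, E, SOFormula.pred j => E j ∈ A
  | e, E, SOFormula.neg φ => ¬ Holds A e E φ
  | e, E, SOFormula.and φ ψ => Holds A e E φ ∧ Holds A e E ψ
  | e, E, SOFormula.allNum i φ => ∀ n : W.Nat, Holds A (Function.update e i n) E φ
  | e, E, SOFormula.allSet j φ => ∀ X : W.Real, Holds A e (Function.update E j X) φ
  | e, E, SOFormula.exSet j φ => ∃ X : W.Real, Holds A e (Function.update E j X) φ

/-- `B` is boldface `Σ¹ₙ` in `A`: for some `Σ¹ₙ` formula and some real `z`, `B` is the set of the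
reals `x` such that the formula holds in `(ω, ℘(ω), 0, 1, +, ×, ∈, A)` when the set variable `0`
denotes `x` and all other free set variables denote the parameter `z` (and free number variables
denote `0`). -/
def BoldSigmaIn (n : ℕ) (B A : Set W.Real) : Prop :=
  ∃ (φ : SOFormula) (z : W.Real), SOFormula.IsSigma n φ ∧
    ∀ x : W.Real, x ∈ B ↔ W.Holds A (fun _ => W.zero) (fun j => if j = 0 then x else z) φ

end Naturals

end SetModel

/-!
Consider the game in which player I plays the digits of a real `x`, player II those of a real `y`,
and player I wins if `x ∈ A ↔ y ∈ B` fails. Let `τ` be an optimal mixed strategy of player II. When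
player I purely plays a real `z`, the strategy `τ` almost surely answers by a real `y` with
`z ∈ A ↔ y ∈ B`. Hence the set of plays answering `z` by some `y ∉ B` is null if `z ∈ A`, and has
measure one if `z ∉ A`. So `z ∈ A` if and only if there is a set `X` of cylinders of total measure at most `1/2`
which cover every play of `z` against a real `y ∉ B`. This condition has the form `∃ X, ∀ y`,
followed by a condition which is arithmetical in `B`, so `A` is boldface `Σ¹₂` in `B`. An optimal
strategy of player I almost surely answers `z` by a real `y` with `z ∈ B ↔ y ∉ A`, and the same
argument shows that `B` is boldface `Σ¹₂` in `A`. The two directions of the equivalence are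
`not_witnesses_of_notMem` and `exists_witnesses_of_mem`. The second one needs that null sets are
covered by open sets of small measure (`exists_openSet_of_measure_eq_zero`); this is the only place
where countable choice is used.

The total measure of `X` has to be expressed without mentioning the measure, which depends on `z`.
By `exists_weight`, the measure of a cylinder which is compatible with `z` is the product of the
probabilities of the moves of the opponent, which does not depend on `z`. Therefore the finite sets
of cylinders with a sum of measures at most `1/2` can be coded by a real, to be used as a parameter
(`exists_real_coding`, `boldSigmaIn_of_witnesses`).

Since all notions are those of a model `M` of ZF, every set and function which occurs has to be
represented in `M`. This is the purpose of `DefMap`: a map between coded types is called definable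
if it is first-order definable over `M` on the level of representatives. By separation and
replacement, definable subsets of sets of `M` and definable functions on sets of `M` are represented
in `M` (`internal_setOf`, `internal_fun`). The definable maps are closed under the usual operations,
and definability is proved by the tactic `fun_prop`. On this basis, the elementary theory of natural
numbers, finite sequences, Borel sets and Borel probabilities is developed inside of `M`. A measure
`μ` of the model is never constructed, as optimality of a strategy provides the measures.
-/

/-! ### First-order definable relations of a model -/

namespace SetModel

variable {M : Type u} [Membership M M]

/-- The predicate `P` on assignments is first-order definable over `M` with parameters. -/
def Dv (P : (ℕ → M) → Prop) : Prop := (Set.univ : Set M).Definable language {v | P v}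

namespace Dv

variable {P Q : (ℕ → M) → Prop}

theorem and (hP : Dv P) (hQ : Dv Q) : Dv (fun v => P v ∧ Q v) := Set.Definable.inter hP hQ

theorem not (hP : Dv P) : Dv (fun v => ¬ P v) := Set.Definable.compl hP

theorem or (hP : Dv P) (hQ : Dv Q) : Dv (fun v => P v ∨ Q v) := Set.Definable.union hP hQ

theorem of_iff (hP : Dv P) (h : ∀ v, Q v ↔ P v) : Dv Q := by
  rwa [show Q = P from funext fun v => propext (h v)]

theorem imp (hP : Dv P) (hQ : Dv Q) : Dv (fun v => P v → Q v) :=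
  (hP.not.or hQ).of_iff fun _ => imp_iff_not_or

theorem iff (hP : Dv P) (hQ : Dv Q) : Dv (fun v => P v ↔ Q v) :=
  ((hP.imp hQ).and (hQ.imp hP)).of_iff fun _ => iff_iff_implies_and_implies

theorem subst (hP : Dv P) (ρ : ℕ → ℕ) : Dv (fun v => P (fun i => v (ρ i))) :=
  Set.Definable.preimage_comp ρ hP

theorem mem (i j : ℕ) : Dv (fun v : ℕ → M => v i ∈ v j) := by
  refine Set.Definable.mono (A := ∅) ?_ (Set.empty_subset _)
  rw [Set.empty_definable_iff]
  refine ⟨FirstOrder.Language.Relations.formula₂ (L := language) MemSymbol.mem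
    (FirstOrder.Language.Term.var i) (FirstOrder.Language.Term.var j), ?_⟩
  ext v
  simp only [Set.mem_ofPred_eq]
  rfl

theorem eq (i j : ℕ) : Dv (fun v : ℕ → M => v i = v j) := by
  refine Set.Definable.mono (A := ∅) ?_ (Set.empty_subset _)
  rw [Set.empty_definable_iff]
  refine ⟨FirstOrder.Language.Term.equal (FirstOrder.Language.Term.var i)
    (FirstOrder.Language.Term.var j), ?_⟩
  ext v
  simp

theorem eq_const (i : ℕ) (c : M) : Dv (fun v : ℕ → M => v i = c) := by
  refine Set.Definable.mono (A := {c}) ?_ (Set.subset_univ _)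
  refine ⟨FirstOrder.Language.Term.equal (FirstOrder.Language.Term.var i)
    (FirstOrder.Language.Constants.term (language.con (⟨c, rfl⟩ : ({c} : Set M)))), ?_⟩
  ext v
  simp

/-- Existential quantification, in de Bruijn style: the bound variable becomes variable `0`. -/
theorem ex {P : (ℕ → M) → M → Prop} (h : Dv (fun v => P (fun i => v (i + 1)) (v 0))) :
    Dv (fun v => ∃ a, P v a) := by
  obtain ⟨φ, hφ⟩ := h
  let g : ℕ → ℕ ⊕ Fin 1 := fun k => Nat.casesOn k (Sum.inr 0) Sum.inl
  refine ⟨(FirstOrder.Language.BoundedFormula.relabel g φ).ex, ?_⟩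
  ext v
  simp only [Set.mem_ofPred_eq, FirstOrder.Language.Formula.Realize,
    FirstOrder.Language.BoundedFormula.realize_ex,
    FirstOrder.Language.BoundedFormula.realize_relabel]
  refine exists_congr fun a => ?_
  have := Set.ext_iff.1 hφ (fun k => Nat.casesOn k a v)
  simp only [Set.mem_ofPred_eq] at this
  refine this.trans ?_
  rw [FirstOrder.Language.Formula.Realize]
  refine iff_of_eq (congrArg₂ _ ?_ (Subsingleton.elim _ _))
  funext k
  cases k <;> rfl

theorem all {P : (ℕ → M) → M → Prop} (h : Dv (fun v => P (fun i => v (i + 1)) (v 0))) :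
    Dv (fun v => ∀ a, P v a) :=
  (ex (P := fun v a => ¬ P v a) h.not).not.of_iff fun v => by simp

theorem rel₁ {D : M → Prop} (h : Dv (fun v => D (v 0))) (i : ℕ) : Dv (fun v => D (v i)) :=
  h.subst fun _ => i

theorem rel₂ {G : M → M → Prop} (h : Dv (fun v => G (v 0) (v 1))) (i j : ℕ) :
    Dv (fun v => G (v i) (v j)) :=
  h.subst fun k => if k = 0 then i else j

theorem rel₃ {G : M → M → M → Prop} (h : Dv (fun v => G (v 0) (v 1) (v 2))) (i j k : ℕ) :
    Dv (fun v => G (v i) (v j) (v k)) :=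
  h.subst fun l => if l = 0 then i else if l = 1 then j else k

theorem const₂ {G : M → M → Prop} (h : Dv (fun v => G (v 0) (v 1))) (m : M) :
    Dv (fun v => G m (v 0)) :=
  (ex (P := fun v a => a = m ∧ G a (v 0)) ((eq_const 0 m).and (h.rel₂ 0 1))).of_iff
    fun v => by simp

theorem const₃ {G : M → M → M → Prop} (h : Dv (fun v => G (v 0) (v 1) (v 2))) (m : M) :
    Dv (fun v => G m (v 0) (v 1)) :=
  (ex (P := fun v a => a = m ∧ G a (v 0) (v 1)) ((eq_const 0 m).and (h.rel₃ 0 1 2))).of_iff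
    fun v => by simp

theorem mem_const (i : ℕ) (c : M) : Dv (fun v : ℕ → M => v i ∈ c) :=
  (ex (P := fun v a => a = c ∧ v i ∈ a) ((eq_const 0 c).and (mem (i + 1) 0))).of_iff
    fun v => by simp

theorem isEmptySet (i : ℕ) : Dv (fun v : ℕ → M => IsEmptySet (v i)) :=
  all (P := fun v z => z ∉ v i) (mem _ _).not

theorem isUPair (i j k : ℕ) : Dv (fun v : ℕ → M => IsUPair (v i) (v j) (v k)) :=
  all (P := fun v z => z ∈ v i ↔ z = v j ∨ z = v k) ((mem _ _).iff ((eq _ _).or (eq _ _)))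

theorem isPair (i j k : ℕ) : Dv (fun v : ℕ → M => IsPair (v i) (v j) (v k)) := by
  refine ex (ex ?_)
  exact (isUPair 1 (j + 2) (j + 2)).and ((isUPair 0 (j + 2) (k + 2)).and (isUPair (i + 2) 1 0))

theorem isSucc (i j : ℕ) : Dv (fun v : ℕ → M => IsSucc (v i) (v j)) :=
  all (P := fun v z => z ∈ v i ↔ z ∈ v j ∨ z = v j) ((mem _ _).iff ((mem _ _).or (eq _ _)))

end Dv

/-! ### Elementary consequences of the axioms -/

theorem IsUPair.inj {p x y x' y' : M} (h : IsUPair p x y) (h' : IsUPair p x' y') :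
    (x = x' ∧ y = y') ∨ (x = y' ∧ y = x') := by
  have h1 := (h x).symm.trans (h' x)
  have h2 := (h y).symm.trans (h' y)
  have h3 := (h x').symm.trans (h' x')
  have h4 := (h y').symm.trans (h' y')
  grind

theorem IsPair.inj {p x y x' y' : M} (h : IsPair p x y) (h' : IsPair p x' y') :
    x = x' ∧ y = y' := by
  obtain ⟨a, b, ha, hb, hp⟩ := h
  obtain ⟨a', b', ha', hb', hp'⟩ := h'
  rcases hp.inj hp' with ⟨rfl, rfl⟩ | ⟨rfl, rfl⟩
  · have := ha.inj ha'
    have := hb.inj hb'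
    grind
  · have := ha.inj hb'
    have := hb.inj ha'
    grind

variable [hZF : Fact (IsZF M)]

theorem ext_set {a b : M} (h : ∀ z : M, z ∈ a ↔ z ∈ b) : a = b := hZF.out.extensionality a b h

theorem exists_sep {P : M → M → Prop} (hP : Dv (fun v => P (v 0) (v 1))) (m a : M) :
    ∃ b : M, ∀ z : M, z ∈ b ↔ z ∈ a ∧ P m z :=
  hZF.out.separation {z | P m z} ((hP.const₂ m).preimage_comp fun _ => (0 : Fin 1)) a

theorem exists_repl {P : M → M → M → Prop} (hP : Dv (fun v => P (v 0) (v 1) (v 2))) (m a : M)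
    (h : ∀ x, x ∈ a → ∃! y, P m x y) : ∃ b : M, ∀ y : M, y ∈ b ↔ ∃ x : M, x ∈ a ∧ P m x y :=
  hZF.out.replacement {z | P m z.1 z.2}
    ((hP.const₃ m).preimage_comp fun k => if k = 0 then (0 : Fin 2) else 1) a h

theorem exists_isUPair (x y : M) : ∃ p : M, IsUPair p x y := hZF.out.pairing x y

theorem IsUPair.unique {p q x y : M} (hp : IsUPair p x y) (hq : IsUPair q x y) : p = q :=
  ext_set fun z => (hp z).trans (hq z).symm

theorem exists_isPair (x y : M) : ∃ p : M, IsPair p x y := by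
  obtain ⟨a, ha⟩ := exists_isUPair x x
  obtain ⟨b, hb⟩ := exists_isUPair x y
  obtain ⟨p, hp⟩ := exists_isUPair a b
  exact ⟨p, a, b, ha, hb, hp⟩

theorem IsPair.unique {p q x y : M} (hp : IsPair p x y) (hq : IsPair q x y) : p = q := by
  obtain ⟨a, b, ha, hb, hp⟩ := hp
  obtain ⟨a', b', ha', hb', hq⟩ := hq
  cases ha.unique ha'
  cases hb.unique hb'
  exact hp.unique hq

theorem exists_isEmptySet : ∃ e : M, IsEmptySet e := by
  obtain ⟨w, ⟨e, he, -⟩, -⟩ := hZF.out.infinity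
  exact ⟨e, he⟩

theorem IsEmptySet.unique {a b : M} (ha : IsEmptySet a) (hb : IsEmptySet b) : a = b :=
  ext_set fun z => iff_of_false (ha z) (hb z)

end SetModel

namespace SetModel

/-! ### Codings -/

open Coded

/-- Truth values are represented by `∅` and `{∅}`; this makes predicates a special case of maps. -/
instance codedProp {M : Type u} [Membership M M] : Coded M Prop :=
  ⟨fun p m => ∀ z : M, z ∈ m ↔ p ∧ IsEmptySet z⟩

/-- Objects and their representatives in `M` determine each other. -/
class Coding (M : Type u) [Membership M M] (T : Type v) [Coded M T] : Prop where
  code_unique : ∀ {t : T} {m m' : M}, IsCode t m → IsCode t m' → m = m'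
  code_inj : ∀ {t t' : T} {m : M}, IsCode t m → IsCode t' m → t = t'

/-- The type `T` is a definable class of `M`: all of its objects are represented in `M`, and the
representatives form a definable class. It is possible to quantify over `T` inside `M`. -/
class ClassType (M : Type u) [Membership M M] (T : Type v) [Coded M T] : Prop
    extends Coding M T where
  internal : ∀ t : T, Internal M t
  definable_range : ∃ D : M → Prop, Dv (fun v => D (v 0)) ∧ ∀ m, D m ↔ ∃ t : T, IsCode t m

/-- The type `T` is a set of `M`. -/
class SetType (M : Type u) [Membership M M] (T : Type v) [Coded M T] : Prop
    extends ClassType M T where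
  exists_range : ∃ a : M, ∀ m : M, m ∈ a ↔ ∃ t : T, IsCode t m

variable {M : Type u} [Membership M M]
variable {S : Type*} [Coded M S] {T : Type*} [Coded M T]

open Coding

theorem ClassType.dv_range [ClassType M T] (i : ℕ) :
    Dv (fun v : ℕ → M => ∃ t : T, IsCode t (v i)) := by
  obtain ⟨D, hD, h⟩ := ClassType.definable_range (M := M) (T := T)
  exact (hD.rel₁ i).of_iff fun v => (h _).symm

instance : Coding M M where
  code_unique h h' := by cases h; exact h'
  code_inj h h' := h.trans h'.symm

instance : ClassType M M where
  internal t := ⟨t, rfl⟩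
  definable_range := ⟨fun _ => True, (Dv.eq 0 0).of_iff fun _ => by simp,
    fun m => iff_of_true trivial ⟨m, rfl⟩⟩

instance {p : T → Prop} [Coding M T] : Coding M {t : T // p t} where
  code_unique {t _ _} h h' := code_unique (t := t.1) h h'
  code_inj {t t' _} h h' := Subtype.ext (code_inj (t := t.1) (t' := t'.1) h h')

variable [hZF : Fact (IsZF M)]

instance [Coding M S] [Coding M T] : Coding M (S × T) where
  code_unique := by
    rintro t m m' ⟨a, b, ha, hb, hp⟩ ⟨a', b', ha', hb', hp'⟩
    cases code_unique ha ha'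
    cases code_unique hb hb'
    exact hp.unique hp'
  code_inj := by
    rintro ⟨s, t⟩ ⟨s', t'⟩ m ⟨a, b, ha, hb, hp⟩ ⟨a', b', ha', hb', hp'⟩
    obtain ⟨rfl, rfl⟩ := hp.inj hp'
    cases code_inj ha ha'
    cases code_inj hb hb'
    rfl

instance {F : S → Type*} [∀ x, Coded M (F x)] [Coding M S] [∀ x, Coding M (F x)] :
    Coding M (Sigma F) where
  code_unique := by
    rintro t m m' ⟨a, b, ha, hb, hp⟩ ⟨a', b', ha', hb', hp'⟩
    cases code_unique ha ha'
    cases code_unique hb hb'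
    exact hp.unique hp'
  code_inj := by
    rintro ⟨s, t⟩ ⟨s', t'⟩ m ⟨a, b, ha, hb, hp⟩ ⟨a', b', ha', hb', hp'⟩
    obtain ⟨rfl, rfl⟩ := hp.inj hp'
    cases code_inj ha ha'
    cases code_inj hb hb'
    rfl

instance [Coding M T] : Coding M (Set T) where
  code_unique h h' := ext_set fun z => (h.2 z).trans (h'.2 z).symm
  code_inj := by
    have key : ∀ {X Y : Set T} {m : M}, IsCode X m → IsCode Y m → X ⊆ Y := by
      intro X Y m h h' x hx
      obtain ⟨c, hc⟩ := h.1 x hx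
      obtain ⟨y, hy, hyc⟩ := (h'.2 c).1 ((h.2 c).2 ⟨x, hx, hc⟩)
      cases code_inj hc hyc
      exact hy
    intro X Y m h h'
    exact (key h h').antisymm (key h' h)

instance [Coding M S] [Coding M T] : Coding M (S → T) where
  code_unique h h' := ext_set fun z => (h.2 z).trans (h'.2 z).symm
  code_inj := by
    intro F G m h h'
    funext x
    obtain ⟨c, hc⟩ := h.1 x
    obtain ⟨y, hy⟩ := (h'.2 c).1 ((h.2 c).2 ⟨x, hc⟩)
    have := code_inj hc hy
    rw [Prod.mk.injEq] at this
    obtain ⟨rfl, h2⟩ := this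
    exact h2

instance [ClassType M S] [ClassType M T] : ClassType M (S × T) where
  internal t := by
    obtain ⟨a, ha⟩ := ClassType.internal (M := M) t.1
    obtain ⟨b, hb⟩ := ClassType.internal (M := M) t.2
    obtain ⟨p, hp⟩ := exists_isPair a b
    exact ⟨p, a, b, ha, hb, hp⟩
  definable_range := by
    refine ⟨fun m => ∃ a b, (∃ s : S, IsCode s a) ∧ (∃ t : T, IsCode t b) ∧ IsPair m a b, ?_, ?_⟩
    · refine Dv.ex (Dv.ex (Dv.and ?_ (Dv.and ?_ (Dv.isPair _ _ _))))
      · exact ClassType.dv_range 1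
      · exact ClassType.dv_range 0
    · refine fun m => ⟨?_, ?_⟩
      · rintro ⟨a, b, ⟨s, hs⟩, ⟨t, ht⟩, hp⟩
        exact ⟨(s, t), a, b, hs, ht, hp⟩
      · rintro ⟨⟨s, t⟩, a, b, hs, ht, hp⟩
        exact ⟨a, b, ⟨s, hs⟩, ⟨t, ht⟩, hp⟩

/-- The internal subsets of a set of `M` form a class. -/
instance [SetType M T] : ClassType M {X : Set T // Internal M X} where
  internal X := X.2
  definable_range := by
    obtain ⟨a, ha⟩ := SetType.exists_range (M := M) (T := T)
    refine ⟨fun m => ∀ z, z ∈ m → z ∈ a,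
      Dv.all ((Dv.mem _ _).imp (Dv.mem_const _ _)), fun m => ⟨fun h => ?_, ?_⟩⟩
    · have : IsCode {t : T | ∃ c, c ∈ m ∧ IsCode t c} m := by
        refine ⟨fun x _ => ClassType.internal x, fun c => ⟨fun hc => ?_, ?_⟩⟩
        · obtain ⟨t, ht⟩ := (ha c).1 (h c hc)
          exact ⟨t, ⟨c, hc, ht⟩, ht⟩
        · rintro ⟨t, ⟨c', hc', ht'⟩, ht⟩
          cases code_unique ht ht'
          exact hc'
      exact ⟨⟨_, m, this⟩, this⟩
    · rintro ⟨X, hX⟩ z hz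
      obtain ⟨x, -, hx⟩ := (hX.2 z).1 hz
      exact (ha z).2 ⟨x, hx⟩

/-- A class of `M` is a set as soon as its representatives lie in an element of `M`. -/
theorem SetType.of_bound [ClassType M T] (b : M) (hb : ∀ (t : T) (m : M), IsCode t m → m ∈ b) :
    SetType M T where
  exists_range := by
    obtain ⟨a, ha⟩ := exists_sep (P := fun _ z => ∃ t : T, IsCode t z)
      (ClassType.dv_range 1) b b
    exact ⟨a, fun m => (ha m).trans ⟨fun h => h.2, fun ⟨t, ht⟩ => ⟨hb t m ht, t, ht⟩⟩⟩

instance [SetType M T] : SetType M {X : Set T // Internal M X} := by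
  obtain ⟨a, ha⟩ := SetType.exists_range (M := M) (T := T)
  obtain ⟨b, hb⟩ := hZF.out.powerset a
  refine SetType.of_bound b fun X m hX => (hb m).2 fun z hz => ?_
  obtain ⟨x, -, hx⟩ := (hX.2 z).1 hz
  exact (ha z).2 ⟨x, hx⟩

/-- The cartesian product exists by replacement and union. -/
theorem exists_prod (a b : M) : ∃ c : M, ∀ p : M, p ∈ c ↔ ∃ x y, x ∈ a ∧ y ∈ b ∧ IsPair p x y := by
  have h1 : ∀ x, ∃ c : M, ∀ p, p ∈ c ↔ ∃ y, y ∈ b ∧ IsPair p x y := fun x => by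
    refine exists_repl (P := fun x y p => IsPair p x y) (Dv.isPair 2 0 1) x b fun y _ => ?_
    obtain ⟨p, hp⟩ := exists_isPair x y
    exact ⟨p, hp, fun q hq => hq.unique hp⟩
  obtain ⟨d, hd⟩ := exists_repl (P := fun b x c => ∀ p, p ∈ c ↔ ∃ y, y ∈ b ∧ IsPair p x y)
    (Dv.all ((Dv.mem _ _).iff (Dv.ex ((Dv.mem 0 2).and (Dv.isPair 1 3 0))))) b a fun x _ => by
      obtain ⟨c, hc⟩ := h1 x
      exact ⟨c, hc, fun c' hc' => ext_set fun z => (hc' z).trans (hc z).symm⟩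
  obtain ⟨u, hu⟩ := hZF.out.union d
  refine ⟨u, fun p => (hu p).trans ⟨?_, ?_⟩⟩
  · rintro ⟨c, hc, hp⟩
    obtain ⟨x, hx, hxc⟩ := (hd c).1 hc
    obtain ⟨y, hy, hp⟩ := (hxc p).1 hp
    exact ⟨x, y, hx, hy, hp⟩
  · rintro ⟨x, y, hx, hy, hp⟩
    obtain ⟨c, hc⟩ := h1 x
    exact ⟨c, (hd c).2 ⟨x, hx, hc⟩, (hc p).2 ⟨y, hy, hp⟩⟩

instance [SetType M S] [SetType M T] : SetType M (S × T) := by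
  obtain ⟨a, ha⟩ := SetType.exists_range (M := M) (T := S)
  obtain ⟨b, hb⟩ := SetType.exists_range (M := M) (T := T)
  obtain ⟨c, hc⟩ := exists_prod a b
  refine SetType.of_bound c ?_
  rintro ⟨s, t⟩ m ⟨x, y, hx, hy, hp⟩
  exact (hc m).2 ⟨x, y, (ha x).2 ⟨s, hx⟩, (hb y).2 ⟨t, hy⟩, hp⟩

/-- The internal functions from a set of `M` to a class of `M` form a class. -/
instance [SetType M S] [ClassType M T] : ClassType M {F : S → T // Internal M F} where
  internal F := F.2
  definable_range := by
    obtain ⟨a, ha⟩ := SetType.exists_range (M := M) (T := S)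
    refine ⟨fun f => (∀ p, p ∈ f → ∃ x y, x ∈ a ∧ (∃ t : T, IsCode t y) ∧ IsPair p x y) ∧
      ∀ x, x ∈ a → ∃ y, ∀ z, z = y ↔ ∃ p, p ∈ f ∧ IsPair p x z, ?_, ?_⟩
    · refine Dv.and (Dv.all ((Dv.mem _ _).imp (Dv.ex (Dv.ex ((Dv.mem_const _ _).and
        (Dv.and ?_ (Dv.isPair _ _ _))))))) (Dv.all ((Dv.mem_const _ _).imp (Dv.ex (Dv.all
          ((Dv.eq _ _).iff (Dv.ex ((Dv.mem _ _).and (Dv.isPair _ _ _))))))))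
      exact ClassType.dv_range 0
    · refine fun f => ⟨fun ⟨h1, h2⟩ => ?_, ?_⟩
      · have : ∀ s : S, ∃ t : T, ∃ p, p ∈ f ∧ IsCode (s, t) p := fun s => by
          obtain ⟨x, hx⟩ := ClassType.internal (M := M) s
          obtain ⟨y, hy⟩ := h2 x ((ha x).2 ⟨s, hx⟩)
          obtain ⟨p, hp, hxy⟩ := (hy y).1 rfl
          obtain ⟨x', y', -, ⟨t, ht⟩, hp'⟩ := h1 p hp
          obtain ⟨rfl, rfl⟩ := hxy.inj hp'
          exact ⟨t, p, hp, x, y, hx, ht, hxy⟩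
        choose F hF using this
        have hc : IsCode F f := by
          refine ⟨fun x => ClassType.internal _, fun p => ⟨fun hp => ?_, fun ⟨s, hs⟩ => ?_⟩⟩
          · obtain ⟨x, y, hx, ⟨t, ht⟩, hxy⟩ := h1 p hp
            obtain ⟨s, hs⟩ := (ha x).1 hx
            refine ⟨s, ?_⟩
            obtain ⟨q, hq, x', y', hx', hy', hq'⟩ := hF s
            cases code_unique hs hx'
            obtain ⟨y₀, hy₀⟩ := h2 x hx
            cases (hy₀ y).2 ⟨p, hp, hxy⟩
            cases (hy₀ y').2 ⟨q, hq, hq'⟩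
            exact ⟨x, _, hs, hy', hxy⟩
          · obtain ⟨q, hq, hq'⟩ := hF s
            cases code_unique hs hq'
            exact hq
        exact ⟨⟨F, f, hc⟩, hc⟩
      · rintro ⟨⟨F, hF⟩, hc⟩
        refine ⟨fun p hp => ?_, fun x hx => ?_⟩
        · obtain ⟨s, x, y, hx, hy, hp⟩ := (hc.2 p).1 hp
          exact ⟨x, y, (ha x).2 ⟨s, hx⟩, ⟨_, hy⟩, hp⟩
        · obtain ⟨s, hs⟩ := (ha x).1 hx
          obtain ⟨p, x', y, hx', hy, hp⟩ := hc.1 s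
          cases code_unique hs hx'
          refine ⟨y, fun z => ⟨?_, ?_⟩⟩
          · rintro rfl
            exact ⟨p, (hc.2 p).2 ⟨s, x, _, hs, hy, hp⟩, hp⟩
          · rintro ⟨q, hq, hq'⟩
            obtain ⟨s', x', y', hx', hy', hq''⟩ := (hc.2 q).1 hq
            obtain ⟨rfl, rfl⟩ := hq'.inj hq''
            cases code_inj hs hx'
            exact code_unique hy' hy

instance [SetType M S] [SetType M T] : SetType M {F : S → T // Internal M F} := by
  obtain ⟨a, ha⟩ := SetType.exists_range (M := M) (T := S × T)
  obtain ⟨b, hb⟩ := hZF.out.powerset a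
  refine SetType.of_bound b fun F m hF => (hb m).2 fun z hz => ?_
  obtain ⟨s, hs⟩ := (hF.2 z).1 hz
  exact (ha z).2 ⟨_, hs⟩

omit hZF in
instance (a : M) : ClassType M (El a) where
  internal x := ⟨x.1, rfl⟩
  definable_range := ⟨fun m => m ∈ a, Dv.mem_const 0 a,
    fun m => ⟨fun h => ⟨⟨m, h⟩, rfl⟩, fun ⟨x, hx⟩ => (hx : x.1 = m) ▸ x.2⟩⟩

omit hZF in
instance (a : M) : SetType M (El a) where
  exists_range := ⟨a, fun m => ⟨fun h => ⟨⟨m, h⟩, rfl⟩, fun ⟨x, hx⟩ => (hx : x.1 = m) ▸ x.2⟩⟩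

end SetModel

namespace SetModel
open Coded Coding

/-! ### Definable maps between coded types -/

variable {M : Type u} [Membership M M]
variable {Γ : Type*} [Coded M Γ] {S : Type*} [Coded M S] {T : Type*} [Coded M T]

variable (M) in
/-- On representatives, `f` is given by a relation which is first-order definable over `M` with
parameters. In particular `f` maps objects of `M` to objects of `M`. -/
@[fun_prop]
def DefMap (f : Γ → T) : Prop :=
  ∃ G : M → M → Prop, Dv (fun v => G (v 0) (v 1)) ∧
    ∀ γ m, IsCode γ m → ∃ m', IsCode (f γ) m' ∧ ∀ m'', G m m'' ↔ m'' = m'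

theorem DefMap.internal {f : Γ → T} (hf : DefMap M f) {γ : Γ} (h : Internal M γ) :
    Internal M (f γ) := by
  obtain ⟨G, -, hG⟩ := hf
  obtain ⟨m, hm⟩ := h
  obtain ⟨m', hm', -⟩ := hG γ m hm
  exact ⟨m', hm'⟩

theorem DefMap.internal_apply [ClassType M Γ] {f : Γ → T} (hf : DefMap M f) (γ : Γ) :
    Internal M (f γ) := hf.internal (ClassType.internal γ)

namespace DefMap

@[fun_prop]
theorem id' : DefMap M (fun x : Γ => x) :=
  ⟨fun a b => b = a, Dv.eq 1 0, fun _ m hm => ⟨m, hm, fun _ => Iff.rfl⟩⟩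

theorem const_of_internal {c : T} (hc : Internal M c) : DefMap M (fun _ : Γ => c) := by
  obtain ⟨m, hm⟩ := hc
  exact ⟨fun _ b => b = m, Dv.eq_const 1 m, fun _ _ _ => ⟨m, hm, fun _ => Iff.rfl⟩⟩

@[fun_prop]
theorem const [ClassType M T] (c : T) : DefMap M (fun _ : Γ => c) :=
  const_of_internal (ClassType.internal c)

@[fun_prop]
theorem comp {f : S → T} {g : Γ → S} (hf : DefMap M f) (hg : DefMap M g) :
    DefMap M (fun x => f (g x)) := by
  obtain ⟨F, hF, hF'⟩ := hf
  obtain ⟨G, hG, hG'⟩ := hg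
  refine ⟨fun a c => ∃ b, G a b ∧ F b c, Dv.ex ((hG.rel₂ 1 0).and (hF.rel₂ 0 2)), ?_⟩
  intro γ m hm
  obtain ⟨b, hb, hb'⟩ := hG' γ m hm
  obtain ⟨c, hc, hc'⟩ := hF' _ b hb
  exact ⟨c, hc, fun c' => by simp [hb', hc']⟩

@[fun_prop]
theorem val {p : T → Prop} {f : Γ → {t : T // p t}} (hf : DefMap M f) :
    DefMap M (fun x => (f x).1) := hf

theorem of_val {p : T → Prop} {f : Γ → {t : T // p t}} (hf : DefMap M fun x => (f x).1) :
    DefMap M f := hf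

@[fun_prop]
theorem fst {f : Γ → S × T} (hf : DefMap M f) : DefMap M (fun x => (f x).1) := by
  refine comp (f := fun p : S × T => p.1) ?_ hf
  refine ⟨fun p a => ∃ b, IsPair p a b, Dv.ex (Dv.isPair 1 2 0), ?_⟩
  rintro ⟨s, t⟩ m ⟨a, b, ha, hb, hp⟩
  refine ⟨a, ha, fun a' => ⟨?_, ?_⟩⟩
  · rintro ⟨b', hb'⟩
    exact (hb'.inj hp).1
  · rintro rfl
    exact ⟨b, hp⟩

@[fun_prop]
theorem snd {f : Γ → S × T} (hf : DefMap M f) : DefMap M (fun x => (f x).2) := by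
  refine comp (f := fun p : S × T => p.2) ?_ hf
  refine ⟨fun p b => ∃ a, IsPair p a b, Dv.ex (Dv.isPair 1 0 2), ?_⟩
  rintro ⟨s, t⟩ m ⟨a, b, ha, hb, hp⟩
  refine ⟨b, hb, fun a' => ⟨?_, ?_⟩⟩
  · rintro ⟨b', hb'⟩
    exact (hb'.inj hp).2
  · rintro rfl
    exact ⟨a, hp⟩

variable [hZF : Fact (IsZF M)]

@[fun_prop]
theorem prodMk {f : Γ → S} {g : Γ → T} (hf : DefMap M f) (hg : DefMap M g) :
    DefMap M (fun x => (f x, g x)) := by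
  obtain ⟨F, hF, hF'⟩ := hf
  obtain ⟨G, hG, hG'⟩ := hg
  refine ⟨fun m p => ∃ a b, F m a ∧ G m b ∧ IsPair p a b,
    Dv.ex (Dv.ex ((hF.rel₂ 2 1).and ((hG.rel₂ 2 0).and (Dv.isPair 3 1 0)))), ?_⟩
  intro γ m hm
  obtain ⟨a, ha, ha'⟩ := hF' γ m hm
  obtain ⟨b, hb, hb'⟩ := hG' γ m hm
  obtain ⟨p, hp⟩ := exists_isPair a b
  refine ⟨p, ⟨a, b, ha, hb, hp⟩, fun q => ?_⟩
  simp only [ha', hb', exists_eq_left, exists_and_left]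
  exact ⟨fun h => h.unique hp, fun h => h ▸ hp⟩

/-! ### Definable predicates -/

theorem prop_iff {P : Γ → Prop} : DefMap M P ↔
    ∃ D : M → Prop, Dv (fun v => D (v 0)) ∧ ∀ γ m, IsCode γ m → (D m ↔ P γ) := by
  obtain ⟨e, he⟩ := exists_isEmptySet (M := M)
  constructor
  · rintro ⟨G, hG, h⟩
    refine ⟨fun m => ∃ c, G m c ∧ ∃ z, z ∈ c,
      Dv.ex ((hG.rel₂ 1 0).and (Dv.ex (Dv.mem 0 1))), fun γ m hm => ?_⟩
    obtain ⟨c, hc, hc'⟩ := h γ m hm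
    simp only [hc', exists_eq_left]
    exact ⟨fun ⟨z, hz⟩ => ((hc z).1 hz).1, fun hP => ⟨e, (hc e).2 ⟨hP, he⟩⟩⟩
  · rintro ⟨D, hD, h⟩
    refine ⟨fun m c => ∀ z, z ∈ c ↔ D m ∧ IsEmptySet z,
      Dv.all ((Dv.mem 0 2).iff ((hD.rel₁ 1).and (Dv.isEmptySet 0))), fun γ m hm => ?_⟩
    have : ∃ c : M, ∀ z, z ∈ c ↔ D m ∧ IsEmptySet z := by
      by_cases hDm : D m
      · obtain ⟨c, hc⟩ := exists_isUPair e e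
        refine ⟨c, fun z => (hc z).trans ?_⟩
        simp only [hDm, or_self, true_and]
        exact ⟨fun h => h ▸ he, fun h => h.unique he⟩
      · exact ⟨e, fun z => by simp [hDm, he z]⟩
    obtain ⟨c, hc⟩ := this
    refine ⟨c, fun z => by rw [hc, h γ m hm], fun c' => ⟨fun h' => ?_, fun h' => h' ▸ hc⟩⟩
    exact ext_set fun z => (h' z).trans (hc z).symm

@[fun_prop]
theorem and {P Q : Γ → Prop} (hP : DefMap M P) (hQ : DefMap M Q) :
    DefMap M (fun x => P x ∧ Q x) := by
  rw [prop_iff] at *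
  obtain ⟨D, hD, h⟩ := hP
  obtain ⟨E, hE, h'⟩ := hQ
  exact ⟨fun m => D m ∧ E m, hD.and hE, fun γ m hm => and_congr (h γ m hm) (h' γ m hm)⟩

@[fun_prop]
theorem not {P : Γ → Prop} (hP : DefMap M P) : DefMap M (fun x => ¬ P x) := by
  rw [prop_iff] at *
  obtain ⟨D, hD, h⟩ := hP
  exact ⟨fun m => ¬ D m, hD.not, fun γ m hm => not_congr (h γ m hm)⟩

@[fun_prop]
theorem or {P Q : Γ → Prop} (hP : DefMap M P) (hQ : DefMap M Q) :
    DefMap M (fun x => P x ∨ Q x) := by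
  simpa only [not_and_or, not_not] using (hP.not.and hQ.not).not

@[fun_prop]
theorem imp {P Q : Γ → Prop} (hP : DefMap M P) (hQ : DefMap M Q) :
    DefMap M (fun x => P x → Q x) := by
  simpa only [imp_iff_not_or] using hP.not.or hQ

@[fun_prop]
theorem iff {P Q : Γ → Prop} (hP : DefMap M P) (hQ : DefMap M Q) :
    DefMap M (fun x => P x ↔ Q x) := by
  simpa only [iff_iff_implies_and_implies] using (hP.imp hQ).and (hQ.imp hP)

@[fun_prop]
theorem exists' [ClassType M T] {P : Γ → T → Prop}
    (hP : DefMap M (fun p : Γ × T => P p.1 p.2)) : DefMap M (fun x => ∃ t, P x t) := by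
  rw [prop_iff] at *
  obtain ⟨D, hD, h⟩ := hP
  refine ⟨fun m => ∃ c p, (∃ t : T, IsCode t c) ∧ IsPair p m c ∧ D p,
    Dv.ex (Dv.ex ((ClassType.dv_range 1).and ((Dv.isPair 0 2 1).and (hD.rel₁ 0)))), ?_⟩
  intro γ m hm
  constructor
  · rintro ⟨c, p, ⟨t, ht⟩, hp, hDp⟩
    exact ⟨t, (h (γ, t) p ⟨m, c, hm, ht, hp⟩).1 hDp⟩
  · rintro ⟨t, ht⟩
    obtain ⟨c, hc⟩ := ClassType.internal (M := M) t
    obtain ⟨p, hp⟩ := exists_isPair m c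
    exact ⟨c, p, ⟨t, hc⟩, hp, (h (γ, t) p ⟨m, c, hm, hc, hp⟩).2 ht⟩

@[fun_prop]
theorem forall' [ClassType M T] {P : Γ → T → Prop}
    (hP : DefMap M (fun p : Γ × T => P p.1 p.2)) : DefMap M (fun x => ∀ t, P x t) := by
  simpa only [not_exists, not_not] using (exists' (P := fun x t => ¬ P x t) hP.not).not

@[fun_prop]
theorem eq [Coding M T] {f g : Γ → T} (hf : DefMap M f) (hg : DefMap M g) :
    DefMap M (fun x => f x = g x) := by
  obtain ⟨F, hF, hF'⟩ := hf
  obtain ⟨G, hG, hG'⟩ := hg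
  rw [prop_iff]
  refine ⟨fun m => ∃ c, F m c ∧ G m c, Dv.ex ((hF.rel₂ 1 0).and (hG.rel₂ 1 0)), ?_⟩
  intro γ m hm
  obtain ⟨a, ha, ha'⟩ := hF' γ m hm
  obtain ⟨b, hb, hb'⟩ := hG' γ m hm
  simp only [ha', hb', exists_eq_left]
  refine ⟨?_, fun h => ?_⟩
  · rintro rfl
    exact code_inj ha hb
  · rw [h] at ha
    exact code_unique ha hb

/-- A map is definable if its graph is. -/
theorem of_graph [ClassType M T] {f : Γ → T}
    (hf : DefMap M (fun p : Γ × T => f p.1 = p.2)) : DefMap M f := by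
  rw [prop_iff] at hf
  obtain ⟨D, hD, h⟩ := hf
  refine ⟨fun m c => ∃ p, (∃ t : T, IsCode t c) ∧ IsPair p m c ∧ D p,
    Dv.ex ((ClassType.dv_range 2).and ((Dv.isPair 0 1 2).and (hD.rel₁ 0))), ?_⟩
  intro γ m hm
  obtain ⟨c, hc⟩ := ClassType.internal (M := M) (f γ)
  obtain ⟨p, hp⟩ := exists_isPair m c
  refine ⟨c, hc, fun c' => ⟨?_, ?_⟩⟩
  · rintro ⟨p', ⟨t, ht⟩, hp', hDp⟩
    have : f γ = t := (h (γ, t) p' ⟨m, c', hm, ht, hp'⟩).1 hDp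
    subst this
    exact code_unique ht hc
  · rintro rfl
    exact ⟨p, ⟨_, hc⟩, hp, (h (γ, f γ) p ⟨m, c', hm, hc, hp⟩).2 rfl⟩

theorem of_graph_iff [ClassType M T] {f : Γ → T} {P : Γ → T → Prop}
    (hP : DefMap M (fun p : Γ × T => P p.1 p.2)) (h : ∀ x t, f x = t ↔ P x t) : DefMap M f :=
  of_graph (by simpa only [h] using hP)

open Classical in
@[fun_prop]
theorem ite [ClassType M T] {P : Γ → Prop} {f g : Γ → T} [∀ x, Decidable (P x)]
    (hP : DefMap M P) (hf : DefMap M f) (hg : DefMap M g) :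
    DefMap M (fun x => if P x then f x else g x) := by
  refine of_graph_iff (P := fun x t => (P x ∧ f x = t) ∨ (¬ P x ∧ g x = t)) (by fun_prop) ?_
  intro x t
  split_ifs with h <;> simp [h]

/-! ### Sets and functions as values -/

@[fun_prop]
theorem mem [Coding M T] {f : Γ → T} {g : Γ → Set T} (hf : DefMap M f) (hg : DefMap M g) :
    DefMap M (fun x => f x ∈ g x) := by
  obtain ⟨F, hF, hF'⟩ := hf
  obtain ⟨G, hG, hG'⟩ := hg
  rw [prop_iff]
  refine ⟨fun m => ∃ a b, F m a ∧ G m b ∧ a ∈ b,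
    Dv.ex (Dv.ex ((hF.rel₂ 2 1).and ((hG.rel₂ 2 0).and (Dv.mem 1 0)))), ?_⟩
  intro γ m hm
  obtain ⟨a, ha, ha'⟩ := hF' γ m hm
  obtain ⟨b, hb, hb'⟩ := hG' γ m hm
  simp only [ha', hb', exists_eq_left, exists_and_left]
  refine (hb.2 a).trans ⟨?_, fun h => ⟨_, h, ha⟩⟩
  rintro ⟨x, hx, hxa⟩
  cases code_inj hxa ha
  exact hx

omit hZF in
theorem apply_of_val [Coding M S] [Coding M T] {f : Γ → S → T} {g : Γ → S} (hf : DefMap M f)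
    (hg : DefMap M g) : DefMap M (fun x => f x (g x)) := by
  obtain ⟨F, hF, hF'⟩ := hf
  obtain ⟨G, hG, hG'⟩ := hg
  refine ⟨fun m c => ∃ a b p, F m a ∧ G m b ∧ p ∈ a ∧ IsPair p b c,
    Dv.ex (Dv.ex (Dv.ex ((hF.rel₂ 3 2).and ((hG.rel₂ 3 1).and
      ((Dv.mem 0 2).and (Dv.isPair 0 1 4)))))), ?_⟩
  intro γ m hm
  obtain ⟨a, ha, ha'⟩ := hF' γ m hm
  obtain ⟨b, hb, hb'⟩ := hG' γ m hm
  obtain ⟨p, x, c, hx, hc, hp⟩ := ha.1 (g γ)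
  cases code_unique hb hx
  refine ⟨c, hc, fun c' => ?_⟩
  simp only [ha', hb', exists_eq_left, exists_and_left]
  constructor
  · rintro ⟨q, hq, hq'⟩
    obtain ⟨s, x, y, hx', hy, hq⟩ := (ha.2 q).1 hq
    obtain ⟨rfl, rfl⟩ := hq.inj hq'
    cases code_inj hb hx'
    exact code_unique hy hc
  · rintro rfl
    exact ⟨p, (ha.2 p).2 ⟨_, _, _, hb, hc, hp⟩, hp⟩

omit hZF in
@[fun_prop]
theorem val_apply [Coding M S] [Coding M T] {p : (S → T) → Prop} {f : Γ → {F : S → T // p F}}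
    {g : Γ → S} (hf : DefMap M f) (hg : DefMap M g) : DefMap M (fun x => (f x).1 (g x)) :=
  apply_of_val (f := fun x => (f x).1) hf hg

/-- Separation: sets defined by comprehension depend definably on parameters. -/
@[fun_prop]
theorem ofPred [SetType M T] {P : Γ → T → Prop}
    (hP : DefMap M (fun p : Γ × T => P p.1 p.2)) : DefMap M (fun x => {t | P x t}) := by
  rw [prop_iff] at hP
  obtain ⟨D, hD, h⟩ := hP
  obtain ⟨a, ha⟩ := SetType.exists_range (M := M) (T := T)
  refine ⟨fun m b => ∀ z, z ∈ b ↔ z ∈ a ∧ ∃ p, IsPair p m z ∧ D p,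
    Dv.all ((Dv.mem 0 2).iff ((Dv.mem_const 0 a).and
      (Dv.ex ((Dv.isPair 0 2 1).and (hD.rel₁ 0))))), ?_⟩
  intro γ m hm
  obtain ⟨b, hb⟩ := exists_sep (P := fun m z => ∃ p, IsPair p m z ∧ D p)
    (Dv.ex ((Dv.isPair 0 1 2).and (hD.rel₁ 0))) m a
  refine ⟨b, ⟨fun t _ => ClassType.internal t, fun c => (hb c).trans ⟨?_, ?_⟩⟩, fun b' =>
    ⟨fun h' => ext_set fun z => (h' z).trans (hb z).symm, fun h' => h' ▸ hb⟩⟩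
  · rintro ⟨hc, p, hp, hDp⟩
    obtain ⟨t, ht⟩ := (ha c).1 hc
    exact ⟨t, (h (γ, t) p ⟨m, c, hm, ht, hp⟩).1 hDp, ht⟩
  · rintro ⟨t, ht, hc⟩
    obtain ⟨p, hp⟩ := exists_isPair m c
    exact ⟨(ha c).2 ⟨t, hc⟩, p, hp, (h (γ, t) p ⟨m, c, hm, hc, hp⟩).2 ht⟩

@[fun_prop]
theorem compl [SetType M T] {f : Γ → Set T} (hf : DefMap M f) : DefMap M (fun x => (f x)ᶜ) := by
  have : DefMap M (fun p : Γ × T => f p.1) := hf.comp id'.fst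
  exact ofPred (P := fun x t => t ∉ f x) (by fun_prop)

@[fun_prop]
theorem inter [SetType M T] {f g : Γ → Set T} (hf : DefMap M f) (hg : DefMap M g) :
    DefMap M (fun x => f x ∩ g x) := by
  have : DefMap M (fun p : Γ × T => f p.1) := hf.comp id'.fst
  have : DefMap M (fun p : Γ × T => g p.1) := hg.comp id'.fst
  exact ofPred (P := fun x t => t ∈ f x ∧ t ∈ g x) (by fun_prop)

@[fun_prop]
theorem sdiff [SetType M T] {f g : Γ → Set T} (hf : DefMap M f) (hg : DefMap M g) :
    DefMap M (fun x => f x \ g x) := hf.inter hg.compl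

@[fun_prop]
theorem subset [ClassType M T] {f g : Γ → Set T} (hf : DefMap M f) (hg : DefMap M g) :
    DefMap M (fun x => f x ⊆ g x) := by
  have : DefMap M (fun p : Γ × T => f p.1) := hf.comp id'.fst
  have : DefMap M (fun p : Γ × T => g p.1) := hg.comp id'.fst
  exact forall' (P := fun x t => t ∈ f x → t ∈ g x) (by fun_prop)

/-- Replacement: functions given by definable expressions depend definably on parameters. -/
@[fun_prop]
theorem lam [SetType M S] [Coding M T] {f : Γ → S → T}
    (hf : DefMap M (fun p : Γ × S => f p.1 p.2)) : DefMap M (fun x => fun s => f x s) := by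
  obtain ⟨G, hG, h⟩ := hf
  obtain ⟨a, ha⟩ := SetType.exists_range (M := M) (T := S)
  have hD : Dv (fun v : ℕ → M => ∃ p y, IsPair p (v 0) (v 1) ∧ G p y ∧ IsPair (v 2) (v 1) y) :=
    Dv.ex (Dv.ex ((Dv.isPair 1 2 3).and ((hG.rel₂ 1 0).and (Dv.isPair 4 3 0))))
  refine ⟨fun m b => ∀ e, e ∈ b ↔ ∃ x, x ∈ a ∧ ∃ p y, IsPair p m x ∧ G p y ∧ IsPair e x y,
    Dv.all ((Dv.mem 0 2).iff (Dv.ex ((Dv.mem_const 0 a).and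
      (hD.rel₃ (G := fun m x e => ∃ p y, IsPair p m x ∧ G p y ∧ IsPair e x y) 2 0 1)))), ?_⟩
  intro γ m hm
  have hval : ∀ (s : S) (x : M), IsCode s x → ∃ e y, IsPair e x y ∧ IsCode (f γ s) y ∧
      ∀ e', (∃ p y, IsPair p m x ∧ G p y ∧ IsPair e' x y) ↔ e' = e := by
    intro s x hx
    obtain ⟨p, hp⟩ := exists_isPair m x
    obtain ⟨y, hy, hy'⟩ := h (γ, s) p ⟨m, x, hm, hx, hp⟩
    obtain ⟨e, he⟩ := exists_isPair x y
    refine ⟨e, y, he, hy, fun e' => ⟨?_, ?_⟩⟩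
    · rintro ⟨p', y', hp', hy'', he'⟩
      cases hp'.unique hp
      cases (hy' y').1 hy''
      exact he'.unique he
    · rintro rfl
      exact ⟨p, y, hp, (hy' y).2 rfl, he⟩
  obtain ⟨b, hb⟩ := exists_repl
      (P := fun m x e => ∃ p y, IsPair p m x ∧ G p y ∧ IsPair e x y) hD m a fun x hx => by
    obtain ⟨s, hs⟩ := (ha x).1 hx
    obtain ⟨e, y, -, -, he⟩ := hval s x hs
    exact ⟨e, (he e).2 rfl, fun e' he' => (he e').1 he'⟩
  refine ⟨b, ⟨fun s => ?_, fun e => (hb e).trans ⟨?_, ?_⟩⟩, fun b' =>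
    ⟨fun h' => ext_set fun z => (h' z).trans (hb z).symm, fun h' => h' ▸ hb⟩⟩
  · obtain ⟨x, hx⟩ := ClassType.internal (M := M) s
    obtain ⟨e, y, he, hy, -⟩ := hval s x hx
    exact ⟨e, x, y, hx, hy, he⟩
  · rintro ⟨x, hx, he⟩
    obtain ⟨s, hs⟩ := (ha x).1 hx
    obtain ⟨e', y, he', hy, h'⟩ := hval s x hs
    cases (h' e).1 he
    exact ⟨s, x, y, hs, hy, he'⟩
  · rintro ⟨s, x, y, hx, hy, he⟩
    obtain ⟨e', y', he', hy', h'⟩ := hval s x hx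
    cases code_unique hy hy'
    cases he.unique he'
    exact ⟨x, (ha x).2 ⟨s, hx⟩, (h' _).2 rfl⟩

end DefMap

variable [hZF : Fact (IsZF M)]

theorem internal_setOf [SetType M T] {P : T → Prop} (hP : DefMap M P) : Internal M {t | P t} :=
  (DefMap.ofPred (Γ := M) (P := fun _ t => P t) (hP.comp DefMap.id'.snd)).internal_apply
    (Classical.choose (exists_isEmptySet (M := M)))

theorem internal_fun [SetType M S] [Coding M T] {f : S → T} (hf : DefMap M f) : Internal M f :=
  (DefMap.lam (Γ := M) (f := fun _ t => f t) (hf.comp DefMap.id'.snd)).internal_apply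
    (Classical.choose (exists_isEmptySet (M := M)))

omit hZF in
theorem defMap_of_internal [Coding M S] [Coding M T] {f : S → T} (hf : Internal M f) :
    DefMap M f :=
  DefMap.apply_of_val (Γ := S) (f := fun _ => f) (DefMap.const_of_internal hf) DefMap.id'

/-- A definable part of a set of `M` is a set of `M`. -/
theorem setType_subtype [SetType M T] {p : T → Prop} (hp : DefMap M p) :
    SetType M {t : T // p t} := by
  obtain ⟨a, ha⟩ := internal_setOf hp
  have h : ∀ m, m ∈ a ↔ ∃ t : {t : T // p t}, IsCode t m := fun m =>
    (ha.2 m).trans ⟨fun ⟨t, ht, hm⟩ => ⟨⟨t, ht⟩, hm⟩, fun ⟨t, ht⟩ => ⟨t.1, t.2, ht⟩⟩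
  exact { internal := fun t => ClassType.internal (M := M) t.1
          definable_range := ⟨fun m => m ∈ a, Dv.mem_const 0 a, h⟩
          exists_range := ⟨a, h⟩ }

/-- The image of a set of `M` under a definable surjection is a set of `M`. -/
theorem setType_of_surjective [SetType M S] [Coding M T] {f : S → T} (hf : DefMap M f)
    (hs : Function.Surjective f) : SetType M T := by
  obtain ⟨G, hG, h⟩ := hf
  obtain ⟨a, ha⟩ := SetType.exists_range (M := M) (T := S)
  obtain ⟨b, hb⟩ := exists_repl (P := fun _ x y => G x y) (hG.rel₂ 1 2) a a fun x hx => by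
    obtain ⟨s, hs⟩ := (ha x).1 hx
    obtain ⟨y, -, hy⟩ := h s x hs
    exact ⟨y, (hy y).2 rfl, fun y' hy' => (hy y').1 hy'⟩
  have h' : ∀ m, m ∈ b ↔ ∃ t : T, IsCode t m := by
    refine fun m => (hb m).trans ⟨?_, ?_⟩
    · rintro ⟨x, hx, hm⟩
      obtain ⟨s, hs⟩ := (ha x).1 hx
      obtain ⟨y, hy, hy'⟩ := h s x hs
      cases (hy' m).1 hm
      exact ⟨_, hy⟩
    · rintro ⟨t, ht⟩
      obtain ⟨s, rfl⟩ := hs t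
      obtain ⟨x, hx⟩ := ClassType.internal (M := M) s
      obtain ⟨y, hy, hy'⟩ := h s x hx
      cases code_unique ht hy
      exact ⟨x, (ha x).2 ⟨s, hx⟩, (hy' _).2 rfl⟩
  refine { internal := fun t => ?_
           definable_range := ⟨fun m => m ∈ b, Dv.mem_const 0 b, h'⟩
           exists_range := ⟨b, h'⟩ }
  obtain ⟨s, rfl⟩ := hs t
  exact DefMap.internal_apply ⟨G, hG, h⟩ s

end SetModel

namespace SetModel
open Coded Coding

/-! ### Natural numbers of the model -/

variable {M : Type u} [Membership M M] [hZF : Fact (IsZF M)]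
variable {Γ : Type*} [Coded M Γ] {S : Type*} [Coded M S] {T : Type*} [Coded M T]

namespace Naturals

variable (W : Naturals M)

/-- Induction holds for the predicates which are definable over `M`, since `ω` is the least
inductive set. -/
theorem induction {P : W.Nat → Prop} (hP : DefMap M P) (h0 : P W.zero)
    (hs : ∀ n, P n → P (W.succ n)) (n : W.Nat) : P n := by
  obtain ⟨a, ha⟩ := internal_setOf hP
  have hind : IsInductive a := by
    refine ⟨fun e he => (ha.2 e).2 ⟨W.zero, h0, W.isEmptySet_zero.unique he⟩, fun x hx y hy => ?_⟩
    obtain ⟨n, hn, rfl⟩ := (ha.2 x).1 hx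
    refine (ha.2 y).2 ⟨W.succ n, hs n hn, ext_set fun z => ?_⟩
    exact (W.isSucc_succ n z).trans (hy z).symm
  obtain ⟨m, hm, h⟩ := (ha.2 n.1).1 (W.isOmega.2 a hind n.1 n.2)
  rwa [← Subtype.ext h]

@[fun_prop]
theorem defMap_lt {f g : Γ → W.Nat} (hf : DefMap M f) (hg : DefMap M g) :
    DefMap M (fun x => W.Lt (f x) (g x)) := by
  have : DefMap M (fun p : W.Nat × W.Nat => p.1.1 ∈ p.2.1) := by
    rw [DefMap.prop_iff]
    refine ⟨fun m => ∃ a b, IsPair m a b ∧ a ∈ b,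
      Dv.ex (Dv.ex ((Dv.isPair 2 1 0).and (Dv.mem 1 0))), ?_⟩
    rintro ⟨s, t⟩ m ⟨a, b, rfl, rfl, hp⟩
    refine ⟨?_, fun h => ⟨_, _, hp, h⟩⟩
    rintro ⟨a, b, hp', h⟩
    obtain ⟨rfl, rfl⟩ := hp.inj hp'
    exact h
  exact this.comp (hf.prodMk hg)

@[fun_prop]
theorem defMap_succ {f : Γ → W.Nat} (hf : DefMap M f) : DefMap M (fun x => W.succ (f x)) := by
  have : DefMap M W.succ := by
    refine ⟨fun a b => IsSucc b a, Dv.isSucc 1 0, ?_⟩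
    rintro n m rfl
    exact ⟨(W.succ n).1, rfl, fun m => ⟨fun h => ext_set fun z =>
      (h z).trans (W.isSucc_succ n z).symm, fun h => h ▸ W.isSucc_succ n⟩⟩
  exact this.comp hf

@[fun_prop]
theorem defMap_add {f : Γ → W.Nat × W.Nat} (hf : DefMap M f) : DefMap M (fun x => W.add (f x)) :=
  (defMap_of_internal W.internal_add).comp hf

@[fun_prop]
theorem defMap_mul {f : Γ → W.Nat × W.Nat} (hf : DefMap M f) : DefMap M (fun x => W.mul (f x)) :=
  (defMap_of_internal W.internal_mul).comp hf

/-! ### Arithmetic and order of the natural numbers -/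

variable {W}

omit hZF in
theorem not_lt_zero (n : W.Nat) : ¬ W.Lt n W.zero := W.isEmptySet_zero n.1

omit hZF in
theorem lt_succ {m n : W.Nat} : W.Lt m (W.succ n) ↔ W.Lt m n ∨ m = n :=
  (W.isSucc_succ n m.1).trans (or_congr Iff.rfl Subtype.ext_iff.symm)

theorem lt_trans' {l m n : W.Nat} (h : W.Lt l m) (h' : W.Lt m n) : W.Lt l n := by
  refine W.induction (P := fun n => W.Lt m n → W.Lt l n) (by fun_prop) ?_ ?_ n h'
  · exact fun h => (not_lt_zero _ h).elim
  · intro n ih hn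
    rw [lt_succ] at hn ⊢
    rcases hn with hn | rfl
    · exact Or.inl (ih hn)
    · exact Or.inl h

theorem lt_irrefl' (n : W.Nat) : ¬ W.Lt n n := by
  refine W.induction (P := fun n => ¬ W.Lt n n) (by fun_prop) (not_lt_zero _) ?_ n
  intro n ih h
  rcases lt_succ.1 h with h | h
  · exact ih (lt_trans' (lt_succ.2 (Or.inr rfl)) h)
  · have : W.Lt n (W.succ n) := lt_succ.2 (Or.inr rfl)
    rw [h] at this
    exact ih this

theorem zero_lt_or_eq (n : W.Nat) : W.Lt W.zero n ∨ W.zero = n := by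
  refine W.induction (P := fun n => W.Lt W.zero n ∨ W.zero = n) (by fun_prop) (Or.inr rfl) ?_ n
  exact fun n ih => Or.inl (lt_succ.2 ih)

theorem succ_lt_succ {m n : W.Nat} (h : W.Lt m n) : W.Lt (W.succ m) (W.succ n) := by
  refine W.induction (P := fun n => W.Lt m n → W.Lt (W.succ m) (W.succ n)) (by fun_prop) ?_ ?_ n h
  · exact fun h => (not_lt_zero _ h).elim
  · intro n ih hn
    rcases lt_succ.1 hn with hn | rfl
    · exact lt_succ.2 (Or.inl (ih hn))
    · exact lt_succ.2 (Or.inr rfl)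

theorem lt_trichotomy' (m n : W.Nat) : W.Lt m n ∨ m = n ∨ W.Lt n m := by
  refine W.induction (P := fun n => W.Lt m n ∨ m = n ∨ W.Lt n m) (by fun_prop) ?_ ?_ n
  · rcases zero_lt_or_eq m with h | h
    · exact Or.inr (Or.inr h)
    · exact Or.inr (Or.inl h.symm)
  · rintro n (h | rfl | h)
    · exact Or.inl (lt_succ.2 (Or.inl h))
    · exact Or.inl (lt_succ.2 (Or.inr rfl))
    · rcases lt_succ.1 (succ_lt_succ h) with h | h
      · exact Or.inr (Or.inr h)
      · exact Or.inr (Or.inl h.symm)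

theorem zero_add' (n : W.Nat) : W.add (W.zero, n) = n := by
  refine W.induction (P := fun n => W.add (W.zero, n) = n) (by fun_prop) (W.add_zero _) ?_ n
  intro n ih
  rw [W.add_succ, ih]

theorem succ_add' (m n : W.Nat) : W.add (W.succ m, n) = W.succ (W.add (m, n)) := by
  refine W.induction (P := fun n => W.add (W.succ m, n) = W.succ (W.add (m, n))) (by fun_prop)
    ?_ ?_ n
  · rw [W.add_zero, W.add_zero]
  · intro n ih
    rw [W.add_succ, ih, W.add_succ]

theorem add_comm' (m n : W.Nat) : W.add (m, n) = W.add (n, m) := by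
  refine W.induction (P := fun n => W.add (m, n) = W.add (n, m)) (by fun_prop) ?_ ?_ n
  · rw [W.add_zero, zero_add']
  · intro n ih
    rw [W.add_succ, ih, succ_add']

theorem add_assoc' (l m n : W.Nat) : W.add (W.add (l, m), n) = W.add (l, W.add (m, n)) := by
  refine W.induction (P := fun n => W.add (W.add (l, m), n) = W.add (l, W.add (m, n)))
    (by fun_prop) ?_ ?_ n
  · rw [W.add_zero, W.add_zero]
  · intro n ih
    rw [W.add_succ, ih, W.add_succ, W.add_succ]

theorem zero_mul' (n : W.Nat) : W.mul (W.zero, n) = W.zero := by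
  refine W.induction (P := fun n => W.mul (W.zero, n) = W.zero) (by fun_prop) (W.mul_zero _) ?_ n
  intro n ih
  rw [W.mul_succ, ih, W.add_zero]

theorem succ_mul' (m n : W.Nat) : W.mul (W.succ m, n) = W.add (W.mul (m, n), n) := by
  refine W.induction (P := fun n => W.mul (W.succ m, n) = W.add (W.mul (m, n), n)) (by fun_prop)
    ?_ ?_ n
  · rw [W.mul_zero, W.mul_zero, W.add_zero]
  · intro n ih
    rw [W.mul_succ, W.mul_succ, ih, W.add_succ, W.add_succ, add_assoc', add_assoc', add_comm' n]

theorem mul_comm' (m n : W.Nat) : W.mul (m, n) = W.mul (n, m) := by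
  refine W.induction (P := fun n => W.mul (m, n) = W.mul (n, m)) (by fun_prop) ?_ ?_ n
  · rw [W.mul_zero, zero_mul']
  · intro n ih
    rw [W.mul_succ, ih, succ_mul']

theorem mul_add' (l m n : W.Nat) :
    W.mul (l, W.add (m, n)) = W.add (W.mul (l, m), W.mul (l, n)) := by
  refine W.induction (P := fun n => W.mul (l, W.add (m, n)) = W.add (W.mul (l, m), W.mul (l, n)))
    (by fun_prop) ?_ ?_ n
  · rw [W.add_zero, W.mul_zero, W.add_zero]
  · intro n ih
    rw [W.add_succ, W.mul_succ, ih, W.mul_succ, add_assoc']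

theorem mul_assoc' (l m n : W.Nat) : W.mul (W.mul (l, m), n) = W.mul (l, W.mul (m, n)) := by
  refine W.induction (P := fun n => W.mul (W.mul (l, m), n) = W.mul (l, W.mul (m, n)))
    (by fun_prop) ?_ ?_ n
  · rw [W.mul_zero, W.mul_zero, W.mul_zero]
  · intro n ih
    rw [W.mul_succ, ih, W.mul_succ, mul_add']

instance : Add W.Nat := ⟨fun m n => W.add (m, n)⟩

instance : Mul W.Nat := ⟨fun m n => W.mul (m, n)⟩

instance : Zero W.Nat := ⟨W.zero⟩

instance : One W.Nat := ⟨W.succ W.zero⟩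

instance : CommSemiring W.Nat where
  add_assoc := add_assoc'
  zero_add := zero_add'
  add_zero := W.add_zero
  add_comm := add_comm'
  nsmul := nsmulRec
  npow := npowRec
  left_distrib := mul_add'
  right_distrib l m n := by
    change W.mul (W.add (l, m), n) = W.add (W.mul (l, n), W.mul (m, n))
    rw [mul_comm', mul_add', mul_comm' n, mul_comm' n]
  zero_mul := zero_mul'
  mul_zero := W.mul_zero
  mul_assoc := mul_assoc'
  one_mul n := by
    change W.mul (W.succ W.zero, n) = n
    rw [succ_mul', zero_mul', zero_add']
  mul_one n := by
    change W.mul (n, W.succ W.zero) = n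
    rw [W.mul_succ, W.mul_zero, zero_add']
  mul_comm := mul_comm'

omit hZF in
theorem succ_eq (n : W.Nat) : W.succ n = n + 1 := by
  change W.succ n = W.add (n, W.succ W.zero)
  rw [W.add_succ, W.add_zero]

noncomputable instance : LinearOrder W.Nat where
  lt := W.Lt
  le m n := W.Lt m n ∨ m = n
  le_refl _ := Or.inr rfl
  le_trans := by
    rintro l m n (h | rfl) (h' | rfl)
    exacts [Or.inl (lt_trans' h h'), Or.inl h, Or.inl h', Or.inr rfl]
  lt_iff_le_not_ge m n := by
    refine ⟨fun h => ⟨Or.inl h, ?_⟩, ?_⟩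
    · rintro (h' | rfl)
      exacts [lt_irrefl' _ (lt_trans' h h'), lt_irrefl' _ h]
    · rintro ⟨h | rfl, h'⟩
      exacts [h, (h' (Or.inr rfl)).elim]
  le_antisymm := by
    rintro m n (h | rfl) (h' | h')
    exacts [(lt_irrefl' _ (lt_trans' h h')).elim, h'.symm, rfl, rfl]
  le_total m n := by
    rcases lt_trichotomy' m n with h | h | h
    exacts [Or.inl (Or.inl h), Or.inl (Or.inr h), Or.inr (Or.inl h)]
  toDecidableLE := Classical.decRel _

@[fun_prop]
theorem defMap_hAdd {f g : Γ → W.Nat} (hf : DefMap M f) (hg : DefMap M g) :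
    DefMap M (fun x => f x + g x) := W.defMap_add (hf.prodMk hg)

@[fun_prop]
theorem defMap_hMul {f g : Γ → W.Nat} (hf : DefMap M f) (hg : DefMap M g) :
    DefMap M (fun x => f x * g x) := W.defMap_mul (hf.prodMk hg)

@[fun_prop]
theorem defMap_lt' {f g : Γ → W.Nat} (hf : DefMap M f) (hg : DefMap M g) :
    DefMap M (fun x => f x < g x) := W.defMap_lt hf hg

@[fun_prop]
theorem defMap_le {f g : Γ → W.Nat} (hf : DefMap M f) (hg : DefMap M g) :
    DefMap M (fun x => f x ≤ g x) := by
  simpa only [← not_lt] using (defMap_lt' hg hf).not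

/-- `Naturals.induction` in terms of the semiring structure. -/
theorem ind {P : W.Nat → Prop} (hP : DefMap M P) (h0 : P 0) (hs : ∀ n, P n → P (n + 1))
    (n : W.Nat) : P n :=
  W.induction hP h0 (fun n h => succ_eq n ▸ hs n h) n

theorem lt_add_one {m n : W.Nat} : m < n + 1 ↔ m ≤ n := by
  rw [← succ_eq]
  exact lt_succ

theorem zero_le' (n : W.Nat) : 0 ≤ n := zero_lt_or_eq n

theorem eq_zero_or_succ (n : W.Nat) : n = 0 ∨ ∃ m, n = m + 1 :=
  ind (P := fun n : W.Nat => n = 0 ∨ ∃ m, n = m + 1) (by fun_prop) (Or.inl rfl)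
    (fun n _ => Or.inr ⟨n, rfl⟩) n

instance : IsStrictOrderedRing W.Nat :=
  have key : ∀ a b : W.Nat, a < b → ∀ c : W.Nat, a + c < b + c := fun a b h c => by
    refine ind (P := fun c => a + c < b + c) (by fun_prop) (by simpa using h) ?_ c
    intro c ih
    rw [← add_assoc, ← add_assoc, ← succ_eq, ← succ_eq]
    exact succ_lt_succ ih
  have key' : ∀ a b : W.Nat, a < b → ∀ c : W.Nat, 0 < c → a * c < b * c := fun a b h c hc => by
    have : ∀ c, a * (c + 1) < b * (c + 1) := fun c => by
      refine ind (P := fun c => a * (c + 1) < b * (c + 1)) (by fun_prop) (by simpa using h) ?_ c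
      intro c ih
      rw [mul_add a _ 1, mul_add b _ 1, mul_one, mul_one]
      refine (key _ _ ih a).trans ?_
      rw [add_comm _ a, add_comm _ b]
      exact key _ _ h _
    rcases eq_zero_or_succ c with rfl | ⟨c, rfl⟩
    · exact (lt_irrefl _ hc).elim
    · exact this c
  { add_le_add_left := fun a b h c => by
      rcases h.lt_or_eq with h | rfl
      · exact (key a b h c).le
      · exact le_rfl
    le_of_add_le_add_left := fun a b c h => by
      by_contra hbc
      rw [not_le] at hbc
      have := key _ _ hbc a
      rw [add_comm c, add_comm b] at this
      exact absurd h (not_le.2 this)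
    zero_le_one := zero_le' 1
    exists_pair_ne := ⟨0, 1, fun h => by
      have h1 : (0 : W.Nat) < 0 + 1 := lt_add_one.2 le_rfl
      rw [zero_add, ← h] at h1
      exact lt_irrefl _ h1⟩
    mul_lt_mul_of_pos_left := fun a ha b c h => by
      simpa only [mul_comm] using key' b c h a ha
    mul_lt_mul_of_pos_right := fun a ha b c h => by
      simpa only [mul_comm] using key' b c h a ha }

/-- The least number principle. -/
theorem exists_least {P : W.Nat → Prop} (hP : DefMap M P) (h : ∃ n, P n) :
    ∃ n, P n ∧ ∀ m, m < n → ¬ P m := by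
  by_contra hne
  push Not at hne
  have : ∀ n, ∀ m, m < n → ¬ P m := by
    refine ind (P := fun n => ∀ m, m < n → ¬ P m) (by fun_prop)
      (fun m hm => absurd hm (not_lt.2 (zero_le' m))) fun n ih m hm hPm => ?_
    rcases (lt_add_one.1 hm).lt_or_eq with h | rfl
    · exact ih m h hPm
    · obtain ⟨k, hk, hPk⟩ := hne m hPm
      exact ih k hk hPk
  obtain ⟨n, hn⟩ := h
  exact this (n + 1) n (lt_add_one.2 le_rfl) hn

/-- Definition by recursion along the natural numbers, with parameters. -/
theorem exists_rec [ClassType M Γ] [ClassType M T] {f : Γ → T} {g : (Γ × W.Nat) × T → T}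
    (hf : DefMap M f) (hg : DefMap M g) :
    ∃ F : Γ × W.Nat → T, DefMap M F ∧
      (∀ x, F (x, 0) = f x) ∧ ∀ x n, F (x, n + 1) = g ((x, n), F (x, n)) := by
  -- `h` satisfies the recursion equations below `n`
  let A : Γ → W.Nat → {h : W.Nat → T // Internal M h} → Prop := fun x n h =>
    h.1 0 = f x ∧ ∀ i, i < n → h.1 (i + 1) = g ((x, i), h.1 i)
  have hA : DefMap M (fun p : (Γ × W.Nat) × {h : W.Nat → T // Internal M h} =>
      A p.1.1 p.1.2 p.2) := by
    simp only [A]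
    fun_prop
  have hex : ∀ x n, ∃ h, A x n h := by
    intro x n
    refine ind (P := fun n => ∃ h, A x n h) ?_ ?_ ?_ n
    · refine DefMap.exists' (P := fun n h => A x n h) ?_
      exact hA.comp (g := fun p : W.Nat × {h : W.Nat → T // Internal M h} => ((x, p.1), p.2))
        (by fun_prop)
    · exact ⟨⟨fun _ => f x, internal_fun (by fun_prop)⟩, rfl,
        fun i hi => absurd hi (not_lt.2 (zero_le' i))⟩
    · rintro n ⟨h, h0, hs⟩
      classical
      refine ⟨⟨fun i => if i = n + 1 then g ((x, n), h.1 n) else h.1 i,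
        internal_fun (by fun_prop)⟩, ?_, fun i hi => ?_⟩
      · have : (0 : W.Nat) ≠ n + 1 := (lt_add_one.2 (zero_le' n)).ne
        simp only [this, if_false, h0]
      · have hi' := lt_add_one.1 hi
        have h1 : i ≠ n + 1 := hi.ne
        simp only [h1, if_false, add_left_inj]
        rcases hi'.lt_or_eq with hi' | rfl
        · simp only [hi'.ne, if_false, hs i hi']
        · simp
  -- such functions agree up to `n`
  have huniq : ∀ x n h h', A x n h → A x n h' → h.1 n = h'.1 n := by
    intro x n h h' hh hh'
    have : ∀ i, i ≤ n → h.1 i = h'.1 i := by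
      refine ind (P := fun i => i ≤ n → h.1 i = h'.1 i) (by fun_prop)
        (fun _ => hh.1.trans hh'.1.symm) fun i ih hi => ?_
      have hi' : i < n := (lt_add_one.2 le_rfl).trans_le hi
      rw [hh.2 i hi', hh'.2 i hi', ih hi'.le]
    exact this n le_rfl
  choose h hh using hex
  refine ⟨fun p => (h p.1 p.2).1 p.2, ?_, fun x => (hh x 0).1, fun x n => ?_⟩
  · refine DefMap.of_graph_iff (P := fun p t => ∃ h, A p.1 p.2 h ∧ h.1 p.2 = t) ?_ ?_
    · refine DefMap.exists' (P := fun (p : (Γ × W.Nat) × T) h =>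
        A p.1.1 p.1.2 h ∧ h.1 p.1.2 = p.2) (DefMap.and ?_ (by fun_prop))
      exact hA.comp (g := fun p : ((Γ × W.Nat) × T) × {h : W.Nat → T // Internal M h} =>
        (p.1.1, p.2)) (by fun_prop)
    · rintro ⟨x, n⟩ t
      exact ⟨fun ht => ⟨_, hh x n, ht⟩, fun ⟨h', hh', ht⟩ => (huniq x n _ _ (hh x n) hh').trans ht⟩
  · have h1 := hh x (n + 1)
    refine (h1.2 n (lt_add_one.2 le_rfl)).trans (congrArg (fun t => g ((x, n), t)) ?_)
    exact (huniq x n _ _ ⟨h1.1, fun i hi => h1.2 i (hi.trans (lt_add_one.2 le_rfl))⟩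
      (hh x n))

end Naturals

/-! ### Real numbers of the model -/

namespace RealLine

variable {R : RealLine M}

@[fun_prop]
theorem defMap_hAdd {f g : Γ → R.Num} (hf : DefMap M f) (hg : DefMap M g) :
    DefMap M (fun x => f x + g x) := (defMap_of_internal R.internal_add).comp (hf.prodMk hg)

@[fun_prop]
theorem defMap_hMul {f g : Γ → R.Num} (hf : DefMap M f) (hg : DefMap M g) :
    DefMap M (fun x => f x * g x) := (defMap_of_internal R.internal_mul).comp (hf.prodMk hg)

@[fun_prop]
theorem defMap_le {f g : Γ → R.Num} (hf : DefMap M f) (hg : DefMap M g) :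
    DefMap M (fun x => f x ≤ g x) :=
  (hf.prodMk hg).mem (DefMap.const_of_internal R.internal_le)

@[fun_prop]
theorem defMap_lt {f g : Γ → R.Num} (hf : DefMap M f) (hg : DefMap M g) :
    DefMap M (fun x => f x < g x) := by
  simpa only [← not_le] using (defMap_le hg hf).not

@[fun_prop]
theorem defMap_hSub {f g : Γ → R.Num} (hf : DefMap M f) (hg : DefMap M g) :
    DefMap M (fun x => f x - g x) :=
  DefMap.of_graph_iff (P := fun x t => f x = t + g x) (by fun_prop) fun _ _ => sub_eq_iff_eq_add

end RealLine

end SetModel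

namespace SetModel
open Coded Coding

namespace Naturals

variable {M : Type u} [Membership M M] [hZF : Fact (IsZF M)] {W : Naturals M}
variable {Γ : Type*} [Coded M Γ]

/-! ### Finite sequences of the model -/

/-- The set of all points of the Baire space which agree with `w` below `n`. -/
def cyl (w : W.Baire) (n : W.Nat) : Set W.Baire := {w' | ∀ i, i < n → w'.1 i = w.1 i}

instance setType_below (n : W.Nat) : SetType M {i : W.Nat // W.Lt i n} :=
  setType_subtype (by fun_prop)

theorem internal_restrict (w : W.Baire) (n : W.Nat) :
    Internal M (⟨n, fun i => w.1 i.1⟩ : Σ n : W.Nat, ({i : W.Nat // W.Lt i n} → W.Nat)) := by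
  obtain ⟨f, hf⟩ := internal_fun (M := M) (f := fun i : {i : W.Nat // W.Lt i n} => w.1 i.1)
    (by fun_prop)
  obtain ⟨p, hp⟩ := exists_isPair n.1 f
  exact ⟨p, n.1, f, rfl, hf, hp⟩

/-- The finite sequence `w ↾ n`. -/
def restrict (p : W.Baire × W.Nat) : W.FinSeq := ⟨⟨p.2, fun i => p.1.1 i.1⟩,
  internal_restrict p.1 p.2⟩

theorem cone_restrict (w : W.Baire) (n : W.Nat) : W.cone (restrict (w, n)) = cyl w n :=
  Set.ext fun _ => ⟨fun h i hi => h ⟨i, hi⟩, fun h i => h i.1 i.2⟩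

@[fun_prop]
theorem defMap_restrict : DefMap M (restrict (W := W)) := by
  refine ⟨fun p s => ∃ a b h, IsPair p a b ∧ IsPair s b h ∧ ∀ e, e ∈ h ↔ e ∈ a ∧
    ∃ i y, i ∈ b ∧ IsPair e i y, ?_, ?_⟩
  · exact Dv.ex (Dv.ex (Dv.ex ((Dv.isPair 3 2 1).and ((Dv.isPair 4 1 0).and
      (Dv.all ((Dv.mem 0 1).iff ((Dv.mem 0 3).and (Dv.ex (Dv.ex
        ((Dv.mem 1 4).and (Dv.isPair 2 1 0)))))))))))
  · rintro ⟨w, n⟩ m ⟨a, b, ha, rfl, hp⟩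
    obtain ⟨s, b', h, rfl, hh, hs⟩ := internal_restrict w n
    have hh' : ∀ e, e ∈ h ↔ e ∈ a ∧ ∃ i y, i ∈ n.1 ∧ IsPair e i y := by
      intro e
      refine (hh.2 e).trans ⟨?_, ?_⟩
      · rintro ⟨i, x, y, rfl, hy, he⟩
        exact ⟨(ha.2 e).2 ⟨i.1, _, y, rfl, hy, he⟩, i.1.1, y, i.2, he⟩
      · rintro ⟨he, i, y, hi, he'⟩
        obtain ⟨x, _, z, rfl, hz, hxz⟩ := (ha.2 e).1 he
        obtain ⟨rfl, rfl⟩ := hxz.inj he'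
        exact ⟨⟨x, hi⟩, _, _, rfl, hz, he'⟩
    refine ⟨s, ⟨n.1, h, rfl, hh, hs⟩, fun s' => ⟨?_, ?_⟩⟩
    · rintro ⟨a', b', h', hp', hs', he⟩
      obtain ⟨rfl, rfl⟩ := hp'.inj hp
      have : h' = h := ext_set fun e => (he e).trans (hh' e).symm
      subst this
      exact hs'.unique hs
    · rintro rfl
      exact ⟨a, n.1, h, hp, hs, hh'⟩

theorem restrict_surjective : Function.Surjective (restrict (W := W)) := by
  rintro ⟨⟨n, f⟩, hs⟩
  have hf : DefMap M f := by
    obtain ⟨p, a, b, ha, hb, hp⟩ := hs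
    exact defMap_of_internal ⟨b, hb⟩
  classical
  have hw : DefMap M (fun i : W.Nat => if h : W.Lt i n then f ⟨i, h⟩ else 0) := by
    refine DefMap.of_graph_iff (P := fun i v => (∃ j : {i : W.Nat // W.Lt i n}, j.1 = i ∧ f j = v) ∨
      (¬ W.Lt i n ∧ (0 : W.Nat) = v)) (by fun_prop) fun i v => ?_
    by_cases h : W.Lt i n
    · simp only [h, dif_pos, not_true, false_and, or_false]
      exact ⟨fun hv => ⟨⟨i, h⟩, rfl, hv⟩, by rintro ⟨⟨j, hj⟩, rfl, hv⟩; exact hv⟩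
    · simp only [h, dif_neg, not_false_iff, true_and]
      exact ⟨Or.inr, by rintro (⟨⟨j, hj⟩, rfl, hv⟩ | hv); exacts [(h hj).elim, hv]⟩
  refine ⟨(⟨_, internal_fun hw⟩, n), Subtype.ext ?_⟩
  refine Sigma.ext rfl (heq_of_eq (funext fun i => ?_))
  exact dif_pos i.2

@[fun_prop]
theorem defMap_cyl {f : Γ → W.Baire} {g : Γ → W.Nat} (hf : DefMap M f) (hg : DefMap M g) :
    DefMap M (fun x => cyl (f x) (g x)) := by
  unfold cyl
  fun_prop

theorem mem_cyl_self (w : W.Baire) (n : W.Nat) : w ∈ cyl w n := fun _ _ => rfl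

theorem cyl_eq_of_mem {w w' : W.Baire} {n : W.Nat} (h : w' ∈ cyl w n) : cyl w' n = cyl w n :=
  Set.ext fun v => forall₂_congr fun i hi => by rw [h i hi]

theorem cyl_antitone (w : W.Baire) {m n : W.Nat} (h : m ≤ n) : cyl w n ⊆ cyl w m :=
  fun _ hv i hi => hv i (hi.trans_le h)

theorem isOpenSet_iff {U : Set W.Baire} : W.IsOpenSet U ↔ ∀ w ∈ U, ∃ n, cyl w n ⊆ U := by
  refine forall₂_congr fun w _ => ⟨?_, ?_⟩
  · rintro ⟨s, hs, hsU⟩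
    obtain ⟨⟨w', n⟩, rfl⟩ := restrict_surjective s
    rw [cone_restrict] at hs hsU
    exact ⟨n, (cyl_eq_of_mem hs).trans_subset hsU⟩
  · rintro ⟨n, hn⟩
    exact ⟨restrict (w, n), by rw [cone_restrict]; exact ⟨mem_cyl_self w n, hn⟩⟩

/-! ### Codes of finite sequences -/

/-- A polynomial pairing function. -/
noncomputable def pair (a b : W.Nat) : W.Nat := (a + b) * (a + b) + a

theorem pair_inj {a b c d : W.Nat} (h : pair a b = pair c d) : a = c ∧ b = d := by
  have key : ∀ a b c d : W.Nat, a + b < c + d → pair a b < pair c d := by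
    intro a b c d h
    have h1 : a + b + 1 ≤ c + d := by
      rw [← not_lt, lt_add_one, not_le]
      exact h
    have h2 := mul_le_mul h1 h1 (zero_le' _) (zero_le' _)
    calc (a + b) * (a + b) + a < (a + b) * (a + b) + a + 1 := lt_add_one.2 le_rfl
      _ ≤ (a + b) * (a + b) + a + 1 + (b + (a + b)) := le_add_of_nonneg_right (zero_le' _)
      _ = (a + b + 1) * (a + b + 1) := by ring
      _ ≤ (c + d) * (c + d) := h2
      _ ≤ (c + d) * (c + d) + c := le_add_of_nonneg_right (zero_le' _)
  have h1 : a + b = c + d := by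
    rcases lt_trichotomy (a + b) (c + d) with h' | h' | h'
    · exact absurd h (key _ _ _ _ h').ne
    · exact h'
    · exact absurd h (key _ _ _ _ h').ne'
  unfold pair at h
  rw [h1] at h
  have h2 := add_left_cancel h
  subst h2
  exact ⟨rfl, add_left_cancel h1⟩

@[fun_prop]
theorem defMap_pair {f g : Γ → W.Nat} (hf : DefMap M f) (hg : DefMap M g) :
    DefMap M (fun x => pair (f x) (g x)) := by
  unfold pair
  fun_prop

/-- Finite sequences are coded by iterating the pairing function, starting with `0` for the empty
sequence. -/
theorem exists_code (W : Naturals M) : ∃ c : W.Baire × W.Nat → W.Nat, DefMap M c ∧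
    ∀ w w' n n', c (w, n) = c (w', n') ↔ n = n' ∧ w' ∈ cyl w n := by
  obtain ⟨c, hc, h0, hs⟩ := exists_rec (W := W) (Γ := W.Baire) (T := W.Nat) (f := fun _ => 0)
    (g := fun p => pair p.2 (p.1.1.1 p.1.2) + 1) (by fun_prop) (by fun_prop)
  have hne : ∀ a : W.Nat, (0 : W.Nat) ≠ a + 1 := fun a => (lt_add_one.2 (zero_le' a)).ne
  refine ⟨c, hc, fun w w' n => ?_⟩
  refine ind (P := fun n => ∀ n', c (w, n) = c (w', n') ↔ n = n' ∧ w' ∈ cyl w n)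
    (by fun_prop) ?_ ?_ n
  · intro n'
    rcases eq_zero_or_succ n' with rfl | ⟨m, rfl⟩
    · exact iff_of_true (by rw [h0, h0]) ⟨rfl, fun i hi => absurd hi (not_lt.2 (zero_le' i))⟩
    · rw [h0, hs]
      exact iff_of_false (hne _) fun h => hne m h.1
  · intro n ih n'
    rcases eq_zero_or_succ n' with rfl | ⟨m, rfl⟩
    · rw [h0, hs]
      exact iff_of_false (hne _).symm fun h => hne n h.1.symm
    · rw [hs, hs]
      constructor
      · intro h
        obtain ⟨h1, h2⟩ := pair_inj (add_right_cancel h)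
        obtain ⟨rfl, h3⟩ := (ih m).1 h1
        refine ⟨rfl, fun i hi => ?_⟩
        rcases (lt_add_one.1 hi).lt_or_eq with hi | rfl
        · exact h3 i hi
        · exact h2.symm
      · rintro ⟨h1, h2⟩
        cases add_right_cancel h1
        rw [(ih n).2 ⟨rfl, cyl_antitone w (lt_add_one.2 le_rfl).le h2⟩]
        simp only [h2 n (lt_add_one.2 le_rfl)]

/-- A number coding the finite sequence `w ↾ n`. -/
noncomputable def code (p : W.Baire × W.Nat) : W.Nat := Classical.choose (exists_code W) p

@[fun_prop]
theorem defMap_code : DefMap M (code (W := W)) := (Classical.choose_spec (exists_code W)).1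

theorem code_eq_iff {w w' : W.Baire} {n n' : W.Nat} :
    code (w, n) = code (w', n') ↔ n = n' ∧ w' ∈ cyl w n :=
  (Classical.choose_spec (exists_code W)).2 w w' n n'

/-- The open set of all sequences with an initial segment whose code is in `X`. -/
noncomputable def openSet (X : Set W.Nat) : Set W.Baire := {w | ∃ n, code (w, n) ∈ X}

/-- The basic open set with code `a`, which is empty if `a` is not a code. -/
noncomputable def codeSet (a : W.Nat) : Set W.Baire := {w | ∃ n, code (w, n) = a}

@[fun_prop]
theorem defMap_openSet {f : Γ → Set W.Nat} (hf : DefMap M f) :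
    DefMap M (fun x => openSet (f x)) := by
  have : DefMap M (fun p : (Γ × W.Baire) × W.Nat => f p.1.1) :=
    hf.comp DefMap.id'.fst.fst
  unfold openSet
  fun_prop

@[fun_prop]
theorem defMap_codeSet {f : Γ → W.Nat} (hf : DefMap M f) :
    DefMap M (fun x => codeSet (f x)) := by
  unfold codeSet
  fun_prop

theorem codeSet_code (w : W.Baire) (n : W.Nat) : codeSet (code (w, n)) = cyl w n := by
  ext v
  constructor
  · rintro ⟨m, hm⟩
    obtain ⟨rfl, h⟩ := code_eq_iff.1 hm.symm
    exact h
  · intro h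
    exact ⟨n, (code_eq_iff.2 ⟨rfl, h⟩).symm⟩

theorem mem_openSet_iff {X : Set W.Nat} {w : W.Baire} : w ∈ openSet X ↔ ∃ a ∈ X, w ∈ codeSet a :=
  ⟨fun ⟨n, hn⟩ => ⟨_, hn, n, rfl⟩, fun ⟨_, ha, n, hn⟩ => ⟨n, hn ▸ ha⟩⟩

theorem isOpenSet_openSet (X : Set W.Nat) : W.IsOpenSet (openSet X) := by
  rw [isOpenSet_iff]
  rintro w ⟨n, hn⟩
  exact ⟨n, fun v hv => ⟨n, by rwa [← (code_eq_iff (w := w)).2 ⟨rfl, hv⟩]⟩⟩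

/-- Every open set of the model is coded by a real. -/
theorem exists_openSet_eq (U : {U : Set W.Baire // Internal M U}) (hU : W.IsOpenSet U.1) :
    ∃ X : W.Real, openSet X.1 = U.1 := by
  refine ⟨⟨{a | ∃ w : W.Baire, ∃ n, code (w, n) = a ∧ ∀ v, v ∈ cyl w n → v ∈ U.1},
    internal_setOf (by fun_prop)⟩, Set.ext fun w => ⟨?_, fun hw => ?_⟩⟩
  · rintro ⟨n, v, m, hv, h⟩
    obtain ⟨rfl, h'⟩ := code_eq_iff.1 hv
    exact h w h'
  · obtain ⟨n, hn⟩ := isOpenSet_iff.1 hU w hw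
    exact ⟨n, w, n, rfl, fun v hv => hn hv⟩

/-! ### Borel sets of the model -/

/-- The union of the sets `F m` for `m < n`. -/
def unionBelow (F : W.Nat → Set W.Baire) (n : W.Nat) : Set W.Baire := {w | ∃ m, m < n ∧ w ∈ F m}

omit hZF in
theorem iUnion_eq (F : W.Nat → Set W.Baire) : (⋃ n, F n) = {w | ∃ n, w ∈ F n} := by
  ext; simp

@[fun_prop]
theorem defMap_unionBelow {F : W.Nat → Set W.Baire} (hF : DefMap M F) :
    DefMap M (unionBelow F) := by
  unfold unionBelow
  fun_prop

theorem unionBelow_zero (F : W.Nat → Set W.Baire) : unionBelow F 0 = ∅ :=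
  Set.eq_empty_of_forall_notMem fun _ ⟨m, hm, _⟩ => absurd hm (not_lt.2 (zero_le' m))

theorem unionBelow_succ (F : W.Nat → Set W.Baire) (n : W.Nat) :
    unionBelow F (n + 1) = unionBelow F n ∪ F n := by
  ext w
  constructor
  · rintro ⟨m, hm, hw⟩
    rcases (lt_add_one.1 hm).lt_or_eq with hm | rfl
    · exact Or.inl ⟨m, hm, hw⟩
    · exact Or.inr hw
  · rintro (⟨m, hm, hw⟩ | hw)
    · exact ⟨m, hm.trans (lt_add_one.2 le_rfl), hw⟩
    · exact ⟨n, lt_add_one.2 le_rfl, hw⟩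

namespace IsBorel

variable {S T : Set W.Baire}

theorem compl (hS : W.IsBorel S) : W.IsBorel Sᶜ :=
  ⟨(DefMap.const_of_internal (Γ := W.Nat) hS.1).compl.internal_apply 0,
    fun K hK hU => hK.compl_mem S (hS.2 K hK hU)⟩

theorem setOf_exists {F : W.Nat → Set W.Baire} (hF : DefMap M F) (h : ∀ n, W.IsBorel (F n)) :
    W.IsBorel {w | ∃ n, w ∈ F n} := by
  refine ⟨internal_setOf (by fun_prop), fun K hK hU => ?_⟩
  rw [← iUnion_eq]
  exact hK.iUnion_mem F (internal_fun hF) fun n => (h n).2 K hK hU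

theorem union (hS : W.IsBorel S) (hT : W.IsBorel T) : W.IsBorel (S ∪ T) := by
  classical
  have h1 : DefMap M (fun _ : W.Nat × W.Baire => S) := DefMap.const_of_internal hS.1
  have h2 : DefMap M (fun _ : W.Nat × W.Baire => T) := DefMap.const_of_internal hT.1
  have h3 : DefMap M (fun n : W.Nat => {w | (n = 0 ∧ w ∈ S) ∨ (n ≠ 0 ∧ w ∈ T)}) :=
    DefMap.ofPred (((by fun_prop : DefMap M (fun p : W.Nat × W.Baire => p.1 = 0)).and
      (DefMap.id'.snd.mem h1)).or
        ((by fun_prop : DefMap M (fun p : W.Nat × W.Baire => p.1 ≠ 0)).and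
      (DefMap.id'.snd.mem h2)))
  have := setOf_exists h3 fun n => by
    by_cases hn : n = 0
    · have : {w | (n = 0 ∧ w ∈ S) ∨ (n ≠ 0 ∧ w ∈ T)} = S := by ext; simp [hn]
      rwa [this]
    · have : {w | (n = 0 ∧ w ∈ S) ∨ (n ≠ 0 ∧ w ∈ T)} = T := by ext; simp [hn]
      rwa [this]
  have heq : S ∪ T = {w | ∃ n : W.Nat, w ∈ {w | (n = 0 ∧ w ∈ S) ∨ (n ≠ 0 ∧ w ∈ T)}} := by
    ext w
    constructor
    · rintro (hw | hw)
      · exact ⟨0, Or.inl ⟨rfl, hw⟩⟩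
      · exact ⟨1, Or.inr ⟨one_ne_zero, hw⟩⟩
    · rintro ⟨n, ⟨-, hw⟩ | ⟨-, hw⟩⟩
      exacts [Or.inl hw, Or.inr hw]
  rwa [heq]

theorem inter (hS : W.IsBorel S) (hT : W.IsBorel T) : W.IsBorel (S ∩ T) := by
  rw [← compl_compl (S ∩ T), Set.compl_inter]
  exact (hS.compl.union hT.compl).compl

theorem diff (hS : W.IsBorel S) (hT : W.IsBorel T) : W.IsBorel (S \ T) := hS.inter hT.compl

omit hZF in
theorem of_isOpenSet (hS : Internal M S) (h : W.IsOpenSet S) : W.IsBorel S :=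
  ⟨hS, fun _ _ hU => hU S hS h⟩

theorem openSet (X : W.Real) : W.IsBorel (openSet X.1) :=
  of_isOpenSet ((by fun_prop : DefMap M fun X : W.Real => Naturals.openSet X.1).internal_apply X)
    (isOpenSet_openSet _)

theorem cyl (w : W.Baire) (n : W.Nat) : W.IsBorel (cyl w n) :=
  of_isOpenSet ((by fun_prop : DefMap M fun w : W.Baire => Naturals.cyl w n).internal_apply w)
    (isOpenSet_iff.2 fun _ hv => ⟨n, (cyl_eq_of_mem hv).subset⟩)

theorem codeSet (a : W.Nat) : W.IsBorel (codeSet a) := by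
  refine of_isOpenSet
    ((by fun_prop : DefMap M fun a : W.Nat => Naturals.codeSet a).internal_apply a) ?_
  have : Naturals.codeSet a = Naturals.openSet {a} := rfl
  rw [this]
  exact isOpenSet_openSet _

theorem empty : W.IsBorel (∅ : Set W.Baire) := by
  have : (∅ : Set W.Baire) = {w | w ≠ w} := by ext; simp
  refine of_isOpenSet ?_ fun x hx => hx.elim
  rw [this]
  exact internal_setOf (by fun_prop)

theorem univ : W.IsBorel (Set.univ : Set W.Baire) := by
  rw [← Set.compl_empty]
  exact empty.compl

theorem unionBelow {F : W.Nat → Set W.Baire} (hF : DefMap M F) (h : ∀ n, W.IsBorel (F n))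
    (n : W.Nat) : W.IsBorel (unionBelow F n) := by
  have := setOf_exists (F := fun m => {w | m < n ∧ w ∈ F m}) (by fun_prop) fun m => by
    by_cases hm : m < n
    · simpa [hm] using h m
    · simpa [hm] using empty
  exact this

end IsBorel

/-! ### Borel probabilities of the model -/

section Measure

variable {R : RealLine M} {μ : Set W.Baire → R.Num} (hμ : W.IsBorelProbability R μ)
include hμ

theorem defMap_measure {F : Γ → Set W.Baire} (hF : DefMap M F) (h : ∀ x, W.IsBorel (F x)) :
    DefMap M (fun x => μ (F x)) :=
  (defMap_of_internal hμ.internal).comp (g := fun x => ⟨F x, h x⟩) hF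

theorem exists_sums {F : W.Nat → Set W.Baire} (hF : DefMap M F) (h : ∀ n, W.IsBorel (F n))
    (hd : ∀ m n, m ≠ n → Disjoint (F m) (F n)) :
    ∃ s : W.Nat → R.Num, DefMap M s ∧ s 0 = 0 ∧ (∀ n, s (n + 1) = s n + μ (F n)) ∧
      IsLUB (Set.range s) (μ {w | ∃ n, w ∈ F n}) := by
  obtain ⟨s, h1, h2, h3, h4⟩ := hμ.iUnion F (internal_fun hF) h hd
  rw [iUnion_eq] at h4
  exact ⟨s, defMap_of_internal h1, h2, fun n => succ_eq n ▸ h3 n, h4⟩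

theorem measure_empty : μ ∅ = 0 := by
  obtain ⟨s, -, h1, h2, h3⟩ := exists_sums hμ (F := fun _ => ∅)
    (DefMap.const_of_internal IsBorel.empty.1) (fun _ => IsBorel.empty) (fun _ _ _ => by simp)
  have h4 : {w : W.Baire | ∃ _ : W.Nat, w ∈ (∅ : Set W.Baire)} = ∅ := by ext; simp
  rw [h4] at h3
  have h5 := h3.1 ⟨0 + 1 + 1, rfl⟩
  rw [h2, h2, h1] at h5
  linarith [hμ.nonneg ∅ IsBorel.empty]

theorem measure_union {S T : Set W.Baire} (hS : W.IsBorel S) (hT : W.IsBorel T)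
    (hd : Disjoint S T) : μ (S ∪ T) = μ S + μ T := by
  have h1 : DefMap M (fun _ : W.Nat × W.Baire => S) := DefMap.const_of_internal hS.1
  have h2 : DefMap M (fun _ : W.Nat × W.Baire => T) := DefMap.const_of_internal hT.1
  let F : W.Nat → Set W.Baire := fun n => {w | (n = 0 ∧ w ∈ S) ∨ (n = 1 ∧ w ∈ T)}
  have h3 : DefMap M F :=
    DefMap.ofPred (((by fun_prop : DefMap M (fun p : W.Nat × W.Baire => p.1 = 0)).and
      (DefMap.id'.snd.mem h1)).or
        ((by fun_prop : DefMap M (fun p : W.Nat × W.Baire => p.1 = 1)).and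
      (DefMap.id'.snd.mem h2)))
  have F0 : F 0 = S := by ext; simp [F]
  have F1 : F 1 = T := by ext; simp [F]
  have F2 : ∀ n, F (n + 1 + 1) = ∅ := by
    intro n
    have e1 : n + 1 + 1 ≠ (0 : W.Nat) :=
      (lt_of_le_of_lt (zero_le' _) (lt_add_one.2 le_rfl)).ne'
    have e2 : n + 1 + 1 ≠ (1 : W.Nat) := fun h => by
      have h' : n + 1 + 1 = 0 + 1 := by rw [h, zero_add]
      exact (lt_of_le_of_lt (zero_le' n) (lt_add_one.2 le_rfl)).ne' (add_right_cancel h')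
    ext; simp [F, e1, e2]
  have hB : ∀ n, W.IsBorel (F n) := by
    intro n
    rcases eq_zero_or_succ n with rfl | ⟨n, rfl⟩
    · rwa [F0]
    rcases eq_zero_or_succ n with rfl | ⟨n, rfl⟩
    · rwa [zero_add, F1]
    · rw [F2]
      exact IsBorel.empty
  obtain ⟨s, hs, e0, e1, hl⟩ := exists_sums hμ h3 hB fun m n hmn => by
    rw [Set.disjoint_left] at hd ⊢
    rintro w (⟨rfl, hw⟩ | ⟨rfl, hw⟩) (⟨rfl, hw'⟩ | ⟨rfl, hw'⟩)
    exacts [hmn rfl, hd hw hw', hd hw' hw, hmn rfl]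
  have heq : {w | ∃ n, w ∈ F n} = S ∪ T := by
    ext w
    constructor
    · rintro ⟨n, ⟨-, hw⟩ | ⟨-, hw⟩⟩
      exacts [Or.inl hw, Or.inr hw]
    · rintro (hw | hw)
      · exact ⟨0, Or.inl ⟨rfl, hw⟩⟩
      · exact ⟨1, Or.inr ⟨rfl, hw⟩⟩
  rw [heq] at hl
  have s1 : s 1 = μ S := by
    have := e1 0
    rwa [e0, F0, zero_add, zero_add] at this
  have s2 : ∀ n, s (n + 1 + 1) = μ S + μ T := by
    refine ind (P := fun n => s (n + 1 + 1) = μ S + μ T) (by fun_prop) ?_ fun n ih => ?_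
    · rw [e1, zero_add, s1, F1]
    · rw [e1, ih, F2, measure_empty hμ, _root_.add_zero]
  refine le_antisymm (hl.2 ?_) ((s2 0).symm.le.trans (hl.1 ⟨_, rfl⟩))
  rintro _ ⟨n, rfl⟩
  rcases eq_zero_or_succ n with rfl | ⟨n, rfl⟩
  · rw [e0]
    exact add_nonneg (hμ.nonneg S hS) (hμ.nonneg T hT)
  rcases eq_zero_or_succ n with rfl | ⟨n, rfl⟩
  · rw [zero_add, s1]
    exact le_add_of_nonneg_right (hμ.nonneg T hT)
  · exact (s2 n).le

theorem measure_diff {S T : Set W.Baire} (hS : W.IsBorel S) (hT : W.IsBorel T) (h : S ⊆ T) :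
    μ (T \ S) = μ T - μ S := by
  have := measure_union hμ hS (hT.diff hS) Set.disjoint_sdiff_right
  rw [Set.union_sdiff_cancel h] at this
  rw [this, add_sub_cancel_left]

theorem measure_mono {S T : Set W.Baire} (hS : W.IsBorel S) (hT : W.IsBorel T) (h : S ⊆ T) :
    μ S ≤ μ T := by
  have := measure_diff hμ hS hT h
  linarith [hμ.nonneg _ (hT.diff hS)]

theorem measure_union_le {S T : Set W.Baire} (hS : W.IsBorel S) (hT : W.IsBorel T) :
    μ (S ∪ T) ≤ μ S + μ T := by
  have := measure_union hμ hS (hT.diff hS) Set.disjoint_sdiff_right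
  rw [Set.union_sdiff_self] at this
  rw [this]
  exact add_le_add le_rfl (measure_mono hμ (hT.diff hS) hT Set.sdiff_subset)

/-- Continuity from below. -/
theorem measure_setOf_exists_le {F : W.Nat → Set W.Baire} (hF : DefMap M F)
    (h : ∀ n, W.IsBorel (F n)) {ε : R.Num} (hε : ∀ n, μ (unionBelow F n) ≤ ε) :
    μ {w | ∃ n, w ∈ F n} ≤ ε := by
  -- the union is made disjoint, so that σ-additivity applies
  let F' : W.Nat → Set W.Baire := fun n => F n \ unionBelow F n
  have hF' : DefMap M F' := hF.sdiff (by fun_prop)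
  have hB : ∀ n, W.IsBorel (F' n) := fun n => (h n).diff (IsBorel.unionBelow hF h n)
  have hd' : ∀ m n, m < n → Disjoint (F' m) (F' n) := fun m n hmn => by
    rw [Set.disjoint_left]
    rintro w ⟨hw, -⟩ ⟨-, hw'⟩
    exact hw' ⟨m, hmn, hw⟩
  obtain ⟨s, hs, e0, e1, hl⟩ := exists_sums hμ hF' hB fun m n hmn => by
    rcases lt_or_gt_of_ne hmn with hmn | hmn
    exacts [hd' m n hmn, (hd' n m hmn).symm]
  have heq : {w | ∃ n, w ∈ F' n} = {w | ∃ n, w ∈ F n} := by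
    ext w
    refine ⟨fun ⟨n, hn⟩ => ⟨n, hn.1⟩, fun hw => ?_⟩
    obtain ⟨n, hn, hmin⟩ := exists_least (W := W) (P := fun n => w ∈ F n) (by fun_prop) hw
    exact ⟨n, hn, fun ⟨m, hm, hwm⟩ => hmin m hm hwm⟩
  rw [heq] at hl
  refine hl.2 ?_
  rintro _ ⟨n, rfl⟩
  have hU : DefMap M (fun n => μ (unionBelow F n)) :=
    defMap_measure hμ (by fun_prop) (IsBorel.unionBelow hF h)
  have : s n = μ (unionBelow F n) := by
    refine ind (P := fun n => s n = μ (unionBelow F n)) (hs.eq hU) ?_ (fun n ih => ?_) n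
    · rw [e0, unionBelow_zero, measure_empty hμ]
    · have := measure_union hμ (IsBorel.unionBelow hF h n) (hB n) Set.disjoint_sdiff_right
      rw [Set.union_sdiff_self, ← unionBelow_succ] at this
      rw [e1, ih, this]
  rw [this]
  exact hε n

theorem measure_setOf_exists_eq_zero {F : W.Nat → Set W.Baire} (hF : DefMap M F)
    (h : ∀ n, W.IsBorel (F n)) (h0 : ∀ n, μ (F n) = 0) : μ {w | ∃ n, w ∈ F n} = 0 := by
  refine le_antisymm (measure_setOf_exists_le hμ hF h ?_) (hμ.nonneg _ (IsBorel.setOf_exists hF h))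
  have hU : DefMap M (fun n => μ (unionBelow F n)) :=
    defMap_measure hμ (by fun_prop) (IsBorel.unionBelow hF h)
  refine ind (P := fun n => μ (unionBelow F n) ≤ 0)
    (RealLine.defMap_le hU (DefMap.const _)) ?_ fun n ih => ?_
  · rw [unionBelow_zero, measure_empty hμ]
  · rw [unionBelow_succ]
    have := measure_union_le hμ (IsBorel.unionBelow hF h n) (h n)
    rw [h0, _root_.add_zero] at this
    exact this.trans ih

end Measure

/-- There is a sequence of positive numbers whose partial sums are bounded by a given number. -/
theorem exists_summable (W : Naturals M) {R : RealLine M} {ε : R.Num} (hε : 0 < ε) :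
    ∃ e : W.Nat → R.Num, DefMap M e ∧ (∀ n, 0 < e n) ∧ ∃ s : W.Nat → R.Num, DefMap M s ∧ s 0 = 0 ∧
      (∀ n, s (n + 1) = s n + e n) ∧ ∀ n, s n ≤ ε := by
  obtain ⟨c, hc, c0, cs⟩ := exists_rec (W := W) (Γ := W.Nat) (T := R.Num) (f := fun _ => ε)
    (g := fun p => 2⁻¹ * p.2) (by fun_prop) (by fun_prop)
  have hpos : ∀ n, 0 < c (0, n) := by
    refine ind (P := fun n => 0 < c (0, n)) (by fun_prop) (by rwa [c0]) fun n ih => ?_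
    rw [cs]
    positivity
  refine ⟨fun n => c (0, n + 1), by fun_prop, fun n => hpos _, fun n => ε - c (0, n), by fun_prop,
    ?_, fun n => ?_, fun n => ?_⟩
  · simp only [c0, sub_self]
  · simp only [cs]
    ring
  · linarith [hpos n]

/-! ### Even and odd numbers -/

theorem double_lt {a b : W.Nat} (h : a < b) : a + a + 1 < b + b := by
  have h1 : a + 1 ≤ b := by rwa [← not_lt, lt_add_one, not_le]
  calc a + a + 1 < a + a + 1 + 1 := lt_add_one.2 le_rfl
    _ = (a + 1) + (a + 1) := by ring
    _ ≤ b + b := add_le_add h1 h1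

theorem double_inj {a b : W.Nat} (h : a + a = b + b) : a = b := by
  rcases lt_trichotomy a b with h' | h' | h'
  · exact absurd h ((lt_add_one.2 le_rfl).trans (double_lt h')).ne
  · exact h'
  · exact absurd h ((lt_add_one.2 le_rfl).trans (double_lt h')).ne'

theorem double_ne (a b : W.Nat) : a + a ≠ b + b + 1 := by
  intro h
  rcases lt_or_ge b a with h' | h'
  · exact (double_lt h').ne h.symm
  · have := add_le_add h' h'
    rw [h] at this
    exact absurd (lt_add_one.2 le_rfl) (not_lt.2 this)

theorem even_or_odd (n : W.Nat) : (∃ k, n = k + k) ∨ ∃ k, n = k + k + 1 := by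
  refine ind (P := fun n : W.Nat => (∃ k, n = k + k) ∨ ∃ k, n = k + k + 1) (by fun_prop)
    (Or.inl ⟨0, (_root_.add_zero _).symm⟩) ?_ n
  rintro n (⟨k, rfl⟩ | ⟨k, rfl⟩)
  · exact Or.inr ⟨k, rfl⟩
  · exact Or.inl ⟨k + 1, by ring⟩

/-- The numbers `n` with `2 n ∈ Z`. -/
noncomputable def evenPart (Z : W.Real) : W.Real :=
  ⟨{n | n + n ∈ Z.1}, internal_setOf (by fun_prop)⟩

/-- The numbers `n` with `2 n + 1 ∈ Z`. -/
noncomputable def oddPart (Z : W.Real) : W.Real :=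
  ⟨{n | n + n + 1 ∈ Z.1}, internal_setOf (by fun_prop)⟩

theorem exists_join (X Y : W.Real) : ∃ Z : W.Real, evenPart Z = X ∧ oddPart Z = Y := by
  refine ⟨⟨{n | (∃ k, k ∈ X.1 ∧ n = k + k) ∨ ∃ k, k ∈ Y.1 ∧ n = k + k + 1},
    internal_setOf (by fun_prop)⟩, Subtype.ext (Set.ext fun n => ⟨?_, ?_⟩),
    Subtype.ext (Set.ext fun n => ⟨?_, ?_⟩)⟩
  · rintro (⟨k, hk, h⟩ | ⟨k, hk, h⟩)
    · rwa [double_inj h]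
    · exact (double_ne _ _ h).elim
  · exact fun h => Or.inl ⟨n, h, rfl⟩
  · rintro (⟨k, hk, h⟩ | ⟨k, hk, h⟩)
    · exact (double_ne _ _ h.symm).elim
    · rwa [double_inj (add_right_cancel h)]
  · exact fun h => Or.inr ⟨n, h, rfl⟩

/-! ### Regularity of Borel probabilities -/

omit hZF in
/-- A set of objects of a subtype has the same representative as the corresponding set of objects of
the ambient type. -/
theorem internal_image_val {T : Type*} [Coded M T] {p : T → Prop} {K : Set {t : T // p t}}
    (hK : Internal M K) : Internal M (Subtype.val '' K) := by
  obtain ⟨a, h1, h2⟩ := hK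
  refine ⟨a, ?_, fun m => (h2 m).trans ⟨?_, ?_⟩⟩
  · rintro _ ⟨x, hx, rfl⟩
    exact h1 x hx
  · rintro ⟨x, hx, hm⟩
    exact ⟨x.1, ⟨x, hx, rfl⟩, hm⟩
  · rintro ⟨_, ⟨x, hx, rfl⟩, hm⟩
    exact ⟨x, hx, hm⟩

/-- The real `Z` codes open sets covering `S` and its complement, with an intersection of measure at
most `ε`. -/
def Approximates {R : RealLine M} (μ : Set W.Baire → R.Num) (S : Set W.Baire) (ε : R.Num)
    (Z : W.Real) : Prop :=
  S ⊆ openSet (evenPart Z).1 ∧ Sᶜ ⊆ openSet (oddPart Z).1 ∧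
    μ (openSet (evenPart Z).1 ∩ openSet (oddPart Z).1) ≤ ε

section

variable {R : RealLine M} {μ : Set W.Baire → R.Num} (hμ : W.IsBorelProbability R μ)
include hμ

theorem defMap_approximates {f : Γ → Set W.Baire} {g : Γ → R.Num} {h : Γ → W.Real}
    (hf : DefMap M f) (hg : DefMap M g) (hh : DefMap M h) :
    DefMap M (fun x => Approximates μ (f x) (g x) (h x)) := by
  have : DefMap M (fun x => μ (openSet (evenPart (h x)).1 ∩ openSet (oddPart (h x)).1)) :=
    defMap_measure hμ (by fun_prop) fun _ => (IsBorel.openSet _).inter (IsBorel.openSet _)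
  exact (hf.subset (by fun_prop)).and
    ((hf.compl.subset (by fun_prop)).and (RealLine.defMap_le this hg))

theorem exists_approximates_of_clopen (S : {S : Set W.Baire // Internal M S})
    (h : W.IsOpenSet S.1) (h' : W.IsOpenSet S.1ᶜ) {ε : R.Num} (hε : 0 < ε) :
    ∃ Z, Approximates μ S.1 ε Z := by
  obtain ⟨X, hX⟩ := exists_openSet_eq S h
  obtain ⟨Y, hY⟩ := exists_openSet_eq ⟨S.1ᶜ,
    (DefMap.const S : DefMap M fun _ : W.Nat => S).val.compl.internal_apply 0⟩ h'
  obtain ⟨Z, rfl, rfl⟩ := exists_join X Y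
  refine ⟨Z, hX.symm.subset, hY.symm.subset, ?_⟩
  rw [hX, hY, Set.inter_compl_self, measure_empty hμ]
  exact hε.le

omit hμ in
theorem isOpenSet_forall_lt {V : W.Nat → Set W.Baire} (hV : DefMap M V)
    (h : ∀ n, W.IsOpenSet (V n)) (n : W.Nat) : W.IsOpenSet {w | ∀ m, m < n → w ∈ V m} := by
  rw [isOpenSet_iff]
  intro w
  refine ind (P := fun n => (∀ m, m < n → w ∈ V m) →
    ∃ l, cyl w l ⊆ {w | ∀ m, m < n → w ∈ V m}) (by fun_prop) ?_ ?_ n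
  · exact fun _ => ⟨0, fun v _ m hm => absurd hm (not_lt.2 (zero_le' m))⟩
  · intro n ih hw
    obtain ⟨l, hl⟩ := ih fun m hm => hw m (hm.trans (lt_add_one.2 le_rfl))
    obtain ⟨k, hk⟩ := isOpenSet_iff.1 (h n) w (hw n (lt_add_one.2 le_rfl))
    refine ⟨max l k, fun v hv m hm => ?_⟩
    rcases (lt_add_one.1 hm).lt_or_eq with hm | rfl
    · exact hl (cyl_antitone w (le_max_left _ _) hv) m hm
    · exact hk (cyl_antitone w (le_max_right _ _) hv)

/-- For the complement of the union, the infinite intersection of the open sets covering the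
complements of the `F n` need not be open. It is replaced by a finite intersection, whose length is
such that the remaining part of the open set covering the union is small. -/
theorem exists_approximates_iUnion (hAC : W.CountableChoiceReals) {F : W.Nat → Set W.Baire}
    (hF : DefMap M F) (h : ∀ n, ∀ ε : R.Num, 0 < ε → ∃ Z, Approximates μ (F n) ε Z) {ε : R.Num}
    (hε : 0 < ε) : ∃ Z, Approximates μ {w | ∃ n, w ∈ F n} ε Z := by
  obtain ⟨e, he, hpos, s, hs, s0, s1, hsε⟩ := exists_summable W (half_pos hε)
  obtain ⟨f, hf, hfa⟩ := hAC (fun n => {Z | Approximates μ (F n) (e n) Z})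
    (internal_fun (DefMap.ofPred (defMap_approximates hμ (by fun_prop) (by fun_prop)
      (by fun_prop)))) fun n => h n (e n) (hpos n)
  replace hf := defMap_of_internal hf
  let U : W.Nat → Set W.Baire := fun n => openSet (evenPart (f n)).1
  let V : W.Nat → Set W.Baire := fun n => openSet (oddPart (f n)).1
  have hU : DefMap M U := by simp only [U]; fun_prop
  have hV : DefMap M V := by simp only [V]; fun_prop
  have hUB : ∀ n, W.IsBorel (U n) := fun n => IsBorel.openSet _
  have hVB : ∀ n, W.IsBorel (V n) := fun n => IsBorel.openSet _
  have hUVB : ∀ n, W.IsBorel (U n ∩ V n) := fun n => (hUB n).inter (hVB n)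
  have hUU := IsBorel.setOf_exists hU hUB
  -- finitely many of the sets `U n` almost exhaust their union
  obtain ⟨N, hN⟩ : ∃ N, μ {w | ∃ n, w ∈ U n} - ε / 2 < μ (unionBelow U N) := by
    by_contra hne
    push Not at hne
    have := measure_setOf_exists_le hμ hU hUB hne
    linarith
  obtain ⟨X, hX⟩ := exists_openSet_eq ⟨{w | ∃ n, w ∈ U n}, hUU.1⟩ (by
    rw [isOpenSet_iff]
    rintro w ⟨n, hw⟩
    obtain ⟨l, hl⟩ := isOpenSet_iff.1 (isOpenSet_openSet (evenPart (f n)).1) w hw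
    exact ⟨l, fun v hv => ⟨n, hl hv⟩⟩)
  obtain ⟨Y, hY⟩ := exists_openSet_eq ⟨{w | ∀ m, m < N → w ∈ V m}, internal_setOf (by fun_prop)⟩
    (isOpenSet_forall_lt hV (fun n => isOpenSet_openSet _) N)
  obtain ⟨Z, rfl, rfl⟩ := exists_join X Y
  refine ⟨Z, ?_, ?_, ?_⟩
  · rw [hX]
    rintro w ⟨n, hw⟩
    exact ⟨n, (hfa n).1 hw⟩
  · rw [hY]
    exact fun w hw m _ => (hfa m).2.1 fun hwm => hw ⟨m, hwm⟩
  have hbound : μ {w | ∃ n, w ∈ U n ∩ V n} ≤ ε / 2 := by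
    have hUV : DefMap M (fun n => U n ∩ V n) := by fun_prop
    refine measure_setOf_exists_le hμ hUV hUVB fun n => le_trans ?_ (hsε n)
    have h1 : DefMap M (fun n => μ (unionBelow (fun n => U n ∩ V n) n)) :=
      defMap_measure hμ (defMap_unionBelow hUV) (IsBorel.unionBelow hUV hUVB)
    refine ind (P := fun n => μ (unionBelow (fun n => U n ∩ V n) n) ≤ s n)
      (RealLine.defMap_le h1 hs) ?_ (fun n ih => ?_) n
    · rw [unionBelow_zero, measure_empty hμ, s0]
    · rw [unionBelow_succ, s1]
      exact (measure_union_le hμ (IsBorel.unionBelow hUV hUVB n) (hUVB n)).trans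
        (add_le_add ih (hfa n).2.2)
  have hUN := IsBorel.unionBelow hU hUB N
  have hUVU := IsBorel.setOf_exists (F := fun n => U n ∩ V n) (by fun_prop) hUVB
  have hsub : openSet (evenPart Z).1 ∩ openSet (oddPart Z).1 ⊆
      {w | ∃ n, w ∈ U n ∩ V n} ∪ ({w | ∃ n, w ∈ U n} \ unionBelow U N) := by
    rw [hX, hY]
    rintro w ⟨hwU, hwV⟩
    by_cases hw : w ∈ unionBelow U N
    · obtain ⟨m, hm, hwm⟩ := hw
      exact Or.inl ⟨m, hwm, hwV m hm⟩
    · exact Or.inr ⟨hwU, hw⟩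
  have h1 := measure_mono hμ ((IsBorel.openSet _).inter (IsBorel.openSet _))
    (hUVU.union (hUU.diff hUN)) hsub
  have h2 := measure_union_le hμ hUVU (hUU.diff hUN)
  have h3 := measure_diff hμ hUN hUU fun w ⟨m, _, hw⟩ => ⟨m, hw⟩
  linarith

/-- The sets which can be approximated from outside, together with their complements, by open sets
form a σ-algebra of the model; it is here that countable choice is used. -/
theorem exists_approximates (hAC : W.CountableChoiceReals) {S : Set W.Baire} (hS : W.IsBorel S)
    {ε : R.Num} (hε : 0 < ε) : ∃ Z, Approximates μ S ε Z := by
  let K : Set {S : Set W.Baire // Internal M S} :=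
    {S | ∀ ε : R.Num, 0 < ε → ∃ Z, Approximates μ S.1 ε Z}
  have hK : ∀ S, S ∈ Subtype.val '' K ↔
      Internal M S ∧ ∀ ε : R.Num, 0 < ε → ∃ Z, Approximates μ S ε Z :=
    fun S => ⟨by rintro ⟨S, hS, rfl⟩; exact ⟨S.2, hS⟩, fun h => ⟨⟨S, h.1⟩, h.2, rfl⟩⟩
  have hopen : ∀ w n, W.IsOpenSet (cyl w n)ᶜ := fun w n => isOpenSet_iff.2 fun v hv =>
    ⟨n, fun v' hv' hv'' => hv fun i hi => (hv' i hi).symm.trans (hv'' i hi)⟩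
  have hσ : W.IsSigmaAlgebra (Subtype.val '' K) := by
    refine ⟨internal_image_val (internal_setOf ?_), ?_, ?_, ?_⟩
    · exact DefMap.forall' (P := fun (S : {S : Set W.Baire // Internal M S}) (ε : R.Num) =>
        0 < ε → ∃ Z, Approximates μ S.1 ε Z) (DefMap.imp (by fun_prop)
          (DefMap.exists' (defMap_approximates hμ (by fun_prop) (by fun_prop) (by fun_prop))))
    · refine (hK _).2 ⟨IsBorel.empty.1, fun ε hε => ?_⟩
      refine exists_approximates_of_clopen hμ ⟨∅, IsBorel.empty.1⟩ (fun w hw => hw.elim) ?_ hε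
      exact isOpenSet_iff.2 fun w _ => ⟨0, fun v _ hv => hv⟩
    · intro S hS
      obtain ⟨h1, h2⟩ := (hK S).1 hS
      refine (hK _).2 ⟨(DefMap.const_of_internal (Γ := W.Nat) h1).compl.internal_apply 0,
        fun ε hε => ?_⟩
      obtain ⟨Z, hZ1, hZ2, hZ3⟩ := h2 ε hε
      obtain ⟨Z', h3, h4⟩ := exists_join (oddPart Z) (evenPart Z)
      refine ⟨Z', ?_, ?_, ?_⟩
      · rwa [h3]
      · rwa [h4, compl_compl]
      · rwa [h3, h4, Set.inter_comm]
    · intro F hF h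
      rw [iUnion_eq]
      have hF := defMap_of_internal hF
      refine (hK _).2 ⟨internal_setOf (by fun_prop), fun ε hε => ?_⟩
      exact exists_approximates_iUnion hμ hAC hF (fun n => ((hK _).1 (h n)).2) hε
  -- an open set is a countable union of cylinders, which are clopen
  refine ((hK S).1 (hS.2 _ hσ fun U hU hUo => ?_)).2 ε hε
  obtain ⟨X, hX⟩ := exists_openSet_eq ⟨U, hU⟩ hUo
  have : U = ⋃ a, {w | a ∈ X.1 ∧ w ∈ codeSet a} := by
    rw [← show openSet X.1 = U from hX, iUnion_eq]
    ext w
    exact mem_openSet_iff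
  rw [this]
  refine hσ.iUnion_mem _ (internal_fun (by fun_prop)) fun a => ?_
  have hint : Internal M {w | a ∈ X.1 ∧ w ∈ codeSet a} := internal_setOf (by fun_prop)
  refine (hK _).2 ⟨hint, fun ε hε => ?_⟩
  refine exists_approximates_of_clopen hμ ⟨_, hint⟩ ?_ ?_ hε
  · rw [isOpenSet_iff]
    rintro w ⟨ha, hw⟩
    obtain ⟨n, hn⟩ := isOpenSet_iff.1 (isOpenSet_openSet {a}) w hw
    exact ⟨n, fun v hv => ⟨ha, hn hv⟩⟩
  · rw [isOpenSet_iff]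
    intro w hw
    by_cases hc : a ∈ X.1 ∧ ∃ v n, code (W := W) (v, n) = a
    · obtain ⟨ha, v, n, rfl⟩ := hc
      have hw' : w ∈ (cyl v n)ᶜ := fun h => hw ⟨ha, by rwa [codeSet_code]⟩
      obtain ⟨l, hl⟩ := isOpenSet_iff.1 (hopen v n) w hw'
      exact ⟨l, fun v' hv' ⟨_, h⟩ => hl hv' (by rwa [codeSet_code] at h)⟩
    · exact ⟨0, fun v _ ⟨ha, n, hv⟩ => hc ⟨ha, v, n, hv⟩⟩

/-- Outer regularity at null sets. -/
theorem exists_openSet_of_measure_eq_zero (hAC : W.CountableChoiceReals) {S : Set W.Baire}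
    (hS : W.IsBorel S) (h0 : μ S = 0) {ε : R.Num} (hε : 0 < ε) :
    ∃ X : W.Real, S ⊆ openSet X.1 ∧ μ (openSet X.1) ≤ ε := by
  obtain ⟨Z, h1, h2, h3⟩ := exists_approximates hμ hAC hS hε
  refine ⟨evenPart Z, h1, ?_⟩
  have hU := IsBorel.openSet (evenPart Z)
  have hV := IsBorel.openSet (oddPart Z)
  have hsub : openSet (evenPart Z).1 ⊆ S ∪ (openSet (evenPart Z).1 ∩ openSet (oddPart Z).1) := by
    intro w hw
    by_cases hwS : w ∈ S
    · exact Or.inl hwS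
    · exact Or.inr ⟨hw, h2 hwS⟩
  have h4 := measure_mono hμ hU (hS.union (hU.inter hV)) hsub
  have h5 := measure_union_le hμ hS (hU.inter hV)
  linarith

end

/-! ### Plays of reals against a random opponent -/

open Classical in
/-- The characteristic function of a real. -/
noncomputable def bit (x : W.Real) (i : W.Nat) : W.Nat := if i ∈ x.1 then 1 else 0

@[fun_prop]
theorem defMap_bit {f : Γ → W.Real} {g : Γ → W.Nat} (hf : DefMap M f) (hg : DefMap M g) :
    DefMap M (fun x => bit (f x) (g x)) := by
  classical
  unfold bit
  fun_prop

theorem bit_eq_one {x : W.Real} {i : W.Nat} : bit x i = 1 ↔ i ∈ x.1 := by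
  unfold bit
  split_ifs with h <;> simp [h]

theorem bit_eq_zero {x : W.Real} {i : W.Nat} : bit x i = 0 ↔ i ∉ x.1 := by
  unfold bit
  split_ifs with h <;> simp [h]

variable (W) in
/-- A partition of the positions of a play into the ones at which a given real is played and the
ones at which the opponent moves at random. -/
structure Schedule where
  fixed : W.Nat → W.Nat
  random : W.Nat → W.Nat
  defMap_fixed : DefMap M fixed
  defMap_random : DefMap M random
  fixed_inj : ∀ {i j}, fixed i = fixed j → i = j
  random_inj : ∀ {i j}, random i = random j → i = j
  fixed_ne_random : ∀ i j, fixed i ≠ random j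
  cover : ∀ n, (∃ i, n = fixed i) ∨ ∃ i, n = random i

/-- In the play `w`, the moves at the positions `f i` are the digits of `x`. -/
def Plays (f : W.Nat → W.Nat) (x : W.Real) (w : W.Baire) : Prop := ∀ i, w.1 (f i) = bit x i

/-- In the play `w`, the moves at the positions `f i` smaller than `n` are the digits of `x`. -/
def PlaysBelow (f : W.Nat → W.Nat) (x : W.Real) (w : W.Baire) (n : W.Nat) : Prop :=
  ∀ i, f i < n → w.1 (f i) = bit x i

theorem defMap_playsBelow {f : W.Nat → W.Nat} (hf : DefMap M f) {g : Γ → W.Real} {h : Γ → W.Baire}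
    {k : Γ → W.Nat} (hg : DefMap M g) (hh : DefMap M h) (hk : DefMap M k) :
    DefMap M (fun x => PlaysBelow f (g x) (h x) (k x)) := by
  unfold PlaysBelow
  fun_prop

theorem exists_plays (P : W.Schedule) (x y : W.Real) :
    ∃ w : W.Baire, Plays P.fixed x w ∧ Plays P.random y w := by
  classical
  obtain ⟨d, r, hd, hr, hdi, hri, hne, -⟩ := P
  refine ⟨⟨fun n => if (∃ i, n = d i ∧ i ∈ x.1) ∨ ∃ i, n = r i ∧ i ∈ y.1 then 1 else 0,
    internal_fun (by fun_prop)⟩, fun i => ?_, fun i => ?_⟩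
  · have : ((∃ j, d i = d j ∧ j ∈ x.1) ∨ ∃ j, d i = r j ∧ j ∈ y.1) ↔ i ∈ x.1 := by
      constructor
      · rintro (⟨j, hj, h⟩ | ⟨j, hj, h⟩)
        · rwa [hdi hj]
        · exact (hne _ _ hj).elim
      · exact fun h => Or.inl ⟨i, rfl, h⟩
    simp only [this]
    rfl
  · have : ((∃ j, r i = d j ∧ j ∈ x.1) ∨ ∃ j, r i = r j ∧ j ∈ y.1) ↔ i ∈ y.1 := by
      constructor
      · rintro (⟨j, hj, h⟩ | ⟨j, hj, h⟩)
        · exact (hne _ _ hj.symm).elim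
        · rwa [hri hj]
      · exact fun h => Or.inr ⟨i, rfl, h⟩
    simp only [this]
    rfl

/-- The law of the play when `z` is played at the fixed positions, while the move `w n` is played
with probability `p (w, n)` after `w ↾ n` if `n` is a random position. -/
structure IsLaw {R : RealLine M} (P : W.Schedule) (p : W.Baire × W.Nat → R.Num) (z : W.Real)
    (μ : Set W.Baire → R.Num) : Prop where
  prob : W.IsBorelProbability R μ
  fixed : ∀ w i, w.1 (P.fixed i) = bit z i →
    μ (cyl w (P.fixed i + 1)) = μ (cyl w (P.fixed i))
  fixed_ne : ∀ w i, w.1 (P.fixed i) ≠ bit z i → μ (cyl w (P.fixed i + 1)) = 0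
  random : ∀ w i, μ (cyl w (P.random i + 1)) = μ (cyl w (P.random i)) * p (w, P.random i)

theorem cyl_zero (w : W.Baire) : cyl w 0 = Set.univ :=
  Set.eq_univ_of_forall fun _ i hi => absurd hi (not_lt.2 (zero_le' i))

/-- The measure of a cylinder which is compatible with the real played does not depend on that real:
it is the product of the probabilities of the random moves. -/
theorem exists_weight {R : RealLine M} (P : W.Schedule) {p : W.Baire × W.Nat → R.Num}
    (hp : DefMap M p) (hp' : ∀ w w' n, w' ∈ cyl w (n + 1) → p (w', n) = p (w, n)) :
    ∃ q : W.Nat → R.Num, DefMap M q ∧ ∀ z μ, IsLaw P p z μ → ∀ w n,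
      PlaysBelow P.fixed z w n → μ (cyl w n) = q (code (w, n)) := by
  classical
  have hd := P.defMap_fixed
  obtain ⟨m, hm, m0, ms⟩ := exists_rec (W := W) (Γ := W.Baire) (T := R.Num) (f := fun _ => 1)
    (g := fun t => if ∃ i, t.1.2 = P.fixed i then t.2 else t.2 * p t.1) (by fun_prop)
      (by fun_prop)
  have hm' : ∀ w w' n, w' ∈ cyl w n → m (w', n) = m (w, n) := by
    intro w w'
    refine ind (P := fun n => w' ∈ cyl w n → m (w', n) = m (w, n)) (by fun_prop) ?_ ?_
    · intro _
      rw [m0, m0]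
    · intro n ih h
      rw [ms, ms]
      simp only [hp' _ _ _ h, ih (cyl_antitone w (lt_add_one.2 le_rfl).le h)]
  -- `m (w, n)` depends only on `w ↾ n`, so it can be regarded as a function of the code
  have hex : ∀ a, ∃ t : R.Num, (∃ w n, code (w, n) = a ∧ m (w, n) = t) ∨
      ((¬ ∃ (w : W.Baire) (n : W.Nat), code (w, n) = a) ∧ t = 0) := by
    intro a
    by_cases h : ∃ (w : W.Baire) (n : W.Nat), code (w, n) = a
    · obtain ⟨w, n, h⟩ := h
      exact ⟨_, Or.inl ⟨w, n, h, rfl⟩⟩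
    · exact ⟨0, Or.inr ⟨h, rfl⟩⟩
  choose q hq using hex
  have hqm : ∀ w n, q (code (w, n)) = m (w, n) := by
    intro w n
    rcases hq (code (w, n)) with ⟨w', n', h, h'⟩ | ⟨h, -⟩
    · obtain ⟨rfl, hw⟩ := code_eq_iff.1 h
      rw [← h', hm' _ _ _ hw]
    · exact (h ⟨w, n, rfl⟩).elim
  refine ⟨q, ?_, ?_⟩
  · refine DefMap.of_graph_iff (P := fun a t => (∃ w n, code (w, n) = a ∧ m (w, n) = t) ∨
      ((¬ ∃ (w : W.Baire) (n : W.Nat), code (w, n) = a) ∧ t = 0)) (by fun_prop) fun a t => ?_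
    refine ⟨fun h => h ▸ hq a, ?_⟩
    rintro (⟨w, n, rfl, rfl⟩ | ⟨h, rfl⟩)
    · exact hqm w n
    · rcases hq a with ⟨w, n, h', -⟩ | ⟨-, h'⟩
      exacts [(h ⟨w, n, h'⟩).elim, h']
  · intro z μ hμ w n
    rw [hqm]
    have h1 : DefMap M (fun n => μ (cyl w n)) :=
      defMap_measure hμ.prob (by fun_prop) fun n => IsBorel.cyl w n
    refine ind (P := fun n => PlaysBelow P.fixed z w n → μ (cyl w n) = m (w, n))
      ((defMap_playsBelow hd (by fun_prop) (by fun_prop) (by fun_prop)).imp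
        (h1.eq (by fun_prop))) ?_ ?_ n
    · intro _
      rw [cyl_zero, m0, hμ.prob.univ]
    · intro n ih h
      have ih' := ih fun i hi => h i (hi.trans (lt_add_one.2 le_rfl))
      rw [ms]
      rcases P.cover n with ⟨i, rfl⟩ | ⟨i, rfl⟩
      · rw [if_pos ⟨i, rfl⟩, hμ.fixed w i (h i (lt_add_one.2 le_rfl)), ih']
      · rw [if_neg fun ⟨j, hj⟩ => P.fixed_ne_random j i hj.symm, hμ.random, ih']

/-- Almost surely, the real `z` is played at the fixed positions. -/
theorem IsLaw.measure_not_plays {R : RealLine M} {P : W.Schedule} {p : W.Baire × W.Nat → R.Num}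
    {z : W.Real} {μ : Set W.Baire → R.Num} (hμ : IsLaw P p z μ) :
    W.IsBorel {w | ¬ Plays P.fixed z w} ∧ μ {w | ¬ Plays P.fixed z w} = 0 := by
  have hd := P.defMap_fixed
  let F : W.Nat → Set W.Baire := fun a =>
    {v | (∃ (w : W.Baire) (i : W.Nat), code (w, P.fixed i + 1) = a ∧
      w.1 (P.fixed i) ≠ bit z i) ∧ v ∈ codeSet a}
  have hF : DefMap M F := by
    obtain ⟨d, r, hd, hr, hdi, hri, hne, -⟩ := P
    simp only [F]
    fun_prop
  have key : ∀ a, F a = ∅ ∨ ∃ w i, F a = cyl w (P.fixed i + 1) ∧ w.1 (P.fixed i) ≠ bit z i := by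
    intro a
    by_cases h : ∃ (w : W.Baire) (i : W.Nat), code (w, P.fixed i + 1) = a ∧
      w.1 (P.fixed i) ≠ bit z i
    · obtain ⟨w, i, rfl, h'⟩ := h
      refine Or.inr ⟨w, i, ?_, h'⟩
      rw [← codeSet_code]
      ext v
      exact ⟨fun hv => hv.2, fun hv => ⟨⟨w, i, rfl, h'⟩, hv⟩⟩
    · exact Or.inl (Set.eq_empty_of_forall_notMem fun v hv => h hv.1)
  have hB : ∀ a, W.IsBorel (F a) := fun a => by
    rcases key a with h | ⟨w, i, h, -⟩
    · rw [h]; exact IsBorel.empty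
    · rw [h]; exact IsBorel.cyl _ _
  have heq : {w | ¬ Plays P.fixed z w} = {w | ∃ a, w ∈ F a} := by
    ext w
    constructor
    · intro h
      obtain ⟨i, hi⟩ := not_forall.1 h
      exact ⟨code (w, P.fixed i + 1), ⟨w, i, rfl, hi⟩, _, rfl⟩
    · rintro ⟨a, ha⟩ h
      rcases key a with h' | ⟨v, i, h', hne⟩
      · rw [h'] at ha
        exact ha
      · rw [h'] at ha
        exact hne ((ha _ (lt_add_one.2 le_rfl)).symm.trans (h i))
  rw [heq]
  refine ⟨IsBorel.setOf_exists hF hB, measure_setOf_exists_eq_zero hμ.prob hF hB fun a => ?_⟩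
  rcases key a with h | ⟨w, i, h, hne⟩
  · rw [h, measure_empty hμ.prob]
  · rw [h, hμ.fixed_ne w i hne]

/-- The partial sums of a series indexed by a set of natural numbers which is given by its
characteristic function. -/
theorem exists_partialSum (W : Naturals M) {R : RealLine M} {q : W.Nat → R.Num}
    (hq : DefMap M q) : ∃ s : W.Baire × W.Nat → R.Num, DefMap M s ∧ (∀ w, s (w, 0) = 0) ∧
      (∀ w n, w.1 n = 1 → s (w, n + 1) = s (w, n) + q n) ∧
      ∀ w n, w.1 n ≠ 1 → s (w, n + 1) = s (w, n) := by
  classical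
  obtain ⟨s, hs, s0, s1⟩ := exists_rec (W := W) (Γ := W.Baire) (T := R.Num) (f := fun _ => 0)
    (g := fun t => if t.1.1.1 t.1.2 = 1 then t.2 + q t.1.2 else t.2) (by fun_prop)
      (by fun_prop)
  exact ⟨s, hs, s0, fun w n h => by rw [s1, if_pos h], fun w n h => by rw [s1, if_neg h]⟩

/-- The set `X` of codes of finite sequences witnesses that `z` is almost surely answered by reals
in `D`: its sequences are compatible with `z`, have total measure at most `1/2`, and cover all plays
in which the opponent plays a real outside of `D`. Here `s` is the partial sum function of the
measures of cylinders, and the finite subsets of `X` are given by sequences with value `1` at their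
elements. -/
structure Witnesses {R : RealLine M} (P : W.Schedule) (s : W.Baire × W.Nat → R.Num)
    (D : Set W.Real) (z X : W.Real) : Prop where
  compatible : ∀ a ∈ X.1, ∃ w n, code (w, n) = a ∧ PlaysBelow P.fixed z w n
  small : ∀ w n, (∀ i, i < n → w.1 i = 1 → i ∈ X.1) → s (w, n) ≤ 2⁻¹
  covers : ∀ y, y ∈ D ∨ ∃ a ∈ X.1, ∃ w n, code (w, n) = a ∧ PlaysBelow P.random y w n

section

variable {R : RealLine M} {P : W.Schedule} {p : W.Baire × W.Nat → R.Num} {q : W.Nat → R.Num}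
  {s : W.Baire × W.Nat → R.Num} {z : W.Real} {μ : Set W.Baire → R.Num} {Q T : Set W.Baire}
  {C D : Set W.Real}

/-- If `z ∉ C`, almost every play of `z` is answered by a real outside of `D`, so that the cylinders
coded by a witness would cover a set of measure one with total measure at most `1/2`. -/
theorem not_witnesses_of_notMem (hs : DefMap M s)
    (s0 : ∀ w, s (w, 0) = 0) (s1 : ∀ w n, w.1 n = 1 → s (w, n + 1) = s (w, n) + q n)
    (s2 : ∀ w n, w.1 n ≠ 1 → s (w, n + 1) = s (w, n)) (hμ : IsLaw P p z μ)
    (hq : ∀ w n, PlaysBelow P.fixed z w n → μ (cyl w n) = q (code (w, n)))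
    (hT : W.IsBorel T) (hT0 : μ T = 0) (hQT : Q ⊆ T)
    (hQ : ∀ y w, Plays P.fixed z w → Plays P.random y w → (w ∈ Q ↔ ¬ (z ∈ C ↔ y ∈ D)))
    (hQ' : ∀ w, Plays P.fixed z w → (∀ y, ¬ Plays P.random y w) → w ∈ Q)
    (hz : z ∉ C) (X : W.Real) : ¬ Witnesses P s D z X := by
  rintro ⟨h1, h2, h3⟩
  obtain ⟨hE, hE0⟩ := hμ.measure_not_plays
  -- a play of `z` outside of the null set `T` is answered by some `y ∉ D`, hence covered by `X`
  have hcover : Set.univ ⊆ openSet X.1 ∪ (T ∪ {w | ¬ Plays P.fixed z w}) := by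
    intro w _
    by_cases hw : Plays P.fixed z w
    · by_cases hy : ∃ y, Plays P.random y w
      · obtain ⟨y, hy⟩ := hy
        rcases h3 y with hyD | ⟨a, ha, w₁, n, rfl, hw₁⟩
        · exact Or.inr (Or.inl (hQT ((hQ y w hw hy).2 fun h => hz (h.2 hyD))))
        · obtain ⟨w₂, n', hc, hw₂⟩ := h1 _ ha
          obtain ⟨rfl, hcyl⟩ := code_eq_iff.1 hc
          refine Or.inl ⟨n', ?_⟩
          have : code (w₁, n') = code (w, n') := by
            refine code_eq_iff.2 ⟨rfl, fun i hi => ?_⟩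
            rcases P.cover i with ⟨j, rfl⟩ | ⟨j, rfl⟩
            · rw [hw j, hcyl _ hi, hw₂ j hi]
            · rw [hy j, hw₁ j hi]
          rwa [← this]
      · exact Or.inr (Or.inl (hQT (hQ' w hw (not_exists.1 hy))))
    · exact Or.inr (Or.inr hw)
  -- the total measure of the cylinders coded by `X` is at most `1/2`
  have hsmall : μ (openSet X.1) ≤ 2⁻¹ := by
    let F : W.Nat → Set W.Baire := fun a => {w | a ∈ X.1 ∧ w ∈ codeSet a}
    have hF : DefMap M F := by simp only [F]; fun_prop
    have hFa : ∀ a, a ∈ X.1 → F a = codeSet a := fun a ha => by ext; simp [F, ha]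
    have hFa' : ∀ a, a ∉ X.1 → F a = ∅ := fun a ha => by ext; simp [F, ha]
    have hB : ∀ a, W.IsBorel (F a) := fun a => by
      by_cases ha : a ∈ X.1
      · rw [hFa a ha]; exact IsBorel.codeSet a
      · rw [hFa' a ha]; exact IsBorel.empty
    have : openSet X.1 = {w | ∃ a, w ∈ F a} := Set.ext fun w => mem_openSet_iff
    rw [this]
    refine measure_setOf_exists_le hμ.prob hF hB fun n => ?_
    let χ : W.Baire := ⟨bit X, internal_fun (by fun_prop)⟩
    refine le_trans ?_ (h2 χ n fun i _ hi => bit_eq_one.1 hi)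
    have hU : DefMap M (fun n => μ (unionBelow F n)) :=
      defMap_measure hμ.prob (by fun_prop) (IsBorel.unionBelow hF hB)
    refine ind (P := fun n => μ (unionBelow F n) ≤ s (χ, n))
      (RealLine.defMap_le hU (by fun_prop)) ?_ (fun n ih => ?_) n
    · rw [unionBelow_zero, measure_empty hμ.prob, s0]
    · rw [unionBelow_succ]
      by_cases hn : n ∈ X.1
      · rw [s1 χ n (bit_eq_one.2 hn)]
        refine (measure_union_le hμ.prob (IsBorel.unionBelow hF hB n) (hB n)).trans
          (add_le_add ih ?_)
        obtain ⟨w, m, rfl, hw⟩ := h1 n hn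
        rw [hFa _ hn, codeSet_code, hq w m hw]
      · rw [s2 χ n (mt bit_eq_one.1 hn), hFa' n hn, Set.union_empty]
        exact ih
  have hX := IsBorel.openSet X
  have h4 := measure_mono hμ.prob IsBorel.univ (hX.union (hT.union hE)) hcover
  have h5 := measure_union_le hμ.prob hX (hT.union hE)
  have h6 := measure_union_le hμ.prob hT hE
  rw [hμ.prob.univ] at h4
  have h7 : (2 : R.Num)⁻¹ < 1 := by norm_num
  linarith

/-- If `z ∈ C`, the plays in which `z` is answered by a real outside of `D` form a null set. By
outer regularity it is covered by an open set of measure at most `1/2`, and the minimal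
cylinders contained in it are disjoint. -/
theorem exists_witnesses_of_mem (hAC : W.CountableChoiceReals) (hs : DefMap M s)
    (s0 : ∀ w, s (w, 0) = 0) (s1 : ∀ w n, w.1 n = 1 → s (w, n + 1) = s (w, n) + q n)
    (s2 : ∀ w n, w.1 n ≠ 1 → s (w, n + 1) = s (w, n)) (hμ : IsLaw P p z μ)
    (hq : ∀ w n, PlaysBelow P.fixed z w n → μ (cyl w n) = q (code (w, n)))
    (hT : W.IsBorel T) (hT0 : μ T = 0) (hQT : Q ⊆ T)
    (hQ : ∀ y w, Plays P.fixed z w → Plays P.random y w → (w ∈ Q ↔ ¬ (z ∈ C ↔ y ∈ D)))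
    (hz : z ∈ C) : ∃ X, Witnesses P s D z X := by
  obtain ⟨X₀, hTX, hX₀⟩ := exists_openSet_of_measure_eq_zero hμ.prob hAC hT hT0
    (ε := (2 : R.Num)⁻¹) (by positivity)
  -- the minimal sequences with a cylinder contained in the open set coded by `X₀`
  have hd := P.defMap_fixed
  let X : W.Real := ⟨{a | ∃ (w : W.Baire) (n : W.Nat), code (w, n) = a ∧
      PlaysBelow P.fixed z w n ∧ cyl w n ⊆ openSet X₀.1 ∧
      ∀ m, m < n → ¬ cyl w m ⊆ openSet X₀.1}, internal_setOf (by
    have := defMap_playsBelow (Γ := (W.Nat × W.Baire) × W.Nat) (g := fun _ => z)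
      (h := fun p => p.1.2) (k := fun p => p.2) hd (by fun_prop) (by fun_prop) (by fun_prop)
    refine DefMap.exists' (DefMap.exists' (DefMap.and (by fun_prop) (DefMap.and this ?_)))
    fun_prop)⟩
  refine ⟨X, ?_, ?_, ?_⟩
  · rintro a ⟨w, n, hc, hw, -⟩
    exact ⟨w, n, hc, hw⟩
  · intro w n hn
    let F : W.Nat → Set W.Baire := fun a => {v | w.1 a = 1 ∧ v ∈ codeSet a}
    have hF : DefMap M F := by simp only [F]; fun_prop
    have hFa : ∀ a, w.1 a = 1 → F a = codeSet a := fun a ha => by ext; simp [F, ha]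
    have hFa' : ∀ a, w.1 a ≠ 1 → F a = ∅ := fun a ha => by ext; simp [F, ha]
    have hB : ∀ a, W.IsBorel (F a) := fun a => by
      by_cases ha : w.1 a = 1
      · rw [hFa a ha]; exact IsBorel.codeSet a
      · rw [hFa' a ha]; exact IsBorel.empty
    have hU : DefMap M (fun n => μ (unionBelow F n)) :=
      defMap_measure hμ.prob (by fun_prop) (IsBorel.unionBelow hF hB)
    have hdisj : ∀ a b, a ∈ X.1 → b ∈ X.1 → a ≠ b → Disjoint (codeSet a) (codeSet b) := by
      rintro _ _ ⟨v₁, n₁, rfl, -, hv₁, hm₁⟩ ⟨v₂, n₂, rfl, -, hv₂, hm₂⟩ hne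
      rw [Set.disjoint_left, codeSet_code, codeSet_code]
      intro v h₁ h₂
      apply hne
      rcases lt_trichotomy n₁ n₂ with h | rfl | h
      · have := cyl_antitone v₂ h.le h₂
        rw [← cyl_eq_of_mem h₁, cyl_eq_of_mem this] at hv₁
        exact (hm₂ n₁ h hv₁).elim
      · rw [code_eq_iff.2 ⟨rfl, h₁⟩, code_eq_iff.2 ⟨rfl, h₂⟩]
      · have := cyl_antitone v₁ h.le h₁
        rw [← cyl_eq_of_mem h₂, cyl_eq_of_mem this] at hv₂
        exact (hm₁ n₂ h hv₂).elim
    -- by minimality the cylinders are disjoint, so the partial sums are measures of unions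
    have hsum : ∀ m, m ≤ n → s (w, m) = μ (unionBelow F m) := by
      refine ind (P := fun m => m ≤ n → s (w, m) = μ (unionBelow F m))
        (DefMap.imp (by fun_prop) (DefMap.eq (by fun_prop) hU)) ?_ fun m ih hm => ?_
      · intro _
        rw [unionBelow_zero, measure_empty hμ.prob, s0]
      · have hmn : m < n := (lt_add_one.2 le_rfl).trans_le hm
        rw [unionBelow_succ]
        by_cases hw : w.1 m = 1
        · have hmX := hn m hmn hw
          rw [s1 w m hw, ih hmn.le, measure_union hμ.prob (IsBorel.unionBelow hF hB m) (hB m)]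
          · obtain ⟨v, l, hc, hv, -⟩ := hmX
            rw [hFa m hw, ← hc, codeSet_code, hq v l hv]
          · rw [Set.disjoint_left, hFa m hw]
            rintro v ⟨k, hk, hwk, hvk⟩ hvm
            exact Set.disjoint_left.1 (hdisj k m (hn k (hk.trans hmn) hwk) hmX hk.ne) hvk hvm
        · rw [s2 w m hw, hFa' m hw, Set.union_empty]
          exact ih hmn.le
    rw [hsum n le_rfl]
    refine (measure_mono hμ.prob (IsBorel.unionBelow hF hB n) (IsBorel.openSet X₀) ?_).trans hX₀
    rintro v ⟨k, hk, hwk, hvk⟩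
    obtain ⟨v', l, hc, -, hsub, -⟩ := hn k hk hwk
    rw [← hc, codeSet_code] at hvk
    exact hsub hvk
  · intro y
    by_cases hy : y ∈ D
    · exact Or.inl hy
    obtain ⟨w, hw, hw'⟩ := exists_plays P z y
    have hwQ : w ∈ Q := (hQ y w hw hw').2 fun h => hy (h.1 hz)
    obtain ⟨n, hn, hmin⟩ := exists_least (W := W) (P := fun n => cyl w n ⊆ openSet X₀.1)
      (by fun_prop) (isOpenSet_iff.1 (isOpenSet_openSet X₀.1) w (hTX (hQT hwQ)))
    exact Or.inr ⟨code (w, n), ⟨w, n, rfl, fun i _ => hw i, hn, hmin⟩, w, n, rfl,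
      fun i _ => hw' i⟩

end

end Naturals

/-! ### The formula defining the set of reals with a witness -/

namespace NumTerm

/-- The numeral for `k`. -/
def num : ℕ → NumTerm
  | 0 => zero
  | k + 1 => add (num k) one

/-- The term for the polynomial pairing function. -/
def pair (s t : NumTerm) : NumTerm := add (mul (add s t) (add s t)) s

end NumTerm

namespace SOFormula

/-- Implication, expressed by negation and conjunction. -/
def imp (φ ψ : SOFormula) : SOFormula := neg (and φ (neg ψ))

/-- The relation with index `k` coded by the set variable `1` holds between `s` and `t`. This
variable is never quantified: it denotes the real parameter. -/
def rel (k : ℕ) (s t : NumTerm) : SOFormula :=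
  mem (NumTerm.pair (NumTerm.pair s t) (NumTerm.num k)) 1

/-- The finite sequence coded by the number variable `0` is compatible with the set variable `j`,
where the relations with indices `k` and `k + 1` express that some digit must be different from
`0` and from `1`. -/
def digits (k j : ℕ) : SOFormula :=
  allNum 1 (and (imp (rel k (.var 0) (.var 1)) (mem (.var 1) j))
    (imp (rel (k + 1) (.var 0) (.var 1)) (neg (mem (.var 1) j))))

/-- The set variable `2` witnesses that the set variable `0` belongs to the set under
consideration; `φ` is a formula about the set variable `3`. The three conjuncts express the three
fields of `Naturals.Witnesses`; in the second one, the relation with index `4` decodes a finite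
sequence of zeros and ones as a finite set, and the relation with index `5` says that the sum over
this set is at most `1/2`. -/
def witnessed (φ : SOFormula) : SOFormula :=
  exSet 2 (allSet 3 (and (allNum 0 (imp (mem (.var 0) 2) (digits 0 0)))
    (and (allNum 0 (imp (allNum 1 (imp (rel 4 (.var 0) (.var 1)) (mem (.var 1) 2)))
      (rel 5 (.var 0) (.var 0))))
      (imp (neg φ) (neg (allNum 0 (imp (mem (.var 0) 2) (neg (digits 2 3)))))))))

theorem isSigma_witnessed {φ : SOFormula} (h : φ.Arithmetical) : IsSigma 2 (witnessed φ) := by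
  refine .ex 2 (.all 3 (.base ?_))
  simp [imp, digits, rel, Arithmetical, h]

end SOFormula

namespace Naturals

variable {M : Type u} [Membership M M] [hZF : Fact (IsZF M)] {W : Naturals M}

theorem value_num (e : ℕ → W.Nat) (k : ℕ) : W.value e (NumTerm.num k) = k := by
  induction k with
  | zero => exact Nat.cast_zero.symm
  | succ k ih =>
    rw [NumTerm.num, value, ih, Nat.cast_succ]
    rfl

omit hZF in
theorem value_pair (e : ℕ → W.Nat) (s t : NumTerm) :
    W.value e (NumTerm.pair s t) = pair (W.value e s) (W.value e t) := rfl

omit hZF in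
theorem holds_imp {A : Set W.Real} {e : ℕ → W.Nat} {E : ℕ → W.Real} {φ ψ : SOFormula} :
    W.Holds A e E (φ.imp ψ) ↔ (W.Holds A e E φ → W.Holds A e E ψ) := by
  simp only [SOFormula.imp, Holds, not_and, not_not]

theorem holds_rel {A : Set W.Real} {e : ℕ → W.Nat} {E : ℕ → W.Real} {k : ℕ} {s t : NumTerm} :
    W.Holds A e E (SOFormula.rel k s t) ↔
      pair (pair (W.value e s) (W.value e t)) (k : W.Nat) ∈ (E 1).1 := by
  rw [SOFormula.rel, Holds, value_pair, value_pair, value_num]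

/-- A single real codes any finite number of definable relations. -/
theorem exists_real_coding {r : ℕ → W.Nat → W.Nat → Prop}
    (hr : ∀ k, DefMap M (fun p : W.Nat × W.Nat => r k p.1 p.2)) (N : ℕ) :
    ∃ Z : W.Real, ∀ k < N, ∀ a b, pair (pair a b) (k : W.Nat) ∈ Z.1 ↔ r k a b := by
  induction N with
  | zero => exact ⟨⟨{n | n = n}, internal_setOf (by fun_prop)⟩, fun k hk => by omega⟩
  | succ N ih =>
    obtain ⟨Z, hZ⟩ := ih
    have hr' : DefMap M (fun p : (W.Nat × W.Nat) × W.Nat => r N p.1.2 p.2) :=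
      (hr N).comp (g := fun p : (W.Nat × W.Nat) × W.Nat => (p.1.2, p.2)) (by fun_prop)
    refine ⟨⟨{n | (n ∈ Z.1 ∧ ¬ ∃ a b, n = pair (pair a b) (N : W.Nat)) ∨
      ∃ a b, r N a b ∧ n = pair (pair a b) (N : W.Nat)}, internal_setOf ?_⟩, ?_⟩
    · refine DefMap.or (by fun_prop) (DefMap.exists' (DefMap.exists' (DefMap.and hr' ?_)))
      fun_prop
    · intro k hk a b
      rcases Nat.lt_succ_iff_lt_or_eq.1 hk with hk | rfl
      · have hne : ∀ a' b', pair (pair a b) (k : W.Nat) ≠ pair (pair a' b') (N : W.Nat) :=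
          fun a' b' h => hk.ne (Nat.cast_injective (pair_inj h).2)
        refine Iff.trans ⟨?_, fun h => Or.inl ⟨h, ?_⟩⟩ (hZ k hk a b)
        · rintro (⟨h, -⟩ | ⟨a', b', -, h⟩)
          exacts [h, (hne _ _ h).elim]
        · rintro ⟨a', b', h⟩
          exact hne _ _ h
      · constructor
        · rintro (⟨-, h⟩ | ⟨a', b', h, h'⟩)
          · exact (h ⟨a, b, rfl⟩).elim
          · obtain ⟨h1, -⟩ := pair_inj h'
            obtain ⟨rfl, rfl⟩ := pair_inj h1
            exact h
        · exact fun h => Or.inr ⟨a, b, h, rfl⟩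

/-- The number `a` is not the code of a finite sequence whose digit at the position `f i`, if any,
is `v`. -/
def DigitNe (f : W.Nat → W.Nat) (v a i : W.Nat) : Prop :=
  ¬ ∃ (w : W.Baire) (n : W.Nat), code (w, n) = a ∧ (f i < n → w.1 (f i) = v)

theorem defMap_digitNe {f : W.Nat → W.Nat} (hf : DefMap M f) (v : W.Nat) :
    DefMap M (fun p : W.Nat × W.Nat => DigitNe f v p.1 p.2) := by
  unfold DigitNe
  fun_prop

/-- The form in which compatibility with `x` is expressed by the formula: the real `x` only occurs
in atomic formulas `i ∈ x`. If `a` is not a code, `DigitNe` holds for both digits and the left side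
fails. -/
theorem forall_digitNe_iff {f : W.Nat → W.Nat} {a : W.Nat} {x : W.Real} :
    (∀ i, (DigitNe f 0 a i → i ∈ x.1) ∧ (DigitNe f 1 a i → i ∉ x.1)) ↔
      ∃ w n, code (w, n) = a ∧ PlaysBelow f x w n := by
  constructor
  · intro h
    have hcode : ∃ (w : W.Baire) (n : W.Nat), code (w, n) = a := by
      by_contra hne
      have : ∀ v, DigitNe f v a 0 := fun v ⟨w, n, hc, _⟩ => hne ⟨w, n, hc⟩
      exact (h 0).2 (this 1) ((h 0).1 (this 0))
    obtain ⟨w, n, rfl⟩ := hcode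
    refine ⟨w, n, rfl, fun i hi => ?_⟩
    have key : ∀ v, ¬ DigitNe f v (code (w, n)) i → w.1 (f i) = v := by
      intro v hv
      obtain ⟨w', n', hc, hwv⟩ := not_not.1 hv
      obtain ⟨rfl, hw⟩ := code_eq_iff.1 hc
      rw [hw _ hi, hwv hi]
    by_cases hx : i ∈ x.1
    · rw [bit_eq_one.2 hx]
      exact key 1 fun h' => (h i).2 h' hx
    · rw [bit_eq_zero.2 hx]
      exact key 0 fun h' => hx ((h i).1 h')
  · rintro ⟨w, n, hc, hw⟩ i
    refine ⟨fun h => ?_, fun h hx => h ⟨w, n, hc, fun hi => ?_⟩⟩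
    · by_contra hx
      exact h ⟨w, n, hc, fun hi => by rw [hw i hi, bit_eq_zero.2 hx]⟩
    · rw [hw i hi, bit_eq_one.2 hx]

/-- Everything in the definition of `Witnesses` except for `z`, `X` and `D` is coded into a real
parameter. What remains is the quantifier over `X`, followed by the one over `y` and an arithmetical
condition on `z`, `X`, `y`. -/
theorem boldSigmaIn_of_witnesses {R : RealLine M} {P : W.Schedule}
    {s : W.Baire × W.Nat → R.Num} (hs : DefMap M s) {A C D : Set W.Real} {φ : SOFormula}
    (hφ : φ.Arithmetical) (hφD : ∀ e E, W.Holds A e E φ ↔ E 3 ∈ D)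
    (h : ∀ z, z ∈ C ↔ ∃ X, Witnesses P s D z X) : W.BoldSigmaIn 2 C A := by
  -- the relations occurring in the formula
  let r : ℕ → W.Nat → W.Nat → Prop := fun k a b => match k with
    | 0 => DigitNe P.fixed 0 a b
    | 1 => DigitNe P.fixed 1 a b
    | 2 => DigitNe P.random 0 a b
    | 3 => DigitNe P.random 1 a b
    | 4 => ∃ (w : W.Baire) (n : W.Nat), code (w, n) = a ∧ b < n ∧ w.1 b = 1
    | _ => ∀ (w : W.Baire) (n : W.Nat), code (w, n) = a → s (w, n) ≤ 2⁻¹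
  have hr : ∀ k, DefMap M (fun p : W.Nat × W.Nat => r k p.1 p.2) := by
    intro k
    match k with
    | 0 => exact defMap_digitNe P.defMap_fixed 0
    | 1 => exact defMap_digitNe P.defMap_fixed 1
    | 2 => exact defMap_digitNe P.defMap_random 0
    | 3 => exact defMap_digitNe P.defMap_random 1
    | 4 => simp only [r]; fun_prop
    | k + 5 => simp only [r]; fun_prop
  obtain ⟨Z, hZ⟩ := exists_real_coding hr 6
  refine ⟨SOFormula.witnessed φ, Z, SOFormula.isSigma_witnessed hφ, fun x => (h x).trans ?_⟩
  have hdig : ∀ (k j : ℕ) (e : ℕ → W.Nat) (E : ℕ → W.Real), k + 1 < 6 → E 1 = Z →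
      (W.Holds A e E (SOFormula.digits k j) ↔
        ∀ i, (r k (e 0) i → i ∈ (E j).1) ∧ (r (k + 1) (e 0) i → i ∉ (E j).1)) := by
    intro k j e E hk hE
    rw [SOFormula.digits, Holds]
    refine forall_congr' fun i => ?_
    rw [Holds, holds_imp, holds_imp, holds_rel, holds_rel, hE, hZ k (by omega),
      hZ (k + 1) hk]
    rfl
  rw [SOFormula.witnessed, Holds]
  refine exists_congr fun X => ?_
  -- quantification over `w` is replaced by quantification over codes of finite sequences
  have hsmall : (∀ w n, (∀ i, i < n → w.1 i = 1 → i ∈ X.1) → s (w, n) ≤ 2⁻¹) ↔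
      ∀ a, (∀ b, r 4 a b → b ∈ X.1) → r 5 a a := by
    constructor
    · rintro h a ha w n rfl
      exact h w n fun i hi hwi => ha i ⟨w, n, rfl, hi, hwi⟩
    · intro h w n hw
      refine h (code (w, n)) ?_ w n rfl
      rintro b ⟨w', n', hc, hb, hwb⟩
      obtain ⟨rfl, hw'⟩ := code_eq_iff.1 hc
      exact hw b hb (by rw [← hwb, hw' b hb])
  have hiff : ∀ Y : W.Real, W.Holds A (fun _ => W.zero) (Function.update
      (Function.update (fun j => if j = 0 then x else Z) 2 X) 3 Y)
      (.and (.allNum 0 (.imp (.mem (.var 0) 2) (.digits 0 0)))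
        (.and (.allNum 0 (.imp (.allNum 1 (.imp (.rel 4 (.var 0) (.var 1)) (.mem (.var 1) 2)))
          (.rel 5 (.var 0) (.var 0))))
          (.imp (.neg φ) (.neg (.allNum 0 (.imp (.mem (.var 0) 2) (.neg (.digits 2 3)))))))) ↔
      (∀ a ∈ X.1, ∃ w n, code (w, n) = a ∧ PlaysBelow P.fixed x w n) ∧
      (∀ w n, (∀ i, i < n → w.1 i = 1 → i ∈ X.1) → s (w, n) ≤ 2⁻¹) ∧
      (Y ∈ D ∨ ∃ a ∈ X.1, ∃ w n, code (w, n) = a ∧ PlaysBelow P.random Y w n) := by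
    intro Y
    rw [Holds, Holds, hsmall]
    refine and_congr ?_ (and_congr ?_ ?_)
    · rw [Holds]
      refine forall_congr' fun a => ?_
      rw [holds_imp, hdig 0 0 _ _ (by omega) (by simp)]
      refine imp_congr (by simp [Holds, value]) ?_
      rw [← forall_digitNe_iff]
      simp [r]
    · rw [Holds]
      refine forall_congr' fun a => ?_
      rw [holds_imp, holds_rel, Holds]
      refine imp_congr (forall_congr' fun b => ?_) ?_
      · rw [holds_imp, holds_rel]
        have h4 := hZ 4 (by omega) a b
        rw [Nat.cast_ofNat] at h4
        simp [Holds, value, h4]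
      · have h5 := hZ 5 (by omega) a a
        rw [Nat.cast_ofNat] at h5
        simp [value, h5]
    · rw [holds_imp, Holds, hφD, Holds, Holds, or_iff_not_imp_left]
      refine imp_congr (by simp) ?_
      rw [not_forall]
      refine exists_congr fun a => ?_
      simp only [holds_imp, Holds]
      rw [hdig 2 3 _ _ (by omega) (by simp), ← forall_digitNe_iff]
      simp [value, r]
  rw [Holds]
  refine ⟨fun hX Y => (hiff Y).2 ⟨hX.compatible, hX.small, hX.covers Y⟩, fun hX => ?_⟩
  obtain ⟨h1, h2, -⟩ := (hiff X).1 (hX X)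
  exact ⟨h1, h2, fun y => ((hiff y).1 (hX y)).2.2⟩

variable {Γ : Type*} [Coded M Γ] {R : RealLine M}

/-- The sets `C` and `D` are related by a strategy, with move probabilities `p`, which almost surely
answers `z` by a real `y` with `z ∈ C ↔ y ∈ D`; the set `Q` contains the plays in which this
fails. Then `C` is definable from `D`. -/
theorem boldSigmaIn_of_laws (hAC : W.CountableChoiceReals) (P : W.Schedule)
    {p : W.Baire × W.Nat → R.Num} (hp : DefMap M p)
    (hp' : ∀ w w' n, w' ∈ cyl w (n + 1) → p (w', n) = p (w, n)) {Q : Set W.Baire}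
    (hlaw : ∀ z, ∃ μ, IsLaw P p z μ ∧ ∃ T, W.IsBorel T ∧ Q ⊆ T ∧ μ T = 0)
    {A C D : Set W.Real} {φ : SOFormula} (hφ : φ.Arithmetical)
    (hφD : ∀ e E, W.Holds A e E φ ↔ E 3 ∈ D)
    (hQ : ∀ z y w, Plays P.fixed z w → Plays P.random y w → (w ∈ Q ↔ ¬ (z ∈ C ↔ y ∈ D)))
    (hQ' : ∀ z w, Plays P.fixed z w → (∀ y, ¬ Plays P.random y w) → w ∈ Q) :
    W.BoldSigmaIn 2 C A := by
  obtain ⟨q, hq, hqμ⟩ := exists_weight P hp hp'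
  obtain ⟨s, hs, s0, s1, s2⟩ := exists_partialSum W hq
  refine boldSigmaIn_of_witnesses (P := P) hs hφ hφD fun z => ?_
  obtain ⟨μ, hμ, T, hT, hQT, hT0⟩ := hlaw z
  refine ⟨fun hz => exists_witnesses_of_mem hAC hs s0 s1 s2 hμ (hqμ z μ hμ) hT hT0 hQT (hQ z) hz,
    ?_⟩
  rintro ⟨X, hX⟩
  by_contra hz
  exact not_witnesses_of_notMem hs s0 s1 s2 hμ (hqμ z μ hμ) hT hT0 hQT (hQ z) (hQ' z) hz X hX

/-! ### Strategies -/

instance setType_finSeq : SetType M W.FinSeq :=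
  setType_of_surjective defMap_restrict restrict_surjective

omit hZF in
@[fun_prop]
theorem defMap_lh {f : Γ → W.FinSeq} (hf : DefMap M f) : DefMap M (fun x => W.lh (f x)) := by
  have : DefMap M (fun s : W.FinSeq => W.lh s) := by
    refine ⟨fun s a => ∃ h, IsPair s a h, Dv.ex (Dv.isPair 1 2 0), ?_⟩
    rintro s m ⟨a, h, ha, hh, hp⟩
    refine ⟨a, ha, fun a' => ⟨fun ⟨h', hp'⟩ => (hp'.inj hp).1, ?_⟩⟩
    rintro rfl
    exact ⟨h, hp⟩
  exact this.comp hf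

theorem defMap_isEven_lh : DefMap M (fun s : W.FinSeq => W.IsEven (W.lh s)) := by
  unfold IsEven
  fun_prop

instance : SetType M {s : W.FinSeq // W.IsEven (W.lh s)} := setType_subtype defMap_isEven_lh

instance : SetType M {s : W.FinSeq // ¬ W.IsEven (W.lh s)} := setType_subtype defMap_isEven_lh.not

open Classical in
/-- The probability concentrated at `k`. -/
noncomputable def dirac (R : RealLine M) (k : W.Nat) : W.Prob R := by
  refine ⟨fun j => if j = k then 1 else 0, internal_fun (by fun_prop), fun j => ?_,
    fun n => if k < n then 1 else 0, internal_fun (by fun_prop),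
    if_neg (not_lt.2 (zero_le' k)), fun n => ?_, ?_, fun b hb => ?_⟩
  · dsimp only
    split_ifs <;> simp
  · rw [succ_eq]
    dsimp only
    rcases lt_trichotomy k n with h | rfl | h
    · rw [if_pos h, if_pos (h.trans (lt_add_one.2 le_rfl)), if_neg h.ne', _root_.add_zero]
    · rw [if_pos rfl, if_pos (lt_add_one.2 le_rfl), if_neg (lt_irrefl _), zero_add]
    · rw [if_neg h.not_gt, if_neg h.ne, if_neg, _root_.add_zero]
      exact fun h' => (lt_add_one.1 h').not_gt h
  · rintro _ ⟨n, rfl⟩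
    dsimp only
    split_ifs <;> simp
  · refine hb ⟨k + 1, if_pos (lt_add_one.2 le_rfl)⟩

@[fun_prop]
theorem defMap_dirac {f : Γ → W.Nat} (hf : DefMap M f) :
    DefMap M (fun x => dirac R (f x)) := by
  classical
  refine DefMap.of_val (DefMap.lam (f := fun x j => if j = f x then (1 : R.Num) else 0) ?_)
  fun_prop

theorem dirac_self (k : W.Nat) : (dirac R k).1 k = 1 := if_pos rfl

theorem dirac_ne {j k : W.Nat} (h : j ≠ k) : (dirac R k).1 j = 0 := if_neg h

/-- The pure strategy of playing the digits of the real `z` at the positions `f i`. -/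
theorem exists_pure {q : W.FinSeq → Prop} [SetType M {s : W.FinSeq // q s}] {f : W.Nat → W.Nat}
    (hf : DefMap M f) (hinj : ∀ {i j}, f i = f j → i = j) (z : W.Real) :
    ∃ σ : {σ : {s : W.FinSeq // q s} → W.Prob R // Internal M σ},
      ∀ s i, W.lh s.1 = f i → σ.1 s = dirac R (bit z i) := by
  classical
  refine ⟨⟨fun s => dirac R (if ∃ i, W.lh s.1 = f i ∧ i ∈ z.1 then 1 else 0),
    internal_fun (by fun_prop)⟩, fun s i hi => ?_⟩
  have : (∃ j, W.lh s.1 = f j ∧ j ∈ z.1) ↔ i ∈ z.1 := by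
    constructor
    · rintro ⟨j, hj, h⟩
      rwa [hinj (hi.symm.trans hj)]
    · exact fun h => ⟨i, hi, h⟩
  simp only [this]
  rfl

open Classical in
/-- The probability, according to the strategy `τ`, of the move `w n` after `w ↾ n`. -/
noncomputable def moveProb {q : W.FinSeq → Prop}
    (τ : {τ : {s : W.FinSeq // q s} → W.Prob R // Internal M τ}) (t : W.Baire × W.Nat) : R.Num :=
  if h : q (restrict t) then (τ.1 ⟨restrict t, h⟩).1 (t.1.1 t.2) else 0

theorem defMap_moveProb {q : W.FinSeq → Prop} [SetType M {s : W.FinSeq // q s}]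
    (τ : {τ : {s : W.FinSeq // q s} → W.Prob R // Internal M τ}) :
    DefMap M (moveProb τ) := by
  have hτ := defMap_of_internal τ.2
  obtain ⟨τ, hτ'⟩ := τ
  simp only at hτ
  refine DefMap.of_graph_iff (P := fun t r =>
    (∃ s : {s : W.FinSeq // q s}, s.1 = restrict t ∧ (τ s).1 (t.1.1 t.2) = r) ∨
      ((¬ ∃ s : {s : W.FinSeq // q s}, s.1 = restrict t) ∧ 0 = r)) (by fun_prop) fun t r => ?_
  unfold moveProb
  split_ifs with h
  · constructor
    · exact fun hr => Or.inl ⟨⟨_, h⟩, rfl, hr⟩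
    · rintro (⟨⟨s, hs⟩, rfl, hr⟩ | ⟨hne, -⟩)
      exacts [hr, (hne ⟨⟨_, h⟩, rfl⟩).elim]
  · constructor
    · exact fun hr => Or.inr ⟨fun ⟨s, hs⟩ => h (hs ▸ s.2), hr⟩
    · rintro (⟨s, hs, -⟩ | ⟨-, hr⟩)
      exacts [(h (hs ▸ s.2)).elim, hr]

theorem moveProb_eq_of_mem_cyl {q : W.FinSeq → Prop}
    (τ : {τ : {s : W.FinSeq // q s} → W.Prob R // Internal M τ}) (w w' : W.Baire) (n : W.Nat)
    (h : w' ∈ cyl w (n + 1)) : moveProb τ (w', n) = moveProb τ (w, n) := by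
  have h1 : restrict (w', n) = restrict (w, n) := by
    refine Subtype.ext (Sigma.ext rfl (heq_of_eq (funext fun i => ?_)))
    exact h i.1 (lt_trans (show i.1 < n from i.2) (lt_add_one.2 le_rfl))
  have h2 : w'.1 n = w.1 n := h n (lt_add_one.2 le_rfl)
  unfold moveProb
  dsimp only
  rw [h2]
  generalize restrict (w', n) = s at h1 ⊢
  rw [h1]

theorem IsOutcome.measure_cyl {σ : W.MixedI R} {τ : W.MixedII R} {μ : Set W.Baire → R.Num}
    (h : W.IsOutcome σ τ μ) (w : W.Baire) (n : W.Nat) :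
    μ (cyl w (n + 1)) = μ (cyl w n) * (W.next σ τ (restrict (w, n))).1 (w.1 n) := by
  rw [← cone_restrict w n, ← h.step (restrict (w, n)) (w.1 n), cone_restrict]
  congr 1
  ext v
  constructor
  · exact fun hv => ⟨cyl_antitone w (lt_add_one.2 le_rfl).le hv, hv n (lt_add_one.2 le_rfl)⟩
  · rintro ⟨hv, hvn⟩ i hi
    rcases (lt_add_one.1 hi).lt_or_eq with hi | rfl
    exacts [hv i hi, hvn]

omit hZF in
theorem isEven_double (i : W.Nat) : W.IsEven (i + i) := ⟨i, rfl⟩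

theorem not_isEven_double_add_one (i : W.Nat) : ¬ W.IsEven (i + i + 1) :=
  fun ⟨k, hk⟩ => double_ne k i hk.symm

/-- The schedule in which the real is played by player I. -/
noncomputable def scheduleI (W : Naturals M) : W.Schedule where
  fixed i := i + i
  random i := i + i + 1
  defMap_fixed := by fun_prop
  defMap_random := by fun_prop
  fixed_inj := double_inj
  random_inj h := double_inj (add_right_cancel h)
  fixed_ne_random := double_ne
  cover := even_or_odd

/-- The schedule in which the real is played by player II. -/
noncomputable def scheduleII (W : Naturals M) : W.Schedule where
  fixed i := i + i + 1
  random i := i + i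
  defMap_fixed := by fun_prop
  defMap_random := by fun_prop
  fixed_inj h := double_inj (add_right_cancel h)
  random_inj := double_inj
  fixed_ne_random i j := (double_ne j i).symm
  cover n := (even_or_odd n).symm

/-- The law of the play in which player I purely plays `z` against the mixed strategy `τ`. -/
theorem IsOutcome.isLaw_I {σ : W.MixedI R} {τ : W.MixedII R} {μ : Set W.Baire → R.Num}
    (h : W.IsOutcome σ τ μ) {z : W.Real}
    (hσ : ∀ s i, W.lh s.1 = i + i → σ.1 s = dirac R (bit z i)) :
    IsLaw (scheduleI W) (moveProb τ) z μ := by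
  have key : ∀ (w : W.Baire) (i : W.Nat),
      W.next σ τ (restrict (w, i + i)) = dirac R (bit z i) := fun w i => by
    have hE : W.IsEven (W.lh (restrict (w, i + i))) := isEven_double i
    rw [next, dif_pos hE]
    exact hσ _ i rfl
  refine ⟨h.isBorelProbability, fun w i hw => ?_, fun w i hw => ?_, fun w i => ?_⟩
  · simp only [scheduleI] at hw ⊢
    rw [h.measure_cyl, key, hw, dirac_self, mul_one]
  · simp only [scheduleI] at hw ⊢
    rw [h.measure_cyl, key, dirac_ne hw, MulZeroClass.mul_zero]
  · have hE : ¬ W.IsEven (W.lh (restrict (w, i + i + 1))) := not_isEven_double_add_one i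
    simp only [scheduleI]
    rw [h.measure_cyl, next, dif_neg hE, moveProb, dif_pos hE]

/-- The law of the play in which player II purely plays `z` against the mixed strategy `σ`. -/
theorem IsOutcome.isLaw_II {σ : W.MixedI R} {τ : W.MixedII R} {μ : Set W.Baire → R.Num}
    (h : W.IsOutcome σ τ μ) {z : W.Real}
    (hτ : ∀ s i, W.lh s.1 = i + i + 1 → τ.1 s = dirac R (bit z i)) :
    IsLaw (scheduleII W) (moveProb σ) z μ := by
  have key : ∀ (w : W.Baire) (i : W.Nat),
      W.next σ τ (restrict (w, i + i + 1)) = dirac R (bit z i) := fun w i => by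
    have hE : ¬ W.IsEven (W.lh (restrict (w, i + i + 1))) := not_isEven_double_add_one i
    rw [next, dif_neg hE]
    exact hτ _ i rfl
  refine ⟨h.isBorelProbability, fun w i hw => ?_, fun w i hw => ?_, fun w i => ?_⟩
  · simp only [scheduleII] at hw ⊢
    rw [h.measure_cyl, key, hw, dirac_self, mul_one]
  · simp only [scheduleII] at hw ⊢
    rw [h.measure_cyl, key, dirac_ne hw, MulZeroClass.mul_zero]
  · have hE : W.IsEven (W.lh (restrict (w, i + i))) := isEven_double i
    simp only [scheduleII]
    rw [h.measure_cyl, next, dif_pos hE, moveProb, dif_pos hE]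

/-! ### The game -/

/-- Player I wins `w` if the moves of player I are the digits of a real `x`, and the moves of
player II are not the digits of a real `y` with `x ∈ A ↔ y ∈ B`. -/
def payoff (A B : Set W.Real) : Set W.Baire :=
  {w | ∃ x, Plays (scheduleI W).fixed x w ∧
    ∀ y, Plays (scheduleI W).random y w → ¬ (x ∈ A ↔ y ∈ B)}

theorem internal_payoff (A B : {X : Set W.Real // Internal M X}) :
    Internal M (payoff A.1 B.1) := by
  refine internal_setOf ?_
  simp only [Plays, scheduleI]
  fun_prop

theorem Plays.unique {f : W.Nat → W.Nat} {x y : W.Real} {w : W.Baire} (hx : Plays f x w)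
    (hy : Plays f y w) : x = y := by
  refine Subtype.ext (Set.ext fun i => ?_)
  rw [← bit_eq_one, ← bit_eq_one, ← hx i, ← hy i]

end Naturals

end SetModel

open SetModel Naturals

theorem mainTheorem12 {M : Type u} [Membership M M] (hZF : SetModel.IsZF M)
    (W : SetModel.Naturals M) (hAC : W.CountableChoiceReals) (hBl : W.BlAD)
    (A B : Set W.Real) (hA : SetModel.Internal M A) (hB : SetModel.Internal M B) :
    W.BoldSigmaIn 2 A B ∨ W.BoldSigmaIn 2 B A := by
  have : Fact (IsZF M) := ⟨hZF⟩
  obtain ⟨R, hR⟩ := hBl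
  rcases hR (payoff A B) (internal_payoff ⟨A, hA⟩ ⟨B, hB⟩) with ⟨σ, hσ⟩ | ⟨τ, hτ⟩
  · right
    -- the strategy `σ` of player I almost surely answers `z` by a real `y` with `z ∈ B ↔ y ∉ A`
    refine boldSigmaIn_of_laws (R := R) hAC (scheduleII W) (defMap_moveProb σ)
      (moveProb_eq_of_mem_cyl σ) (Q := (payoff A B)ᶜ) (D := Aᶜ) (φ := .neg (.pred 3))
      (fun z => ?_) trivial (fun e E => Iff.rfl) (fun z y w hz hy => ?_) (fun z w hz hy => ?_)
    · obtain ⟨τ, hτ⟩ := exists_pure (R := R) (q := fun s => ¬ W.IsEven (W.lh s))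
        (scheduleII W).defMap_fixed (scheduleII W).fixed_inj z
      obtain ⟨μ, hμ, S, T, hS, -, hSA, -, -, hS1⟩ := hσ τ
      refine ⟨μ, hμ.isLaw_II hτ, Sᶜ, hS.compl, Set.compl_subset_compl.2 hSA, ?_⟩
      have := measure_diff hμ.isBorelProbability hS IsBorel.univ (Set.subset_univ S)
      rw [Set.compl_eq_univ_sdiff, this, hμ.isBorelProbability.univ, hS1, sub_self]
    · have : w ∈ payoff A B ↔ ¬ (y ∈ A ↔ z ∈ B) := by
        constructor
        · rintro ⟨x, hx, h⟩
          cases hx.unique hy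
          exact h z hz
        · intro h
          refine ⟨y, hy, fun z' hz' => ?_⟩
          cases Plays.unique hz' hz
          exact h
      rw [Set.mem_compl_iff, Set.mem_compl_iff, this]
      tauto
    · rintro ⟨x, hx, -⟩
      exact hy x hx
  · left
    -- the strategy `τ` of player II almost surely answers `z` by a real `y` with `z ∈ A ↔ y ∈ B`
    refine boldSigmaIn_of_laws (R := R) hAC (scheduleI W) (defMap_moveProb τ)
      (moveProb_eq_of_mem_cyl τ) (Q := payoff A B) (D := B) (φ := .pred 3)
      (fun z => ?_) trivial (fun e E => Iff.rfl) (fun z y w hz hy => ?_) (fun z w hz hy => ?_)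
    · obtain ⟨σ, hσ⟩ := exists_pure (R := R) (q := fun s => W.IsEven (W.lh s))
        (scheduleI W).defMap_fixed (scheduleI W).fixed_inj z
      obtain ⟨μ, hμ, S, T, hS, hT, hSA, hAT, hTS, hS0⟩ := hτ σ
      refine ⟨μ, hμ.isLaw_I hσ, T, hT, hAT, ?_⟩
      have := measure_diff hμ.isBorelProbability hS hT (hSA.trans hAT)
      rwa [hTS, hS0, sub_zero, eq_comm] at this
    · constructor
      · rintro ⟨x, hx, h⟩
        cases hx.unique hz
        exact h y hy
      · intro h
        refine ⟨z, hz, fun y' hy' => ?_⟩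
        cases Plays.unique hy' hy
        exact h
    · exact ⟨z, hz, fun y hy' => (hy y hy').elim⟩
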